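/- **Setting.** Let $u:\mathbb R^d\to\mathbb R$ be differentiable with $h=\nabla u$, and let $m,L,l>0$ be such that for all $x,y\in\mathbb R^d$ $$\langle h(x)-h(y),x-y\rangle\ge 2m|x-y|^2,\qquad |h(x)-h(y)|\le L(1+|x|+|y|)^l|x-y| .$$ For a step size $\lambda>0$ put $g(x)=h(x)-mx$, $r_\lambda=(L+m)\,(1/\sqrt\lambda)^{1/(l+2)}$, $R_\lambda=\sup_{|x|<r_\lambda}|g(x)|$ and define the tamed drift $$h_\lambda(x)=t(x)g(x)+R_\lambda s(x)x+mx,$$ where $t(x)=1$ if $|x|\le r_\lambda-1$, $t(x)=r_\lambda-|x|$ if $r_\lambda-1<|x|<r_\lambda$, $t(x)=0$ if $|x|\ge r_\lambda$; and $s(x)=0$ if $|x|\le r_\lambda-2$, $s(x)=|x|-r_\lambda+2$ if $r_\lambda-2<|x|<r_\lambda-1$, $s(x)=1$ if $r_\lambda-1\le|x|\le r_\lambda$, $s(x)=r_\lambda/|x|$ if $|x|\ge r_\lambda$. Let $\gamma>0$ and $\eta=e^{-\lambda\gamma/2}$. The tamed OBABO chain $(x_n,v_n)_{n\ge0}$ on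 $\mathbb R^d\times\mathbb R^d$ is given by $$\begin{aligned}x_{n+1}&=x_n+\lambda\big(\eta v_n+\sqrt{1-\eta^2}\,G_n\big)-\tfrac{\lambda^2}{2}h_\lambda(x_n),\\ v_{n+1}&=\eta^2v_n-\tfrac{\lambda\eta}{2}\big(h_\lambda(x_n)+h_\lambda(x_{n+1})\big)+\sqrt{1-\eta^2}\,\big(\eta G_n+G_n'\big),\end{aligned}$$ where $G_0,G_0',G_1,G_1',\dots$ are independent standard Gaussian vectors in $\mathbb R^d$, independent of $(x_0,v_0)$. A probability measure $\mu$ on $\mathbb R^{2d}$ satisfies an LSI with constant $C$ if for all bounded $f\in C^1(\mathbb R^{2d})$ with bounded gradient $$\int f^2\log f^2\,d\mu-\Big(\int f^2\,d\mu\Big)\log\Big(\int f^2\,d\mu\Big)\le C\int|\nabla f|^2\,d\mu$$ (so the standard Gaussian has constant $2$). **Theorem.** Let $M_\lambda\ge2$ be a Lipschitz constant of $h_\lambda$ (any number at least as large as its least Lipschitz constant), and suppose $\gamma\ge2\sqrt{M_\lambda}$ and $\lambda\le m/(33\gamma^3)$. Set $a=1/M_\lambda$, $b=1/\gamma$, $\kappa=m/(3\gamma)$,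 $r=\sqrt{1-\lambda\kappa}$, $C_1=8\sqrt{1-e^{-2\lambda\gamma}}$ and $S(x,v)=(x+bv,\sqrt{a-b^2}\,v)$. If the law of $(x_0,v_0)$ satisfies an LSI with constant $C_{LSI,0}$, then for every $n\in\mathbb N$ the law of $S(x_n,v_n)$ satisfies an LSI with constant at most $$(1-\lambda\kappa)^n\sqrt{1+a}\;C_{LSI,0}+\frac{1-r^{2n}}{1-r^2}\,C_1 .$$ -/

import Mathlib

open MeasureTheory ProbabilityTheory
open scoped NNReal

noncomputable section

/-- Position or velocity space `ℝᵈ` with the Euclidean norm. -/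
abbrev Vec (d : ℕ) : Type := EuclideanSpace ℝ (Fin d)

/-- Phase space `ℝᵈ × ℝᵈ ≅ ℝ²ᵈ` with the Euclidean norm (hence `WithLp 2`). -/
abbrev Phase (d : ℕ) : Type := WithLp 2 (Vec d × Vec d)

/-- Logarithmic Sobolev inequality with constant `C`, in the normalization in which the standard
Gaussian has constant `2`: for every bounded `C¹` function `f` with bounded derivative,
`Ent_μ(f²) = ∫ f² log f² dμ - (∫ f² dμ) log (∫ f² dμ) ≤ C ∫ |∇f|² dμ`.
For a probability measure all these integrals converge. -/
def SatisfiesLSI {E : Type*} [NormedAddCommGroup E] [NormedSpace ℝ E] [MeasurableSpace E]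
    (μ : Measure E) (C : ℝ) : Prop :=
  ∀ f : E → ℝ, ContDiff ℝ 1 f → (∃ K : ℝ, ∀ z, |f z| ≤ K ∧ ‖fderiv ℝ f z‖ ≤ K) →
    ∫ z, f z ^ 2 * Real.log (f z ^ 2) ∂μ - (∫ z, f z ^ 2 ∂μ) * Real.log (∫ z, f z ^ 2 ∂μ)
      ≤ C * ∫ z, ‖fderiv ℝ f z‖ ^ 2 ∂μ

/-- The (least) Lipschitz constant of a map. -/
def lipConst {E F : Type*} [PseudoEMetricSpace E] [PseudoEMetricSpace F] (f : E → F) : ℝ≥0 :=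
  sInf {K : ℝ≥0 | LipschitzWith K f}

/-- The taming radius `r_λ = (L + m) (1/√λ)^{1/(l+2)}`. -/
def tamingRadius (m L l lam : ℝ) : ℝ :=
  (L + m) * (1 / √lam) ^ (1 / (l + 2))

/-- The cut-off factor `t`, as a function of `ρ = |x|` and of the radius `R = r_λ`. -/
def cutT (R ρ : ℝ) : ℝ :=
  if ρ ≤ R - 1 then 1 else if ρ < R then R - ρ else 0

/-- The factor `s`, as a function of `ρ = |x|` and of the radius `R = r_λ`. -/
def cutS (R ρ : ℝ) : ℝ :=
  if ρ ≤ R - 2 then 0 else if ρ < R - 1 then ρ - R + 2 else if ρ ≤ R then 1 else R / ρ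

/-- `g(x) = h(x) - m x`. -/
def shifted {d : ℕ} (h : Vec d → Vec d) (m : ℝ) (x : Vec d) : Vec d :=
  h x - m • x

/-- `R_λ`, the supremum of `|g|` over the ball `B(0, r_λ)`. -/
def tamingSup {d : ℕ} (h : Vec d → Vec d) (m L l lam : ℝ) : ℝ :=
  sSup ((fun x => ‖shifted h m x‖) '' Metric.ball (0 : Vec d) (tamingRadius m L l lam))

/-- The tamed drift `h_λ(x) = t(x) g(x) + R_λ s(x) x + m x`. -/
def tamedDrift {d : ℕ} (h : Vec d → Vec d) (m L l lam : ℝ) (x : Vec d) : Vec d :=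
  cutT (tamingRadius m L l lam) ‖x‖ • shifted h m x
    + (tamingSup h m L l lam * cutS (tamingRadius m L l lam) ‖x‖) • x + m • x

/-- One step of the OBABO scheme with drift `b`, step size `lam` and friction `gam`, started at
`z = (x₀, v₀)` and driven by the Gaussian inputs `g` and `g'`. -/
def obaboStep {d : ℕ} (b : Vec d → Vec d) (lam gam : ℝ) (z : Phase d) (g g' : Vec d) : Phase d :=
  let η : ℝ := Real.exp (-(lam * gam / 2))
  let v₀' : Vec d := η • z.snd + √(1 - η ^ 2) • g
  let vhalf : Vec d := v₀' - (lam / 2) • b z.fst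
  let x₁ : Vec d := z.fst + lam • vhalf
  let v₁' : Vec d := vhalf - (lam / 2) • b x₁
  let v₁ : Vec d := η • v₁' + √(1 - η ^ 2) • g'
  WithLp.toLp 2 (x₁, v₁)

/-- The OBABO chain `z_n = (x_n, v_n)` started at `z₀` and driven by the inputs `(G_n, G'_n)`. -/
def obaboChain {d : ℕ} {Ω : Type*} (b : Vec d → Vec d) (lam gam : ℝ) (z₀ : Ω → Phase d)
    (G G' : ℕ → Ω → Vec d) : ℕ → Ω → Phase d
  | 0 => z₀
  | n + 1 => fun ω => obaboStep b lam gam (obaboChain b lam gam z₀ G G' n ω) (G n ω) (G' n ω)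

/-- The linear map `S(x, v) = (x + b v, √(a - b²) v)`. -/
def shear {d : ℕ} (a b : ℝ) (z : Phase d) : Phase d :=
  WithLp.toLp 2 (z.fst + b • z.snd, √(a - b ^ 2) • z.snd)

end

/-!
The Jacobian of the tamed drift is not symmetric: in the shell where the drift is switched off
it is a positive operator minus a rank-one term `⟨n, ·⟩ g`, with `n` the radial direction. Splitting
it there into symmetric and skew parts shows that, for almost every `x`, it is `m`-strongly monotone
and `(2M - m)`-cocoercive. Both properties are convex, so averaging over translations gives `C¹`
approximations of the drift with the same two properties, now globally and without any symmetry.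

For such a drift, strong monotonicity and cocoercivity suffice to make the quadratic form
`|x|² + 2b⟨x, v⟩ + a|v|² = |S(x, v)|²` contract by `1 - λκ` along an OBABO step. In the coordinates
`S(x, v)` the step is thus `√(1 - λκ)`-Lipschitz in the state and `√(1 - η²)`-Lipschitz in each of
its two Gaussian inputs. A map of independent variables with laws of constants `C` and `C'`,
`r`-Lipschitz in the first and `s`-Lipschitz in the second, has a law of constant `r² C + s² C'`;
hence one step turns `C` into `(1 - λκ) C + 4 (1 - η²)`, and `4 (1 - η²) ≤ C₁`. The resulting bound
does not depend on the approximation, and an LSI passes to pointwise limits.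

The constant `2` of the Gaussian comes from writing it as a sum of `k + 1` independent small
Gaussians: entropy is subadditive, each increment contributes a Bregman divergence of `x log x`, and
as `k → ∞` these divergences add up to at most half the Fisher information.
-/

open Filter Topology NNReal

/-! ### Entropy -/

section Bregman

/-- The Bregman divergence of `x ↦ x log x`, the excess of `x log x` over its tangent line at `c`;
it localizes the entropy. -/
noncomputable def bregman (x c : ℝ) : ℝ := x * Real.log x - x * Real.log c - x + c

theorem bregman_eq_mul_klFun {x c : ℝ} (hx : 0 < x) (hc : 0 < c) :
    bregman x c = c * InformationTheory.klFun (x / c) := by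
  rw [bregman, InformationTheory.klFun_apply, Real.log_div hx.ne' hc.ne']
  field_simp
  ring

theorem bregman_nonneg {x c : ℝ} (hx : 0 < x) (hc : 0 < c) : 0 ≤ bregman x c := by
  rw [bregman_eq_mul_klFun hx hc]
  exact mul_nonneg hc.le (InformationTheory.klFun_nonneg (div_pos hx hc).le)

theorem bregman_le_sq_div_two_mul_min {x c : ℝ} (hx : 0 < x) (hc : 0 < c) :
    bregman x c ≤ (x - c) ^ 2 / (2 * min x c) := by
  rcases le_total c x with hcx | hxc
  · have hlog : Real.log x - Real.log c ≤ (x / c - c / x) / 2 := by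
      rw [← Real.log_div hx.ne' hc.ne', ← inv_div x c, ← Real.sinh_log (div_pos hx hc)]
      exact Real.self_le_sinh_iff.2 (Real.log_nonneg ((one_le_div hc).2 hcx))
    calc bregman x c = x * (Real.log x - Real.log c) - x + c := by rw [bregman]; ring
      _ ≤ x * ((x / c - c / x) / 2) - x + c := by gcongr
      _ = (x - c) ^ 2 / (2 * min x c) := by rw [min_eq_right hcx]; field_simp; ring
  · have hlog : 2 * (c - x) / (c + x) ≤ Real.log c - Real.log x := by
      have h := Real.le_log_one_add_of_nonneg (div_nonneg (sub_nonneg.2 hxc) hx.le)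
      rw [one_add_div hx.ne', add_sub_cancel, Real.log_div hc.ne' hx.ne'] at h
      refine le_trans (le_of_eq ?_) h
      field_simp
      ring
    calc bregman x c = c - x - x * (Real.log c - Real.log x) := by rw [bregman]; ring
      _ ≤ c - x - x * (2 * (c - x) / (c + x)) := by gcongr
      _ = (x - c) ^ 2 / (x + c) := by field_simp; ring
      _ ≤ (x - c) ^ 2 / (2 * min x c) := by
        rw [min_eq_left hxc]
        gcongr
        linarith only [hxc]

theorem bregman_mem_Icc {δ K x c : ℝ} (hδ : 0 < δ) (hx : x ∈ Set.Icc δ K)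
    (hc : c ∈ Set.Icc δ K) : bregman x c ∈ Set.Icc 0 ((K - δ) ^ 2 / (2 * δ)) := by
  refine ⟨bregman_nonneg (hδ.trans_le hx.1) (hδ.trans_le hc.1),
    (bregman_le_sq_div_two_mul_min (hδ.trans_le hx.1) (hδ.trans_le hc.1)).trans ?_⟩
  have hsq : (x - c) ^ 2 ≤ (K - δ) ^ 2 :=
    sq_le_sq' (by linarith only [hx.1, hc.2]) (by linarith only [hx.2, hc.1])
  gcongr
  exact le_min hx.1 hc.1

theorem measurable_bregman : Measurable fun p : ℝ × ℝ => bregman p.1 p.2 := by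
  unfold bregman
  fun_prop

end Bregman

section Entropy

variable {E : Type*} [MeasurableSpace E] {μ : Measure E} {F H : E → ℝ} {δ K : ℝ}

/-- The entropy functional `Ent_μ(F) = ∫ F log F dμ - (∫ F dμ) log (∫ F dμ)`. -/
noncomputable def ent (μ : Measure E) (F : E → ℝ) : ℝ :=
  ∫ z, F z * Real.log (F z) ∂μ - (∫ z, F z ∂μ) * Real.log (∫ z, F z ∂μ)

theorem ent_map {E' : Type*} [MeasurableSpace E'] {T : E → E'} (hT : Measurable T) {F : E' → ℝ}
    (hF : Measurable F) : ent (μ.map T) F = ent μ fun z => F (T z) := by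
  rw [ent, ent, integral_map hT.aemeasurable (by fun_prop),
    integral_map hT.aemeasurable (by fun_prop)]

theorem integrable_mul_log [IsFiniteMeasure μ] (hF : Measurable F) (hH : Measurable H)
    (hδ : 0 < δ) (hFb : ∀ z, F z ∈ Set.Icc δ K) (hHb : ∀ z, H z ∈ Set.Icc δ K) :
    Integrable (fun z => F z * Real.log (H z)) μ := by
  refine (Integrable.of_mem_Icc (Real.log δ) (Real.log K) hH.log.aemeasurable
    (.of_forall fun z => ⟨Real.log_le_log hδ (hHb z).1,
      Real.log_le_log (hδ.trans_le (hHb z).1) (hHb z).2⟩)).bdd_mul (c := K)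
    hF.aestronglyMeasurable (.of_forall fun z => ?_)
  rw [Real.norm_of_nonneg (hδ.le.trans (hFb z).1)]
  exact (hFb z).2

theorem integral_mem_Icc [IsProbabilityMeasure μ] (hF : Measurable F)
    (hFb : ∀ z, F z ∈ Set.Icc δ K) : ∫ z, F z ∂μ ∈ Set.Icc δ K :=
  (convex_Icc δ K).integral_mem isClosed_Icc (.of_forall hFb)
    (.of_mem_Icc δ K hF.aemeasurable (.of_forall hFb))

theorem integral_bregman_mul [IsProbabilityMeasure μ] (hF : Measurable F) (hH : Measurable H)
    (hδ : 0 < δ) (hFb : ∀ z, F z ∈ Set.Icc δ K) (hHb : ∀ z, H z ∈ Set.Icc δ K) {c : ℝ}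
    (hc : 0 < c) :
    ∫ z, bregman (F z) (c * H z) ∂μ = ∫ z, F z * Real.log (F z) ∂μ
      - ∫ z, F z * Real.log (H z) ∂μ - (∫ z, F z ∂μ) * (Real.log c + 1) + c * ∫ z, H z ∂μ := by
  have hF_int : Integrable F μ := .of_mem_Icc δ K hF.aemeasurable (.of_forall hFb)
  have hH_int : Integrable H μ := .of_mem_Icc δ K hH.aemeasurable (.of_forall hHb)
  have hFF := integrable_mul_log (μ := μ) hF hF hδ hFb hFb
  have hFH := integrable_mul_log (μ := μ) hF hH hδ hFb hHb
  have hexpand (z : E) : bregman (F z) (c * H z) = F z * Real.log (F z) - F z * Real.log (H z)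
      - F z * (Real.log c + 1) + c * H z := by
    rw [bregman, Real.log_mul hc.ne' (hδ.trans_le (hHb z).1).ne']
    ring
  simp_rw [hexpand]
  rw [integral_add (by fun_prop) (by fun_prop), integral_sub (by fun_prop) (by fun_prop),
    integral_sub hFF hFH, integral_mul_const, integral_const_mul]

theorem integral_bregman_const [IsProbabilityMeasure μ] (hF : Measurable F) (hδ : 0 < δ)
    (hFb : ∀ z, F z ∈ Set.Icc δ K) {c : ℝ} (hc : 0 < c) :
    ∫ z, bregman (F z) c ∂μ = ent μ F + bregman (∫ z, F z ∂μ) c := by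
  have hone (_ : E) : (1 : ℝ) ∈ Set.Icc (min δ 1) (max K 1) :=
    ⟨min_le_right _ _, le_max_right _ _⟩
  have hFb' (z : E) : F z ∈ Set.Icc (min δ 1) (max K 1) :=
    ⟨(min_le_left _ _).trans (hFb z).1, (hFb z).2.trans (le_max_left _ _)⟩
  have h := integral_bregman_mul (μ := μ) hF measurable_const (lt_min hδ one_pos) hFb' hone hc
  simp only [mul_one, Real.log_one, mul_zero, integral_zero, integral_const, probReal_univ,
    one_smul] at h
  rw [h, ent, bregman]
  ring

theorem ent_nonneg [IsProbabilityMeasure μ] (hF : Measurable F) (hδ : 0 < δ)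
    (hFb : ∀ z, F z ∈ Set.Icc δ K) : 0 ≤ ent μ F := by
  have hmean := hδ.trans_le (integral_mem_Icc (μ := μ) hF hFb).1
  have h := integral_bregman_const (μ := μ) hF hδ hFb hmean
  rw [show bregman (∫ z, F z ∂μ) (∫ z, F z ∂μ) = 0 by rw [bregman]; ring, add_zero] at h
  rw [← h]
  exact integral_nonneg fun z => bregman_nonneg (hδ.trans_le (hFb z).1) hmean

theorem ent_le_integral_bregman [IsProbabilityMeasure μ] (hF : Measurable F) (hδ : 0 < δ)
    (hFb : ∀ z, F z ∈ Set.Icc δ K) {c : ℝ} (hc : 0 < c) : ent μ F ≤ ∫ z, bregman (F z) c ∂μ := by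
  rw [integral_bregman_const hF hδ hFb hc]
  exact le_add_of_nonneg_right
    (bregman_nonneg (hδ.trans_le (integral_mem_Icc (μ := μ) hF hFb).1) hc)

theorem integral_mul_log_le_ent_add [IsProbabilityMeasure μ] (hF : Measurable F)
    (hH : Measurable H) (hδ : 0 < δ) (hFb : ∀ z, F z ∈ Set.Icc δ K)
    (hHb : ∀ z, H z ∈ Set.Icc δ K) :
    ∫ z, F z * Real.log (H z) ∂μ ≤ ent μ F + (∫ z, F z ∂μ) * Real.log (∫ z, H z ∂μ) := by
  have hF_pos := hδ.trans_le (integral_mem_Icc (μ := μ) hF hFb).1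
  have hH_pos := hδ.trans_le (integral_mem_Icc (μ := μ) hH hHb).1
  have hc := div_pos hF_pos hH_pos
  have h := integral_bregman_mul (μ := μ) hF hH hδ hFb hHb hc
  rw [Real.log_div hF_pos.ne' hH_pos.ne', div_mul_cancel₀ _ hH_pos.ne'] at h
  have hnonneg : 0 ≤ ∫ z, bregman (F z) ((∫ z, F z ∂μ) / (∫ z, H z ∂μ) * H z) ∂μ :=
    integral_nonneg fun z =>
      bregman_nonneg (hδ.trans_le (hFb z).1) (mul_pos hc (hδ.trans_le (hHb z).1))
  rw [ent]
  linarith only [h, hnonneg]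

theorem tendsto_ent [IsFiniteMeasure μ] {F : ℕ → E → ℝ} {F' : E → ℝ}
    (hF : ∀ n, Measurable (F n)) (hFb : ∀ n z, F n z ∈ Set.Icc 0 K)
    (hlim : ∀ z, Tendsto (fun n => F n z) atTop (𝓝 (F' z))) :
    Tendsto (fun n => ent μ (F n)) atTop (𝓝 (ent μ F')) := by
  obtain ⟨B, hB⟩ := (isCompact_Icc (a := 0) (b := K)).exists_bound_of_continuousOn
    Real.continuous_mul_log.continuousOn
  have hmean : Tendsto (fun n => ∫ z, F n z ∂μ) atTop (𝓝 (∫ z, F' z ∂μ)) := by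
    refine tendsto_integral_of_dominated_convergence (fun _ => K)
      (fun n => (hF n).aestronglyMeasurable) (integrable_const K)
      (fun n => .of_forall fun z => ?_) (.of_forall hlim)
    rw [Real.norm_of_nonneg (hFb n z).1]
    exact (hFb n z).2
  have hlog : Tendsto (fun n => ∫ z, F n z * Real.log (F n z) ∂μ) atTop
      (𝓝 (∫ z, F' z * Real.log (F' z) ∂μ)) :=
    tendsto_integral_of_dominated_convergence (fun _ => B)
      (fun n => ((hF n).mul (hF n).log).aestronglyMeasurable) (integrable_const B)
      (fun n => .of_forall fun z => hB _ (hFb n z))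
      (.of_forall fun z => (Real.continuous_mul_log.tendsto _).comp (hlim z))
  exact hlog.sub ((Real.continuous_mul_log.tendsto _).comp hmean)

end Entropy

section EntropyProd

variable {E W : Type*} [MeasurableSpace E] [MeasurableSpace W] {μ : Measure E} {ν : Measure W}
  [IsProbabilityMeasure μ] [IsProbabilityMeasure ν] {F : E × W → ℝ} {δ K : ℝ}

theorem measurable_integral_section (hF : Measurable F) :
    Measurable fun x => ∫ y, F (x, y) ∂ν :=
  hF.stronglyMeasurable.integral_prod_right'.measurable

theorem integral_section_mem_Icc (hF : Measurable F) (hFb : ∀ z, F z ∈ Set.Icc δ K) (x : E) :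
    ∫ y, F (x, y) ∂ν ∈ Set.Icc δ K :=
  integral_mem_Icc (by fun_prop) fun _ => hFb _

theorem integrable_ent_section (hF : Measurable F) (hδ : 0 < δ)
    (hFb : ∀ z, F z ∈ Set.Icc δ K) : Integrable (fun x => ent ν fun y => F (x, y)) μ :=
  (integrable_mul_log (μ := μ.prod ν) hF hF hδ hFb hFb).integral_prod_left.sub
    (integrable_mul_log (measurable_integral_section hF) (measurable_integral_section hF) hδ
      (integral_section_mem_Icc hF hFb) (integral_section_mem_Icc hF hFb))

theorem ent_prod_eq (hF : Measurable F) (hδ : 0 < δ) (hFb : ∀ z, F z ∈ Set.Icc δ K) :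
    ent (μ.prod ν) F =
      ∫ x, ent ν (fun y => F (x, y)) ∂μ + ent μ fun x => ∫ y, F (x, y) ∂ν := by
  have hF_int : Integrable F (μ.prod ν) := .of_mem_Icc δ K hF.aemeasurable (.of_forall hFb)
  have hlog_int := integrable_mul_log (μ := μ.prod ν) hF hF hδ hFb hFb
  simp only [ent]
  rw [integral_sub hlog_int.integral_prod_left
    (integrable_mul_log (measurable_integral_section hF) (measurable_integral_section hF) hδ
      (integral_section_mem_Icc hF hFb) (integral_section_mem_Icc hF hFb)),
    ← integral_prod _ hlog_int, ← integral_prod _ hF_int]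
  ring

theorem ent_integral_le (hF : Measurable F) (hδ : 0 < δ) (hFb : ∀ z, F z ∈ Set.Icc δ K) :
    ent μ (fun x => ∫ y, F (x, y) ∂ν) ≤ ∫ y, ent μ (fun x => F (x, y)) ∂ν := by
  set A : E → ℝ := fun x => ∫ y, F (x, y) ∂ν with hA_def
  have hA : Measurable A := measurable_integral_section hF
  have hAb : ∀ x, A x ∈ Set.Icc δ K := integral_section_mem_Icc hF hFb
  have hF_int : Integrable F (μ.prod ν) := .of_mem_Icc δ K hF.aemeasurable (.of_forall hFb)
  have hFA_int : Integrable (fun z : E × W => F z * Real.log (A z.1)) (μ.prod ν) :=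
    integrable_mul_log hF (by fun_prop) hδ hFb fun z => hAb z.1
  have hent_int : Integrable (fun y => ent μ fun x => F (x, y)) ν :=
    integrable_ent_section (F := fun z : W × E => F z.swap) (by fun_prop) hδ fun z => hFb z.swap
  have hgibbs := integral_mono (μ := ν) hFA_int.integral_prod_right
    (hent_int.add (hF_int.integral_prod_right.mul_const (Real.log (∫ x, A x ∂μ))))
    fun y => integral_mul_log_le_ent_add (μ := μ) (F := fun x => F (x, y)) (by fun_prop) hA hδ
      (fun x => hFb (x, y)) hAb
  have hlog : ∫ y, ∫ x, F (x, y) * Real.log (A x) ∂μ ∂ν = ∫ x, A x * Real.log (A x) ∂μ := by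
    rw [← integral_prod_symm _ hFA_int, integral_prod _ hFA_int]
    simp only [integral_mul_const, hA_def]
  simp only [Pi.add_apply] at hgibbs
  rw [hlog, integral_add hent_int (hF_int.integral_prod_right.mul_const _), integral_mul_const,
    ← integral_prod_symm _ hF_int, integral_prod _ hF_int] at hgibbs
  rw [ent]
  linarith only [hgibbs]

theorem ent_prod_le (hF : Measurable F) (hδ : 0 < δ) (hFb : ∀ z, F z ∈ Set.Icc δ K) :
    ent (μ.prod ν) F ≤
      ∫ x, ent ν (fun y => F (x, y)) ∂μ + ∫ y, ent μ (fun x => F (x, y)) ∂ν := by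
  rw [ent_prod_eq hF hδ hFb]
  exact add_le_add_right (ent_integral_le hF hδ hFb) _

end EntropyProd

/-! ### Logarithmic Sobolev inequalities -/

section SqrtRegularization

theorem sqrt_sq_add_sq_mem_Icc {x δ K : ℝ} (hδ : 0 ≤ δ) (hx : |x| ≤ K) :
    √(x ^ 2 + δ ^ 2) ∈ Set.Icc δ (K + δ) := by
  have hK : 0 ≤ K := (abs_nonneg _).trans hx
  have hsq : x ^ 2 ≤ K ^ 2 := sq_le_sq' (neg_le_of_abs_le hx) (le_of_abs_le hx)
  refine ⟨Real.le_sqrt_of_sq_le (le_add_of_nonneg_left (sq_nonneg _)), ?_⟩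
  rw [Real.sqrt_le_left (by positivity)]
  linarith only [hsq, mul_nonneg hK hδ, add_sq K δ]

variable {E : Type*} [NormedAddCommGroup E] [NormedSpace ℝ E] {f : E → ℝ} {δ : ℝ}

theorem contDiff_sqrt_sq_add_sq (hf : ContDiff ℝ 1 f) (hδ : 0 < δ) :
    ContDiff ℝ 1 fun z => √(f z ^ 2 + δ ^ 2) :=
  ((hf.pow 2).add contDiff_const).sqrt fun _ => by positivity

theorem norm_fderiv_sqrt_sq_add_sq_le (hf : ContDiff ℝ 1 f) (hδ : 0 < δ) (z : E) :
    ‖fderiv ℝ (fun z => √(f z ^ 2 + δ ^ 2)) z‖ ≤ ‖fderiv ℝ f z‖ := by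
  have hpos : 0 < f z ^ 2 + δ ^ 2 := by positivity
  have hderiv : HasFDerivAt (fun z => √(f z ^ 2 + δ ^ 2))
      ((f z / √(f z ^ 2 + δ ^ 2)) • fderiv ℝ f z) z := by
    refine ((((hf.differentiable one_ne_zero z).hasFDerivAt.pow 2).add_const
      (δ ^ 2)).sqrt hpos.ne').congr_fderiv ?_
    ext y
    simp only [smul_apply, smul_eq_mul, nsmul_eq_mul, Nat.cast_ofNat, Nat.add_one_sub_one, pow_one]
    field_simp
  have hle : |f z / √(f z ^ 2 + δ ^ 2)| ≤ 1 := by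
    rw [abs_div, abs_of_pos (Real.sqrt_pos.2 hpos), div_le_one (Real.sqrt_pos.2 hpos)]
    exact Real.abs_le_sqrt (le_add_of_nonneg_right (sq_nonneg δ))
  rw [hderiv.fderiv, norm_smul, Real.norm_eq_abs]
  exact mul_le_of_le_one_left (norm_nonneg _) hle

end SqrtRegularization

theorem continuous_norm_fderiv_sq {E : Type*} [NormedAddCommGroup E] [NormedSpace ℝ E]
    {f : E → ℝ} (hf : ContDiff ℝ 1 f) : Continuous fun z => ‖fderiv ℝ f z‖ ^ 2 :=
  (hf.continuous_fderiv one_ne_zero).norm.pow 2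

section LSI

variable {E : Type*} [NormedAddCommGroup E] [NormedSpace ℝ E] [MeasurableSpace E] {μ : Measure E}
  {C C' : ℝ}

theorem satisfiesLSI_iff : SatisfiesLSI μ C ↔
    ∀ f : E → ℝ, ContDiff ℝ 1 f → (∃ K : ℝ, ∀ z, |f z| ≤ K ∧ ‖fderiv ℝ f z‖ ≤ K) →
      ent μ (fun z => f z ^ 2) ≤ C * ∫ z, ‖fderiv ℝ f z‖ ^ 2 ∂μ := Iff.rfl

theorem SatisfiesLSI.mono (h : SatisfiesLSI μ C) (hC : C ≤ C') : SatisfiesLSI μ C' :=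
  fun f hf hK => (h f hf hK).trans
    (mul_le_mul_of_nonneg_right hC (integral_nonneg fun _ => sq_nonneg _))

theorem satisfiesLSI_of_subsingleton [Subsingleton E] [IsProbabilityMeasure μ] :
    SatisfiesLSI μ C := by
  rw [satisfiesLSI_iff]
  intro f _ _
  obtain ⟨c, rfl⟩ : ∃ c : ℝ, f = fun _ => c :=
    ⟨f 0, funext fun z => congrArg f (Subsingleton.elim z 0)⟩
  simp [ent]

theorem integrable_norm_fderiv_comp_sq {Ω : Type*} [MeasurableSpace Ω] {P : Measure Ω}
    [IsFiniteMeasure P] [OpensMeasurableSpace E] {f : E → ℝ} (hf : ContDiff ℝ 1 f) {K : ℝ}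
    (hfK : ∀ z, ‖fderiv ℝ f z‖ ≤ K) {X : Ω → E} (hX : Measurable X) :
    Integrable (fun ω => ‖fderiv ℝ f (X ω)‖ ^ 2) P :=
  .of_mem_Icc 0 (K ^ 2)
    ((continuous_norm_fderiv_sq hf).measurable.comp hX).aemeasurable
    (.of_forall fun ω => ⟨sq_nonneg _, pow_le_pow_left₀ (norm_nonneg _) (hfK (X ω)) 2⟩)

theorem satisfiesLSI_of_pos [OpensMeasurableSpace E] [IsProbabilityMeasure μ] (hC : 0 ≤ C)
    (h : ∀ f : E → ℝ, ContDiff ℝ 1 f → ∀ δ K : ℝ, 0 < δ → (∀ z, f z ∈ Set.Icc δ K) →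
      (∀ z, ‖fderiv ℝ f z‖ ≤ K) → ent μ (fun z => f z ^ 2) ≤ C * ∫ z, ‖fderiv ℝ f z‖ ^ 2 ∂μ) :
    SatisfiesLSI μ C := by
  rw [satisfiesLSI_iff]
  rintro f hf ⟨K, hK⟩
  have hf_int : Integrable (fun z => ‖fderiv ℝ f z‖ ^ 2) μ :=
    integrable_norm_fderiv_comp_sq hf (fun z => (hK z).2) measurable_id
  let δ (n : ℕ) : ℝ := 1 / (n + 1)
  have hδ (n : ℕ) : 0 < δ n := Nat.one_div_pos_of_nat
  have hδ_le (n : ℕ) : δ n ≤ 1 := by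
    simpa [δ] using Nat.one_div_le_one_div (α := ℝ) n.zero_le
  have hreg (n : ℕ) : ent μ (fun z => f z ^ 2 + δ n ^ 2) ≤ C * ∫ z, ‖fderiv ℝ f z‖ ^ 2 ∂μ := by
    have hcd := contDiff_sqrt_sq_add_sq hf (hδ n)
    have hfderiv (z : E) := norm_fderiv_sqrt_sq_add_sq_le hf (hδ n) z
    have hent := h _ hcd (δ n) (K + δ n) (hδ n)
      (fun z => sqrt_sq_add_sq_mem_Icc (hδ n).le (hK z).1)
      fun z => (hfderiv z).trans ((hK z).2.trans (le_add_of_nonneg_right (hδ n).le))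
    simp only [Real.sq_sqrt (add_nonneg (sq_nonneg _) (sq_nonneg _))] at hent
    refine hent.trans (mul_le_mul_of_nonneg_left (integral_mono_of_nonneg
      (.of_forall fun z => sq_nonneg _) hf_int (.of_forall fun z => ?_)) hC)
    exact pow_le_pow_left₀ (norm_nonneg _) (hfderiv z) 2
  have hfm : Measurable f := hf.continuous.measurable
  refine le_of_tendsto' (tendsto_ent (K := K ^ 2 + 1) (fun n => by fun_prop)
    (fun n z => ⟨by positivity, ?_⟩) fun z => ?_) hreg
  · exact add_le_add (sq_le_sq' (neg_le_of_abs_le (hK z).1) (le_of_abs_le (hK z).1))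
      (pow_le_one₀ (hδ n).le (hδ_le n))
  · simpa [δ] using (tendsto_one_div_add_atTop_nhds_zero_nat.pow 2).const_add (f z ^ 2)

theorem satisfiesLSI_map_iff [BorelSpace E] {Ω : Type*} [MeasurableSpace Ω] {P : Measure Ω}
    {X : Ω → E} (hX : Measurable X) : SatisfiesLSI (P.map X) C ↔
    ∀ f : E → ℝ, ContDiff ℝ 1 f → (∃ K : ℝ, ∀ z, |f z| ≤ K ∧ ‖fderiv ℝ f z‖ ≤ K) →
      ent P (fun ω => f (X ω) ^ 2) ≤ C * ∫ ω, ‖fderiv ℝ f (X ω)‖ ^ 2 ∂P := by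
  rw [satisfiesLSI_iff]
  refine forall₃_congr fun f hf _ => ?_
  rw [ent_map hX (hf.continuous.measurable.pow_const 2), integral_map hX.aemeasurable
    (continuous_norm_fderiv_sq hf).aestronglyMeasurable]

theorem satisfiesLSI_of_tendsto [BorelSpace E] {Ω : Type*} [MeasurableSpace Ω] {P : Measure Ω}
    [IsProbabilityMeasure P] {X : ℕ → Ω → E} {Y : Ω → E} (hX : ∀ k, Measurable (X k))
    (hY : Measurable Y) (hlim : ∀ ω, Tendsto (fun k => X k ω) atTop (𝓝 (Y ω)))
    (h : ∀ k, SatisfiesLSI (P.map (X k)) C) : SatisfiesLSI (P.map Y) C := by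
  rw [satisfiesLSI_map_iff hY]
  rintro f hf ⟨K, hK⟩
  have hfm : Measurable f := hf.continuous.measurable
  have hgrad := continuous_norm_fderiv_sq hf
  have hent : Tendsto (fun k => ent P fun ω => f (X k ω) ^ 2) atTop
      (𝓝 (ent P fun ω => f (Y ω) ^ 2)) :=
    tendsto_ent (K := K ^ 2) (fun k => by have := hX k; fun_prop)
      (fun k ω => ⟨sq_nonneg _, sq_le_sq' (neg_le_of_abs_le (hK _).1) (le_of_abs_le (hK _).1)⟩)
      fun ω => ((hf.continuous.tendsto _).comp (hlim ω)).pow 2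
  have hint : Tendsto (fun k => ∫ ω, ‖fderiv ℝ f (X k ω)‖ ^ 2 ∂P) atTop
      (𝓝 (∫ ω, ‖fderiv ℝ f (Y ω)‖ ^ 2 ∂P)) := by
    refine tendsto_integral_of_dominated_convergence (fun _ => K ^ 2)
      (fun k => (hgrad.measurable.comp (hX k)).aestronglyMeasurable) (integrable_const _)
      (fun k => .of_forall fun ω => ?_) (.of_forall fun ω => (hgrad.tendsto _).comp (hlim ω))
    rw [norm_pow, norm_norm]
    exact pow_le_pow_left₀ (norm_nonneg _) (hK (X k ω)).2 2
  exact le_of_tendsto_of_tendsto' hent (hint.const_mul C)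
    fun k => (satisfiesLSI_map_iff (hX k)).1 (h k) f hf ⟨K, hK⟩

theorem SatisfiesLSI.nonneg [Nontrivial E] [OpensMeasurableSpace E] [IsProbabilityMeasure μ]
    (h : SatisfiesLSI μ C) : 0 ≤ C := by
  obtain ⟨x, hx⟩ := exists_ne (0 : E)
  obtain ⟨ℓ, hℓ, -⟩ := exists_dual_vector ℝ x (norm_ne_zero_iff.2 hx)
  -- A bounded test function whose derivative vanishes nowhere.
  let f (z : E) : ℝ := Real.arctan (ℓ z) + 2
  have hf : ContDiff ℝ 1 f := ℓ.contDiff.arctan.add contDiff_const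
  have hf_mem (z : E) : f z ∈ Set.Icc (2 - Real.pi / 2) (2 + Real.pi / 2) :=
    ⟨by linarith only [Real.neg_pi_div_two_lt_arctan (ℓ z), show f z = _ from rfl],
      by linarith only [Real.arctan_lt_pi_div_two (ℓ z), show f z = _ from rfl]⟩
  have hlow : 0 < 2 - Real.pi / 2 := by linarith only [Real.pi_lt_four]
  have hf_fderiv (z : E) : ‖fderiv ℝ f z‖ = 1 / (1 + ℓ z ^ 2) := by
    rw [((ℓ.hasFDerivAt.arctan).add_const 2).fderiv, norm_smul, hℓ, mul_one,
      Real.norm_of_nonneg (by positivity)]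
  have hf_le (z : E) : ‖fderiv ℝ f z‖ ≤ 2 + Real.pi / 2 := by
    rw [hf_fderiv]
    refine (div_le_self zero_le_one (le_add_of_nonneg_right (sq_nonneg _))).trans ?_
    linarith only [Real.pi_pos]
  have hent : 0 ≤ ent μ fun z => f z ^ 2 :=
    ent_nonneg (hf.continuous.measurable.pow_const 2) (pow_pos hlow 2) fun z =>
      ⟨pow_le_pow_left₀ hlow.le (hf_mem z).1 2,
        pow_le_pow_left₀ (hlow.le.trans (hf_mem z).1) (hf_mem z).2 2⟩
  have hpos : 0 < ∫ z, ‖fderiv ℝ f z‖ ^ 2 ∂μ := by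
    have hint : Integrable (fun z => ‖fderiv ℝ f z‖ ^ 2) μ :=
      integrable_norm_fderiv_comp_sq hf hf_le measurable_id
    have hsupp : Function.support (fun z => ‖fderiv ℝ f z‖ ^ 2) = Set.univ :=
      Set.eq_univ_of_forall fun z => by
        simp only [Function.mem_support, hf_fderiv]
        positivity
    rw [integral_pos_iff_support_of_nonneg (fun z => sq_nonneg _) hint, hsupp, measure_univ]
    exact one_pos
  have hLSI := satisfiesLSI_iff.1 h f hf ⟨2 + Real.pi / 2, fun z =>
    ⟨by rw [abs_of_pos (hlow.trans_le (hf_mem z).1)]; exact (hf_mem z).2, hf_le z⟩⟩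
  exact nonneg_of_mul_nonneg_left (hent.trans hLSI) hpos

end LSI

section Map

variable {E W E' : Type*} [NormedAddCommGroup E] [NormedSpace ℝ E] [MeasurableSpace E]
  [BorelSpace E] [NormedAddCommGroup W] [NormedSpace ℝ W] [MeasurableSpace W] [BorelSpace W]
  [NormedAddCommGroup E'] [NormedSpace ℝ E'] [MeasurableSpace E'] [BorelSpace E']
  {μ : Measure E} {ν : Measure W} {C C' : ℝ}

theorem SatisfiesLSI.map_lipschitz [IsFiniteMeasure μ] (hμ : SatisfiesLSI μ C) (hC : 0 ≤ C)
    {T : E → E'} (hT : ContDiff ℝ 1 T) {r : ℝ≥0} (hr : LipschitzWith r T) :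
    SatisfiesLSI (μ.map T) (r ^ 2 * C) := by
  have hTm : Measurable T := hT.continuous.measurable
  rw [satisfiesLSI_map_iff hTm]
  rintro f hf ⟨K, hK⟩
  have hcomp (x : E) : ‖fderiv ℝ (f ∘ T) x‖ ≤ r * ‖fderiv ℝ f (T x)‖ := by
    rw [fderiv_comp x (hf.differentiable one_ne_zero _) (hT.differentiable one_ne_zero _), mul_comm]
    exact (ContinuousLinearMap.opNorm_comp_le _ _).trans
      (mul_le_mul_of_nonneg_left (norm_fderiv_le_of_lipschitz ℝ hr) (norm_nonneg _))
  have hcomp_le (x : E) : ‖fderiv ℝ (f ∘ T) x‖ ≤ max K (r * K) :=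
    (hcomp x).trans ((mul_le_mul_of_nonneg_left (hK _).2 r.coe_nonneg).trans (le_max_right _ _))
  calc ent μ (fun x => f (T x) ^ 2)
      ≤ C * ∫ x, ‖fderiv ℝ (f ∘ T) x‖ ^ 2 ∂μ := satisfiesLSI_iff.1 hμ _ (hf.comp hT)
        ⟨max K (r * K), fun x => ⟨(hK _).1.trans (le_max_left _ _), hcomp_le x⟩⟩
    _ ≤ C * ∫ x, r ^ 2 * ‖fderiv ℝ f (T x)‖ ^ 2 ∂μ := by
        refine mul_le_mul_of_nonneg_left (integral_mono_of_nonneg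
          (.of_forall fun x => sq_nonneg _) ((integrable_norm_fderiv_comp_sq hf
            (fun z => (hK z).2) hTm).const_mul _) (.of_forall fun x => ?_)) hC
        simpa only [mul_pow] using pow_le_pow_left₀ (norm_nonneg _) (hcomp x) 2
    _ = r ^ 2 * C * ∫ x, ‖fderiv ℝ f (T x)‖ ^ 2 ∂μ := by rw [integral_const_mul]; ring

theorem SatisfiesLSI.map_prod [SecondCountableTopologyEither E W] [IsProbabilityMeasure μ]
    [IsProbabilityMeasure ν] (hμ : SatisfiesLSI μ C) (hν : SatisfiesLSI ν C') (hC : 0 ≤ C)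
    (hC' : 0 ≤ C') {T : E × W → E'} (hT : ContDiff ℝ 1 T) {r s : ℝ≥0}
    (hr : ∀ y, LipschitzWith r fun x => T (x, y)) (hs : ∀ x, LipschitzWith s fun y => T (x, y)) :
    SatisfiesLSI ((μ.prod ν).map T) (r ^ 2 * C + s ^ 2 * C') := by
  have hTm : Measurable T := hT.continuous.measurable
  have := Measure.isProbabilityMeasure_map (μ := μ.prod ν) hTm.aemeasurable
  refine satisfiesLSI_of_pos (by positivity) fun f hf δ K hδ hfb hfd => ?_
  have hfK (z : E') : |f z| ≤ K ∧ ‖fderiv ℝ f z‖ ≤ K :=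
    ⟨by rw [abs_of_pos (hδ.trans_le (hfb z).1)]; exact (hfb z).2, hfd z⟩
  have hfT : Measurable fun p : E × W => f (T p) ^ 2 :=
    (hf.continuous.measurable.comp hTm).pow_const 2
  have hfb_sq (p : E × W) : f (T p) ^ 2 ∈ Set.Icc (δ ^ 2) (K ^ 2) :=
    ⟨pow_le_pow_left₀ hδ.le (hfb _).1 2, pow_le_pow_left₀ (hδ.le.trans (hfb _).1) (hfb _).2 2⟩
  have hint : Integrable (fun p => ‖fderiv ℝ f (T p)‖ ^ 2) (μ.prod ν) :=
    integrable_norm_fderiv_comp_sq hf hfd hTm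
  have hleft := integral_mono (μ := ν) (integrable_ent_section (F := fun p => f (T p.swap) ^ 2)
      (hfT.comp measurable_swap) (pow_pos hδ 2) fun p => hfb_sq p.swap)
    (hint.integral_prod_right.const_mul (r ^ 2 * C)) fun y =>
      (satisfiesLSI_map_iff (by fun_prop)).1 (hμ.map_lipschitz hC
        (hT.comp (contDiff_id.prodMk contDiff_const)) (hr y)) f hf ⟨K, hfK⟩
  have hright := integral_mono (μ := μ) (integrable_ent_section (ν := ν) hfT (pow_pos hδ 2) hfb_sq)
    (hint.integral_prod_left.const_mul (s ^ 2 * C')) fun x =>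
      (satisfiesLSI_map_iff (by fun_prop)).1 (hν.map_lipschitz hC'
        (hT.comp (contDiff_const.prodMk contDiff_id)) (hs x)) f hf ⟨K, hfK⟩
  rw [integral_const_mul, ← integral_prod_symm _ hint] at hleft
  rw [integral_const_mul, ← integral_prod _ hint] at hright
  have htensor := ent_prod_le (μ := μ) (ν := ν) hfT (pow_pos hδ 2) hfb_sq
  rw [ent_map hTm (hf.continuous.measurable.pow_const 2),
    integral_map hTm.aemeasurable (continuous_norm_fderiv_sq hf).aestronglyMeasurable]
  simp only [Prod.swap_prod_mk] at hleft
  linarith only [htensor, hleft, hright]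

end Map

/-! ### The Gaussian logarithmic Sobolev inequality -/

section Convolution

variable {W : Type*} [MeasurableSpace W] {μ ν : Measure W} {F : W → ℝ} {δ K : ℝ}

/-- The mean Bregman divergence created by adding to `x` an increment of law `ν`; the entropy
under a convolution power of `ν` is estimated by these increments. -/
noncomputable def meanBregman [Add W] (ν : Measure W) (F : W → ℝ) (x : W) : ℝ :=
  ∫ g, bregman (F (x + g)) (F x) ∂ν

theorem measurable_bregman_add [Add W] [MeasurableAdd₂ W] (hF : Measurable F) :
    Measurable fun p : W × W => bregman (F (p.1 + p.2)) (F p.1) :=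
  measurable_bregman.comp (f := fun p : W × W => (F (p.1 + p.2), F p.1)) (by fun_prop)

theorem measurable_meanBregman [Add W] [MeasurableAdd₂ W] [IsProbabilityMeasure ν]
    (hF : Measurable F) : Measurable (meanBregman ν F) :=
  measurable_integral_section (measurable_bregman_add hF)

theorem meanBregman_mem_Icc [Add W] [MeasurableAdd₂ W] [IsProbabilityMeasure ν]
    (hF : Measurable F) (hδ : 0 < δ) (hFb : ∀ z, F z ∈ Set.Icc δ K) (x : W) :
    meanBregman ν F x ∈ Set.Icc 0 ((K - δ) ^ 2 / (2 * δ)) :=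
  integral_section_mem_Icc (measurable_bregman_add hF)
    (fun p => bregman_mem_Icc hδ (hFb _) (hFb p.1)) x

theorem ent_dirac (hF : Measurable F) (x : W) : ent (Measure.dirac x) F = 0 := by
  have hlog : Measurable fun z => F z * Real.log (F z) := by fun_prop
  rw [ent, integral_dirac' _ _ hlog.stronglyMeasurable,
    integral_dirac' _ _ hF.stronglyMeasurable, sub_self]

theorem ent_conv_le [AddMonoid W] [MeasurableAdd₂ W] [IsProbabilityMeasure μ]
    [IsProbabilityMeasure ν] (hF : Measurable F) (hδ : 0 < δ) (hFb : ∀ z, F z ∈ Set.Icc δ K) :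
    ent (μ ∗ ν) F ≤ ∫ y, ent μ (fun x => F (x + y)) ∂ν + ∫ x, meanBregman ν F x ∂μ := by
  have hF_add : Measurable fun p : W × W => F (p.1 + p.2) := by fun_prop
  have hsection := integral_mono (μ := μ)
    (integrable_ent_section (ν := ν) hF_add hδ fun p => hFb (p.1 + p.2))
    (.of_mem_Icc 0 _ (measurable_meanBregman hF).aemeasurable
      (.of_forall (meanBregman_mem_Icc (ν := ν) hF hδ hFb)))
    fun x => ent_le_integral_bregman (F := fun g => F (x + g)) (by fun_prop) hδ
      (fun g => hFb (x + g)) (hδ.trans_le (hFb x).1)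
  rw [Measure.conv, ent_map measurable_add hF]
  linarith only [hsection, ent_prod_le (μ := μ) (ν := ν) hF_add hδ fun p => hFb (p.1 + p.2)]

theorem ent_conv_pow_le [AddCommMonoid W] [MeasurableAdd₂ W] [IsProbabilityMeasure ν]
    {ρ : ℕ → Measure W} [∀ k, IsProbabilityMeasure (ρ k)] (hρ₀ : ρ 0 = Measure.dirac 0)
    (hρ : ∀ k, ρ (k + 1) = ρ k ∗ ν) (k : ℕ) (hF : Measurable F) (hδ : 0 < δ)
    (hFb : ∀ z, F z ∈ Set.Icc δ K) :
    ent (ρ (k + 1)) F ≤ (k + 1) * ∫ x, meanBregman ν F x ∂(ρ k) := by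
  induction k generalizing F with
  | zero =>
    have h := ent_conv_le (μ := ρ 0) (ν := ν) hF hδ hFb
    have hdirac (y : W) : ent (ρ 0) (fun x => F (x + y)) = 0 := by
      rw [hρ₀, ent_dirac (by fun_prop)]
    simpa [hρ, hdirac] using h
  | succ k ih =>
    have hmean := measurable_meanBregman (ν := ν) hF
    have hmean_int : Integrable (fun p : W × W => meanBregman ν F (p.1 + p.2)) ((ρ k).prod ν) :=
      .of_mem_Icc 0 _ (hmean.comp measurable_add).aemeasurable
        (.of_forall fun p => meanBregman_mem_Icc hF hδ hFb _)
    have hent_int : Integrable (fun y => ent (ρ (k + 1)) fun x => F (x + y)) ν :=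
      integrable_ent_section (F := fun p : W × W => F (p.2 + p.1)) (by fun_prop) hδ fun p => hFb _
    have hshift (x y : W) : meanBregman ν (fun z => F (z + y)) x = meanBregman ν F (x + y) := by
      simp only [meanBregman, add_right_comm]
    have hprev := integral_mono hent_int (hmean_int.integral_prod_right.const_mul _) fun y => by
      simpa only [hshift] using ih (F := fun x => F (x + y)) (by fun_prop) fun z => hFb _
    have hconv : ∫ x, meanBregman ν F x ∂(ρ (k + 1)) =
        ∫ y, ∫ x, meanBregman ν F (x + y) ∂(ρ k) ∂ν := by
      rw [hρ, Measure.conv, integral_map (by fun_prop) hmean.aestronglyMeasurable,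
        integral_prod_symm _ hmean_int]
    rw [integral_const_mul, ← hconv] at hprev
    have h := ent_conv_le (μ := ρ (k + 1)) (ν := ν) hF hδ hFb
    rw [← hρ] at h
    push_cast
    linarith only [h, hprev]

end Convolution

theorem tendsto_slope_along {E : Type*} [NormedAddCommGroup E] [NormedSpace ℝ E] {F : E → ℝ}
    {F' : StrongDual ℝ E} {x : E} (hF : HasStrictFDerivAt F F' x) {p : ℕ → E}
    (hp : Tendsto p atTop (𝓝 x)) {s : ℕ → ℝ} (hs : Tendsto s atTop (𝓝 0)) (hs_pos : ∀ n, 0 < s n)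
    (g : E) :
    Tendsto (fun n => (F (p n + s n • g) - F (p n)) / s n) atTop (𝓝 (F' g)) := by
  have hp' : Tendsto (fun n => p n + s n • g) atTop (𝓝 x) := by
    simpa using hp.add (hs.smul_const g)
  have hincr : (fun n => (p n + s n • g) - p n) =O[atTop] s :=
    .of_bound ‖g‖ (.of_forall fun n => by rw [add_sub_cancel_left, norm_smul, mul_comm])
  have hlittle :=
    ((hF.isLittleO.comp_tendsto (hp'.prodMk_nhds hp)).trans_isBigO hincr).tendsto_div_nhds_zero
  rw [← zero_add (F' g)]
  refine (hlittle.add_const (F' g)).congr fun n => ?_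
  have := (hs_pos n).ne'
  simp only [Function.comp_apply, add_sub_cancel_left, map_smul, smul_eq_mul]
  field_simp
  ring

section SlopeEnergy

variable {E : Type*} [NormedAddCommGroup E] [NormedSpace ℝ E] {F : E → ℝ} {δ L s : ℝ}

/-- The discrete counterpart, along the increment `s • g`, of the Fisher information density
`(F' x g) ^ 2 / (2 * F x)`. -/
noncomputable def slopeEnergy (F : E → ℝ) (s : ℝ) (x g : E) : ℝ :=
  ((F (x + s • g) - F x) / s) ^ 2 / (2 * min (F (x + s • g)) (F x))

theorem bregman_le_sq_mul_slopeEnergy (hs : s ≠ 0) {x g : E} (hx : 0 < F x)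
    (hxg : 0 < F (x + s • g)) :
    bregman (F (x + s • g)) (F x) ≤ s ^ 2 * slopeEnergy F s x g := by
  rw [slopeEnergy, ← mul_div_assoc, ← mul_pow, mul_div_cancel₀ _ hs]
  exact bregman_le_sq_div_two_mul_min hxg hx

theorem measurable_slopeEnergy [MeasurableSpace E] [BorelSpace E] [SecondCountableTopology E]
    (hF : Measurable F) (q s : ℝ) :
    Measurable fun p : E × E => slopeEnergy F s (q • p.1) p.2 := by
  unfold slopeEnergy
  fun_prop

theorem norm_slopeEnergy_le (hF : Differentiable ℝ F) (hδ : 0 < δ) (hFδ : ∀ z, δ ≤ F z)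
    (hFd : ∀ z, ‖fderiv ℝ F z‖ ≤ L) (hs : 0 < s) (x g : E) :
    ‖slopeEnergy F s x g‖ ≤ L ^ 2 / (2 * δ) * ‖g‖ ^ 2 := by
  have hmin : δ ≤ min (F (x + s • g)) (F x) := le_min (hFδ _) (hFδ _)
  have hmean : ‖F (x + s • g) - F x‖ ≤ L * ‖x + s • g - x‖ :=
    convex_univ.norm_image_sub_le_of_norm_fderiv_le (fun z _ => hF z) (fun z _ => hFd z)
      (Set.mem_univ _) (Set.mem_univ _)
  have hslope : |(F (x + s • g) - F x) / s| ≤ L * ‖g‖ := by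
    rw [add_sub_cancel_left, norm_smul, Real.norm_of_nonneg hs.le, Real.norm_eq_abs,
      mul_left_comm] at hmean
    rwa [abs_div, abs_of_pos hs, div_le_iff₀' hs]
  rw [slopeEnergy, Real.norm_of_nonneg (div_nonneg (sq_nonneg _) (by linarith only [hδ, hmin])),
    ← sq_abs, div_mul_eq_mul_div, ← mul_pow]
  gcongr

theorem tendsto_slopeEnergy {F' : StrongDual ℝ E} {x : E} (hF : HasStrictFDerivAt F F' x)
    (hx : 0 < F x) {p : ℕ → E} (hp : Tendsto p atTop (𝓝 x)) {s : ℕ → ℝ}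
    (hs : Tendsto s atTop (𝓝 0)) (hs_pos : ∀ n, 0 < s n) (g : E) :
    Tendsto (fun n => slopeEnergy F (s n) (p n) g) atTop (𝓝 (F' g ^ 2 / (2 * F x))) := by
  have hcont := hF.hasFDerivAt.continuousAt.tendsto
  have hp' : Tendsto (fun n => p n + s n • g) atTop (𝓝 x) := by
    simpa using hp.add (hs.smul_const g)
  have hmin := ((hcont.comp hp').min (hcont.comp hp)).const_mul 2
  rw [min_self] at hmin
  exact ((tendsto_slope_along hF hp hs hs_pos g).pow 2).div hmin (by positivity)

end SlopeEnergy

section Gaussian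

variable {W : Type*} [NormedAddCommGroup W] [InnerProductSpace ℝ W] [MeasurableSpace W]
  [BorelSpace W] [FiniteDimensional ℝ W] {F : W → ℝ} {δ K L : ℝ}

instance isProbabilityMeasure_map_smul_stdGaussian (c : ℝ) :
    IsProbabilityMeasure ((stdGaussian W).map (c • ·)) :=
  Measure.isProbabilityMeasure_map (by fun_prop)

theorem map_smul_stdGaussian_conv (α β : ℝ) :
    (stdGaussian W).map (α • ·) ∗ (stdGaussian W).map (β • ·) =
      (stdGaussian W).map (√(α ^ 2 + β ^ 2) • ·) := by
  have hnorm (c : ℝ) (t : W) : (‖c • t‖ : ℂ) ^ 2 = (c ^ 2 * ‖t‖ ^ 2 : ℝ) := by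
    rw [← Complex.ofReal_pow, norm_smul, mul_pow, Real.norm_eq_abs, sq_abs]
  refine Measure.ext_of_charFun (funext fun t => ?_)
  simp only [charFun_conv, charFun_map_smul, charFun_stdGaussian, ← Complex.exp_add, hnorm]
  rw [Real.sq_sqrt (by positivity)]
  push_cast
  ring_nf

theorem ent_stdGaussian_le_integral_bregman (k : ℕ) (hF : Measurable F) (hδ : 0 < δ)
    (hFb : ∀ z, F z ∈ Set.Icc δ K) :
    ent (stdGaussian W) F ≤ (k + 1) * ∫ p, bregman
      (F (√(k / (k + 1)) • p.1 + √(1 / (k + 1)) • p.2)) (F (√(k / (k + 1)) • p.1))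
        ∂((stdGaussian W).prod (stdGaussian W)) := by
  let ρ (j : ℕ) : Measure W := (stdGaussian W).map (√(j / (k + 1)) • ·)
  let ν : Measure W := (stdGaussian W).map (√(1 / (k + 1)) • ·)
  have hρ₀ : ρ 0 = Measure.dirac 0 := by simp [ρ]
  have hρ (j : ℕ) : ρ (j + 1) = ρ j ∗ ν := by
    rw [map_smul_stdGaussian_conv, Real.sq_sqrt (by positivity), Real.sq_sqrt (by positivity),
      ← add_div]
    simp only [ρ, Nat.cast_add_one]
  have hlast : ρ (k + 1) = stdGaussian W := by
    simp only [ρ, Nat.cast_add_one, div_self (Nat.cast_add_one_ne_zero (R := ℝ) k), Real.sqrt_one,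
      one_smul, Measure.map_id']
  have h := ent_conv_pow_le hρ₀ hρ k hF hδ hFb
  have hbreg : Measurable fun p : W × W => bregman
      (F (√(k / (k + 1)) • p.1 + √(1 / (k + 1)) • p.2)) (F (√(k / (k + 1)) • p.1)) :=
    measurable_bregman.comp (f := fun p : W × W =>
      (F (√(k / (k + 1)) • p.1 + √(1 / (k + 1)) • p.2), F (√(k / (k + 1)) • p.1))) (by fun_prop)
  rw [hlast, integral_map (by fun_prop) (measurable_meanBregman hF).aestronglyMeasurable] at h
  refine h.trans_eq ?_
  rw [integral_prod _ (.of_mem_Icc 0 _ hbreg.aemeasurable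
    (.of_forall fun p => bregman_mem_Icc hδ (hFb _) (hFb _)))]
  congr with x
  exact integral_map (by fun_prop)
    ((measurable_bregman_add hF).comp measurable_prodMk_left).aestronglyMeasurable

theorem integral_sq_stdGaussian (ℓ : StrongDual ℝ W) :
    ∫ g, ℓ g ^ 2 ∂(stdGaussian W) = ‖ℓ‖ ^ 2 := by
  rw [← variance_dual_stdGaussian ℓ, variance_of_integral_eq_zero (by fun_prop)
    (integral_strongDual_stdGaussian ℓ)]

theorem integrable_norm_sq_stdGaussian : Integrable (fun g : W => ‖g‖ ^ 2) (stdGaussian W) :=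
  IsGaussian.memLp_two_id.integrable_norm_pow two_ne_zero

theorem integrable_slopeEnergy_stdGaussian (hF : Differentiable ℝ F) (hδ : 0 < δ)
    (hFδ : ∀ z, δ ≤ F z) (hFd : ∀ z, ‖fderiv ℝ F z‖ ≤ L) (q : ℝ) {s : ℝ} (hs : 0 < s) :
    Integrable (fun p : W × W => slopeEnergy F s (q • p.1) p.2)
      ((stdGaussian W).prod (stdGaussian W)) :=
  ((integrable_norm_sq_stdGaussian.comp_snd _).const_mul _).mono'
    (measurable_slopeEnergy hF.continuous.measurable q s).aestronglyMeasurable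
    (.of_forall fun _ => norm_slopeEnergy_le hF hδ hFδ hFd hs _ _)

theorem tendsto_integral_slopeEnergy (hF : ContDiff ℝ 1 F) (hδ : 0 < δ) (hFδ : ∀ z, δ ≤ F z)
    (hFd : ∀ z, ‖fderiv ℝ F z‖ ≤ L) {q s : ℕ → ℝ} (hq : Tendsto q atTop (𝓝 1))
    (hs : Tendsto s atTop (𝓝 0)) (hs_pos : ∀ n, 0 < s n) :
    Tendsto (fun n => ∫ p, slopeEnergy F (s n) (q n • p.1) p.2
        ∂((stdGaussian W).prod (stdGaussian W))) atTop
      (𝓝 (∫ z, ‖fderiv ℝ F z‖ ^ 2 / (2 * F z) ∂(stdGaussian W))) := by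
  have hdom : Integrable (fun p : W × W => L ^ 2 / (2 * δ) * ‖p.2‖ ^ 2)
      ((stdGaussian W).prod (stdGaussian W)) :=
    (integrable_norm_sq_stdGaussian.comp_snd _).const_mul _
  have hint (n : ℕ) := integrable_slopeEnergy_stdGaussian (W := W)
    (hF.differentiable one_ne_zero) hδ hFδ hFd (q n) (hs_pos n)
  have hle (n : ℕ) (p : W × W) :=
    norm_slopeEnergy_le (hF.differentiable one_ne_zero) hδ hFδ hFd (hs_pos n) (q n • p.1) p.2
  have hlim (p : W × W) : Tendsto (fun n => slopeEnergy F (s n) (q n • p.1) p.2) atTop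
      (𝓝 (fderiv ℝ F p.1 p.2 ^ 2 / (2 * F p.1))) :=
    tendsto_slopeEnergy (hF.contDiffAt.hasStrictFDerivAt one_ne_zero) (hδ.trans_le (hFδ p.1))
      (by simpa using hq.smul_const p.1) hs hs_pos p.2
  have hlim_int : Integrable (fun p : W × W => fderiv ℝ F p.1 p.2 ^ 2 / (2 * F p.1))
      ((stdGaussian W).prod (stdGaussian W)) :=
    hdom.mono' (aestronglyMeasurable_of_tendsto_ae atTop (fun n => (hint n).aestronglyMeasurable)
      (.of_forall hlim)) (.of_forall fun p => le_of_tendsto' (hlim p).norm fun n => hle n p)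
  have hfubini := integral_prod _ hlim_int
  simp only [integral_div, integral_sq_stdGaussian] at hfubini
  rw [← hfubini]
  exact tendsto_integral_of_dominated_convergence _ (fun n => (hint n).aestronglyMeasurable) hdom
    (fun n => .of_forall (hle n)) (.of_forall hlim)

theorem ent_stdGaussian_le_integral_fderiv (hF : ContDiff ℝ 1 F) (hδ : 0 < δ)
    (hFb : ∀ z, F z ∈ Set.Icc δ K) (hFd : ∀ z, ‖fderiv ℝ F z‖ ≤ L) :
    ent (stdGaussian W) F ≤ ∫ z, ‖fderiv ℝ F z‖ ^ 2 / (2 * F z) ∂(stdGaussian W) := by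
  have hq : Tendsto (fun k : ℕ => √(k / (k + 1) : ℝ)) atTop (𝓝 1) := by
    simpa using (tendsto_natCast_div_add_atTop (1 : ℝ)).sqrt
  have hs : Tendsto (fun k : ℕ => √(1 / (k + 1) : ℝ)) atTop (𝓝 0) := by
    simpa using (tendsto_one_div_add_atTop_nhds_zero_nat (𝕜 := ℝ)).sqrt
  have hs_pos (k : ℕ) : 0 < √(1 / (k + 1) : ℝ) := Real.sqrt_pos.2 Nat.one_div_pos_of_nat
  refine ge_of_tendsto' (tendsto_integral_slopeEnergy hF hδ (fun z => (hFb z).1) hFd hq hs hs_pos)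
    fun k => (ent_stdGaussian_le_integral_bregman k hF.continuous.measurable hδ hFb).trans ?_
  rw [← integral_const_mul]
  refine integral_mono_of_nonneg (.of_forall fun p => mul_nonneg k.cast_add_one_pos.le
    (bregman_mem_Icc hδ (hFb _) (hFb _)).1) ?_ (.of_forall fun p => ?_)
  · exact integrable_slopeEnergy_stdGaussian (hF.differentiable one_ne_zero) hδ
      (fun z => (hFb z).1) hFd _ (hs_pos k)
  · have h := bregman_le_sq_mul_slopeEnergy (F := F) (hs_pos k).ne' (x := √(k / (k + 1)) • p.1)
      (g := p.2) (hδ.trans_le (hFb _).1) (hδ.trans_le (hFb _).1)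
    rw [Real.sq_sqrt Nat.one_div_pos_of_nat.le, one_div_mul_eq_div,
      le_div_iff₀' k.cast_add_one_pos] at h
    exact h

theorem satisfiesLSI_stdGaussian : SatisfiesLSI (stdGaussian W) 2 := by
  refine satisfiesLSI_of_pos zero_le_two fun f hf δ K hδ hfb hfd => ?_
  have hfderiv (z : W) : fderiv ℝ (fun z => f z ^ 2) z = (2 * f z) • fderiv ℝ f z := by
    rw [((hf.differentiable one_ne_zero z).hasFDerivAt.pow 2).fderiv]
    ext y
    simp only [smul_apply, smul_eq_mul, nsmul_eq_mul, Nat.cast_ofNat, Nat.add_one_sub_one, pow_one]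
  have hbound (z : W) : ‖fderiv ℝ (fun z => f z ^ 2) z‖ ≤ 2 * K * K := by
    have hfz := hδ.trans_le (hfb z).1
    rw [hfderiv, norm_smul, Real.norm_of_nonneg (by positivity)]
    exact mul_le_mul (by linarith only [(hfb z).2]) (hfd z) (norm_nonneg _)
      (by linarith only [hfz, (hfb z).2])
  refine (ent_stdGaussian_le_integral_fderiv (hf.pow 2) (pow_pos hδ 2)
    (fun z => ⟨pow_le_pow_left₀ hδ.le (hfb z).1 2,
      pow_le_pow_left₀ (hδ.le.trans (hfb z).1) (hfb z).2 2⟩) hbound).trans_eq ?_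
  rw [← integral_const_mul]
  congr with z
  have hfz := (hδ.trans_le (hfb z).1).ne'
  rw [hfderiv, norm_smul, mul_pow, Real.norm_eq_abs, sq_abs]
  field_simp

end Gaussian

/-! ### Strongly monotone and cocoercive maps -/

/-- Strong monotonicity `m |x - y|² ≤ ⟨k x - k y, x - y⟩` together with cocoercivity
`|k x - k y|² ≤ c ⟨k x - k y, x - y⟩`; the gradient of an `m`-strongly convex function with
`c`-Lipschitz gradient is the model. -/
structure StronglyMonotoneCocoercive {E : Type*} [NormedAddCommGroup E] [InnerProductSpace ℝ E]
    (m c : ℝ) (k : E → E) : Prop where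
  mul_norm_sq_le : ∀ x y, m * ‖x - y‖ ^ 2 ≤ inner ℝ (k x - k y) (x - y)
  norm_sq_le : ∀ x y, ‖k x - k y‖ ^ 2 ≤ c * inner ℝ (k x - k y) (x - y)

section LinearAlgebra

variable {V : Type*} [NormedAddCommGroup V] [InnerProductSpace ℝ V] {m c M R : ℝ}
  {A S K Q : V →L[ℝ] V} {n g : V}

theorem StronglyMonotoneCocoercive.norm_sub_le {k : V → V}
    (hk : StronglyMonotoneCocoercive m c k) (hc : 0 ≤ c) (x y : V) :
    ‖k x - k y‖ ≤ c * ‖x - y‖ := by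
  have hcs := mul_le_mul_of_nonneg_left (real_inner_le_norm (k x - k y) (x - y)) hc
  have hcoc := hk.norm_sq_le x y
  by_contra! hlt
  have hprod : 0 ≤ c * ‖x - y‖ := by positivity
  nlinarith only [hcs, hcoc, hlt, hprod]

theorem StronglyMonotoneCocoercive.of_linear
    (hmono : ∀ x, m * ‖x‖ ^ 2 ≤ inner ℝ (A x) x)
    (hcoco : ∀ x, ‖A x‖ ^ 2 ≤ c * inner ℝ (A x) x) : StronglyMonotoneCocoercive m c A where
  mul_norm_sq_le x y := by simpa only [map_sub] using hmono (x - y)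
  norm_sq_le x y := by simpa only [map_sub] using hcoco (x - y)

theorem inner_apply_self_le (hM : ‖A‖ ≤ M) (x : V) : inner ℝ (A x) x ≤ M * ‖x‖ ^ 2 := by
  rw [sq, ← mul_assoc]
  exact (real_inner_le_norm _ _).trans (by gcongr; exact A.le_of_opNorm_le hM x)

theorem inner_apply_sq_le_of_isPositive (hS : S.IsPositive) (x y : V) :
    inner ℝ (S x) y ^ 2 ≤ inner ℝ (S x) x * inner ℝ (S y) y := by
  refine LinearMap.BilinForm.apply_sq_le_of_symm ((innerₗ V).comp S.toLinearMap)
    hS.inner_nonneg_left ⟨fun x y => ?_⟩ x y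
  exact (hS.inner_left_eq_inner_right x y).trans (real_inner_comm _ _)

theorem norm_apply_sq_le_of_isPositive (hS : S.IsPositive) (x : V) :
    ‖S x‖ ^ 2 ≤ ‖S‖ * inner ℝ (S x) x := by
  have hle := inner_apply_self_le (A := S) le_rfl (S x)
  have hcs := inner_apply_sq_le_of_isPositive hS x (S x)
  rw [real_inner_self_eq_norm_sq] at hcs
  rcases (norm_nonneg (S x)).eq_or_lt with hzero | hpos
  · rw [← hzero]
    simpa using mul_nonneg (norm_nonneg S) (hS.inner_nonneg_left x)
  · refine le_of_mul_le_mul_right ?_ (pow_pos hpos 2)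
    nlinarith only [hcs, hle, hS.inner_nonneg_left x]

theorem StronglyMonotoneCocoercive.of_isPositive_add_smul (hQ : Q.IsPositive) (hm : 0 ≤ m)
    (hM : ‖Q + m • ContinuousLinearMap.id ℝ V‖ ≤ M) :
    StronglyMonotoneCocoercive m (2 * M - m) (Q + m • ContinuousLinearMap.id ℝ V) := by
  set T := Q + m • ContinuousLinearMap.id ℝ V with hT
  have hpos : T.IsPositive :=
    hQ.add (ContinuousLinearMap.isPositive_id.smul_of_nonneg hm)
  have hmono (x : V) : m * ‖x‖ ^ 2 ≤ inner ℝ (T x) x := by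
    have hQx := hQ.inner_nonneg_left x
    simp only [hT, add_apply, smul_apply, ContinuousLinearMap.id_apply, inner_add_left,
      real_inner_smul_left, real_inner_self_eq_norm_sq]
    linarith
  refine .of_linear hmono fun x => ?_
  rcases eq_or_ne x 0 with rfl | hx
  · simp
  have hle : m ≤ M := by
    have hxpos : 0 < ‖x‖ ^ 2 := by have := norm_pos_iff.2 hx; positivity
    exact le_of_mul_le_mul_right ((hmono x).trans (inner_apply_self_le hM x)) hxpos
  refine (norm_apply_sq_le_of_isPositive hpos x).trans ?_
  gcongr
  · exact hpos.inner_nonneg_left x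
  · linarith

theorem inner_apply_self_le_of_apply_eq_neg (hS : S.IsPositive)
    (hK : ∀ x y, inner ℝ (K x) y = -inner ℝ x (K y)) (hR : 0 ≤ R)
    (hKS : ∀ x, ‖K x‖ ^ 2 ≤ R * inner ℝ (S x) x) {w y : V} (hw : S w = -K y) :
    inner ℝ (S w) w ≤ R * ‖y‖ ^ 2 := by
  have hle : inner ℝ (S w) w ≤ ‖K w‖ * ‖y‖ := by
    have hww : inner ℝ (S w) w = inner ℝ (K w) y := by
      rw [hw, inner_neg_left, hK, neg_neg, real_inner_comm]
    exact hww ▸ real_inner_le_norm _ _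
  have hnn := hS.inner_nonneg_left w
  have hsq : inner ℝ (S w) w * inner ℝ (S w) w ≤ R * ‖y‖ ^ 2 * inner ℝ (S w) w := by
    calc inner ℝ (S w) w * inner ℝ (S w) w ≤ ‖K w‖ * ‖y‖ * (‖K w‖ * ‖y‖) := by gcongr
      _ = ‖K w‖ ^ 2 * ‖y‖ ^ 2 := by ring
      _ ≤ R * inner ℝ (S w) w * ‖y‖ ^ 2 := by gcongr; exact hKS w
      _ = R * ‖y‖ ^ 2 * inner ℝ (S w) w := by ring
  rcases hnn.eq_or_lt with hzero | hpos
  · rw [← hzero]; positivity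
  · exact le_of_mul_le_mul_right hsq hpos

theorem surjective_of_coercive [CompleteSpace V] (hm : 0 < m)
    (hcoer : ∀ x, m * ‖x‖ ^ 2 ≤ inner ℝ (S x) x) : Function.Surjective S := by
  refine (ContinuousLinearMap.isUnit_iff_bijective.1
    (S.isUnit_of_forall_le_norm_inner_map (c := m.toNNReal) (by simpa) fun z => ?_)).2
  rw [Real.coe_toNNReal m hm.le, mul_comm]
  exact (hcoer z).trans (Real.le_norm_self _)

/- With `y = S x + K x` and `S w = -K y` one has `|y|² = ⟨S x, y + w⟩`, and the two terms of
`⟨S (y + w), y + w⟩ = ⟨S y, y⟩ + ⟨S w, w⟩` are at most `M |y|²` and `R |y|²`. -/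
theorem norm_add_skew_apply_sq_le [CompleteSpace V] (hS : S.IsPositive)
    (hK : ∀ x y, inner ℝ (K x) y = -inner ℝ x (K y)) (hm : 0 < m) (hR : 0 ≤ R)
    (hcoer : ∀ x, m * ‖x‖ ^ 2 ≤ inner ℝ (S x) x) (hM : ∀ x, inner ℝ (S x) x ≤ M * ‖x‖ ^ 2)
    (hKS : ∀ x, ‖K x‖ ^ 2 ≤ R * inner ℝ (S x) x) (x : V) :
    ‖S x + K x‖ ^ 2 ≤ (M + R) * inner ℝ (S x) x := by
  have hKself (z : V) : inner ℝ (K z) z = 0 := by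
    linarith [hK z z, real_inner_comm z (K z)]
  have hSx : inner ℝ (S x + K x) x = inner ℝ (S x) x := by
    rw [inner_add_left, hKself, add_zero]
  set y := S x + K x with hy
  clear_value y
  obtain ⟨w, hw⟩ := surjective_of_coercive hm hcoer (-K y)
  have hyy : ‖y‖ ^ 2 = inner ℝ (S x) (y + w) := by
    rw [inner_add_right, hS.inner_left_eq_inner_right x w, hw, inner_neg_right, ← hK,
      ← inner_add_left, ← hy, real_inner_self_eq_norm_sq]
  have horth : inner ℝ (S w) y = 0 := by rw [hw, inner_neg_left, hKself, neg_zero]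
  have hsum : inner ℝ (S (y + w)) (y + w) = inner ℝ (S y) y + inner ℝ (S w) w := by
    rw [map_add, inner_add_left, inner_add_right, inner_add_right,
      hS.inner_left_eq_inner_right y w, real_inner_comm (S w) y, horth]
    ring
  have hww := inner_apply_self_le_of_apply_eq_neg hS hK hR hKS hw
  rcases eq_or_ne y 0 with hzero | hne
  · rw [hzero, inner_zero_left] at hSx
    rw [hzero, ← hSx, norm_zero, mul_zero, zero_pow two_ne_zero]
  · refine le_of_mul_le_mul_right ?_ (pow_pos (norm_pos_iff.2 hne) 2)
    calc ‖y‖ ^ 2 * ‖y‖ ^ 2 = inner ℝ (S x) (y + w) ^ 2 := by rw [← hyy, sq (‖y‖ ^ 2)]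
      _ ≤ inner ℝ (S x) x * inner ℝ (S (y + w)) (y + w) :=
        inner_apply_sq_le_of_isPositive hS x (y + w)
      _ ≤ inner ℝ (S x) x * (M * ‖y‖ ^ 2 + R * ‖y‖ ^ 2) := by
        rw [hsum]
        exact mul_le_mul_of_nonneg_left (add_le_add (hM y) hww) (hS.inner_nonneg_left x)
      _ = (M + R) * inner ℝ (S x) x * ‖y‖ ^ 2 := by ring

open InnerProductSpace in
theorem inner_sub_symm_rankOne_apply_self (z : V) :
    inner ℝ ((R • ContinuousLinearMap.id ℝ V
        - (1 / 2 : ℝ) • (rankOne ℝ g n + rankOne ℝ n g)) z) z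
      = R * ‖z‖ ^ 2 - inner ℝ g z * inner ℝ n z := by
  simp only [sub_apply, add_apply, smul_apply, ContinuousLinearMap.id_apply, rankOne_apply,
    inner_sub_left, inner_add_left, real_inner_smul_left, real_inner_self_eq_norm_sq]
  ring

open InnerProductSpace in
theorem isPositive_sub_symm_rankOne (hR : ‖g‖ * ‖n‖ ≤ R) :
    (R • ContinuousLinearMap.id ℝ V
      - (1 / 2 : ℝ) • (rankOne ℝ g n + rankOne ℝ n g)).IsPositive := by
  refine (ContinuousLinearMap.isPositive_iff _).2 ⟨fun x y => ?_, fun z => ?_⟩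
  · simp only [ContinuousLinearMap.coe_coe, sub_apply, add_apply, smul_apply,
      ContinuousLinearMap.id_apply, rankOne_apply, inner_sub_left, inner_sub_right, inner_add_left,
      inner_add_right, real_inner_smul_left, real_inner_smul_right, real_inner_comm n x,
      real_inner_comm g x]
    ring
  · rw [inner_sub_symm_rankOne_apply_self, sub_nonneg]
    calc inner ℝ g z * inner ℝ n z ≤ |inner ℝ g z| * |inner ℝ n z| := by
          rw [← abs_mul]; exact le_abs_self _
      _ ≤ ‖g‖ * ‖z‖ * (‖n‖ * ‖z‖) := by gcongr <;> exact abs_real_inner_le_norm _ _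
      _ = ‖g‖ * ‖n‖ * ‖z‖ ^ 2 := by ring
      _ ≤ R * ‖z‖ ^ 2 := by gcongr

theorem inner_add_norm_mul_inner_sq_le (hn : ‖n‖ = 1) (w : V) :
    (inner ℝ g w + ‖g‖ * inner ℝ n w) ^ 2
      ≤ 2 * ‖g‖ * (‖g‖ + inner ℝ g n) * ‖w‖ ^ 2 := by
  have hinner : inner ℝ (g + ‖g‖ • n) w = inner ℝ g w + ‖g‖ * inner ℝ n w := by
    rw [inner_add_left, real_inner_smul_left]
  have hnorm : ‖g + ‖g‖ • n‖ ^ 2 = 2 * ‖g‖ * (‖g‖ + inner ℝ g n) := by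
    rw [norm_add_sq_real, norm_smul, hn, norm_norm, real_inner_smul_right]
    ring
  rw [← hinner, ← hnorm, ← mul_pow]
  exact sq_le_sq' (neg_le_of_abs_le (abs_real_inner_le_norm _ _)) (real_inner_le_norm _ _)

theorem norm_sq_inner_smul_sub_inner_smul (hn : ‖n‖ = 1) (w : V) :
    ‖inner ℝ g w • n - inner ℝ n w • g‖ ^ 2
      = inner ℝ g w ^ 2 + ‖g‖ ^ 2 * inner ℝ n w ^ 2
        - 2 * inner ℝ g n * inner ℝ g w * inner ℝ n w := by
  rw [norm_sub_sq_real, norm_smul, norm_smul, hn, real_inner_smul_left, real_inner_smul_right,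
    real_inner_comm g n, mul_pow, mul_pow, Real.norm_eq_abs, Real.norm_eq_abs, sq_abs, sq_abs]
  ring

theorem norm_sq_skew_le_of_norm (hn : ‖n‖ = 1) (w : V) :
    ‖inner ℝ g w • n - inner ℝ n w • g‖ ^ 2
      ≤ 4 * (‖g‖ * (‖g‖ * ‖w‖ ^ 2 - inner ℝ g w * inner ℝ n w)) := by
  rcases eq_or_ne g 0 with rfl | hg
  · simp
  have hΓ := abs_le.1 (abs_real_inner_le_norm g n)
  rw [hn, mul_one] at hΓ
  have hg0 := norm_pos_iff.2 hg
  have hcs := inner_add_norm_mul_inner_sq_le (g := g) hn w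
  rw [norm_sq_inner_smul_sub_inner_smul hn]
  set ρ := ‖g‖
  set α := inner ℝ g w
  set β := inner ℝ n w
  set Γ := inner ℝ g n
  have hamgm : (ρ - Γ) * (4 * ρ * α * β) ≤ (ρ - Γ) * (α + ρ * β) ^ 2 := by
    refine mul_le_mul_of_nonneg_left ?_ (by linarith)
    nlinarith only [sq_nonneg (α - ρ * β)]
  have hcs' := mul_le_mul_of_nonneg_left hcs (show 0 ≤ 3 * ρ - Γ by linarith)
  have hdefect : 0 ≤ ρ * (ρ - Γ) ^ 2 * ‖w‖ ^ 2 := by positivity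
  refine le_of_mul_le_mul_left ?_ hg0
  nlinarith only [hamgm, hcs', hdefect]

theorem norm_sq_half_skew_le (hn : ‖n‖ = 1) (hg : ‖g‖ ≤ R) (w : V) :
    ‖(1 / 2 : ℝ) • (inner ℝ g w • n - inner ℝ n w • g)‖ ^ 2
      ≤ R * (R * ‖w‖ ^ 2 - inner ℝ g w * inner ℝ n w) := by
  have hpos := isPositive_sub_symm_rankOne (R := ‖g‖) (g := g) (n := n) (by rw [hn, mul_one])
  have hprod := hpos.inner_nonneg_left w
  rw [inner_sub_symm_rankOne_apply_self] at hprod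
  have hskew := norm_sq_skew_le_of_norm (g := g) hn w
  rw [norm_smul, mul_pow, Real.norm_eq_abs, sq_abs]
  have hmono : ‖g‖ * (‖g‖ * ‖w‖ ^ 2 - inner ℝ g w * inner ℝ n w)
      ≤ R * (R * ‖w‖ ^ 2 - inner ℝ g w * inner ℝ n w) := by
    gcongr
    exact (norm_nonneg g).trans hg
  linarith

/-- The operator `Q + R - ⟨n, ·⟩ g + m`: the derivative of the tamed drift in the shell where the
drift is switched off linearly, with `n` the radial direction and `g` the drift. -/
noncomputable def rankOneTaming (Q : V →L[ℝ] V) (m R : ℝ) (n g : V) : V →L[ℝ] V :=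
  Q + (R • ContinuousLinearMap.id ℝ V - InnerProductSpace.rankOne ℝ g n)
    + m • ContinuousLinearMap.id ℝ V

/-- The symmetric part of `rankOneTaming Q m R n g`, for symmetric `Q`. -/
noncomputable def rankOneTamingSymm (Q : V →L[ℝ] V) (m R : ℝ) (n g : V) : V →L[ℝ] V :=
  Q + (R • ContinuousLinearMap.id ℝ V
      - (1 / 2 : ℝ) • (InnerProductSpace.rankOne ℝ g n + InnerProductSpace.rankOne ℝ n g))
    + m • ContinuousLinearMap.id ℝ V

/-- The skew-symmetric part of `rankOneTaming Q m R n g`, for symmetric `Q`. -/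
noncomputable def rankOneTamingSkew (n g : V) : V →L[ℝ] V :=
  (1 / 2 : ℝ) • (InnerProductSpace.rankOne ℝ n g - InnerProductSpace.rankOne ℝ g n)

theorem rankOneTamingSymm_add_skew :
    rankOneTamingSymm Q m R n g + rankOneTamingSkew n g = rankOneTaming Q m R n g := by
  rw [rankOneTamingSymm, rankOneTamingSkew, rankOneTaming]
  module

theorem inner_rankOneTamingSkew (x y : V) :
    inner ℝ (rankOneTamingSkew n g x) y = -inner ℝ x (rankOneTamingSkew n g y) := by
  simp only [rankOneTamingSkew, sub_apply, smul_apply, InnerProductSpace.rankOne_apply,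
    inner_sub_left, inner_sub_right, real_inner_smul_left, real_inner_smul_right,
    real_inner_comm n x, real_inner_comm g x]
  ring

theorem inner_rankOneTamingSymm_self (z : V) :
    inner ℝ (rankOneTamingSymm Q m R n g z) z = inner ℝ (Q z) z
      + (R * ‖z‖ ^ 2 - inner ℝ g z * inner ℝ n z) + m * ‖z‖ ^ 2 := by
  rw [rankOneTamingSymm, add_apply, add_apply, inner_add_left, inner_add_left,
    inner_sub_symm_rankOne_apply_self, smul_apply, ContinuousLinearMap.id_apply,
    real_inner_smul_left, real_inner_self_eq_norm_sq]

theorem inner_rankOneTaming_self (z : V) :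
    inner ℝ (rankOneTaming Q m R n g z) z = inner ℝ (rankOneTamingSymm Q m R n g z) z := by
  have hskew := inner_rankOneTamingSkew (n := n) (g := g) z z
  have hcomm := real_inner_comm z (rankOneTamingSkew n g z)
  rw [← rankOneTamingSymm_add_skew, add_apply, inner_add_left]
  linarith

theorem mul_norm_sq_le_inner_rankOneTamingSymm (hQ : Q.IsPositive) (hn : ‖n‖ = 1) (hg : ‖g‖ ≤ R)
    (z : V) : m * ‖z‖ ^ 2 ≤ inner ℝ (rankOneTamingSymm Q m R n g z) z := by
  have hpos := (isPositive_sub_symm_rankOne (R := R) (g := g) (n := n)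
    (by rwa [hn, mul_one])).inner_nonneg_left z
  rw [inner_sub_symm_rankOne_apply_self] at hpos
  rw [inner_rankOneTamingSymm_self]
  linarith [hQ.inner_nonneg_left z]

theorem norm_rankOneTamingSkew_sq_le (hQ : Q.IsPositive) (hm : 0 ≤ m) (hn : ‖n‖ = 1)
    (hg : ‖g‖ ≤ R) (w : V) :
    ‖rankOneTamingSkew n g w‖ ^ 2 ≤ R * inner ℝ (rankOneTamingSymm Q m R n g w) w := by
  refine (norm_sq_half_skew_le hn hg w).trans ?_
  have hR : 0 ≤ R := (norm_nonneg g).trans hg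
  have hQw := hQ.inner_nonneg_left w
  rw [inner_rankOneTamingSymm_self]
  gcongr
  have hmw : 0 ≤ m * ‖w‖ ^ 2 := by positivity
  linarith

/- The compression of the operator to the orthogonal complement of `n` is at least `R + m`, so this
complement vanishes when the norm is smaller. -/
theorem rankOneTamingSkew_eq_zero (hQ : Q.IsPositive) (hn : ‖n‖ = 1)
    (hM : ‖rankOneTaming Q m R n g‖ < R + m) : rankOneTamingSkew n g = 0 := by
  have horth (ξ : V) (hξ : inner ℝ n ξ = 0) : ξ = 0 := by
    by_contra hne
    have hlt := mul_lt_mul_of_pos_right hM (pow_pos (norm_pos_iff.2 hne) 2)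
    have hle := inner_apply_self_le (A := rankOneTaming Q m R n g) le_rfl ξ
    rw [inner_rankOneTaming_self, inner_rankOneTamingSymm_self, hξ] at hle
    linarith [hQ.inner_nonneg_left ξ]
  have hgn : g = inner ℝ n g • n := by
    refine sub_eq_zero.1 (horth _ ?_)
    rw [inner_sub_right, real_inner_smul_right, real_inner_self_eq_norm_sq, hn]
    ring
  rw [rankOneTamingSkew, hgn, map_smul, map_smul, smul_apply]
  simp

theorem stronglyMonotoneCocoercive_rankOneTaming [CompleteSpace V] (hQ : Q.IsPositive)
    (hm : 0 < m) (hn : ‖n‖ = 1) (hg : ‖g‖ ≤ R) (hM : ‖rankOneTaming Q m R n g‖ ≤ M) :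
    StronglyMonotoneCocoercive m (2 * M - m) (rankOneTaming Q m R n g) := by
  have hpos := hQ.add (isPositive_sub_symm_rankOne (R := R) (g := g) (n := n)
    (by rwa [hn, mul_one]))
  have hcoer := mul_norm_sq_le_inner_rankOneTamingSymm (m := m) hQ hn hg
  rcases le_or_gt (R + m) M with hle | hlt
  · refine .of_linear (fun x => by simpa only [inner_rankOneTaming_self] using hcoer x) fun x => ?_
    have hinner : 0 ≤ inner ℝ (rankOneTamingSymm Q m R n g x) x :=
      le_trans (by positivity) (hcoer x)
    have hcoco := norm_add_skew_apply_sq_le (S := rankOneTamingSymm Q m R n g)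
      (K := rankOneTamingSkew n g) (R := R)
      (hpos.add (ContinuousLinearMap.isPositive_id.smul_of_nonneg hm.le))
      inner_rankOneTamingSkew hm ((norm_nonneg g).trans hg) hcoer
      (fun x => by simpa only [inner_rankOneTaming_self] using inner_apply_self_le hM x)
      (norm_rankOneTamingSkew_sq_le hQ hm.le hn hg) x
    rw [← add_apply, rankOneTamingSymm_add_skew] at hcoco
    rw [inner_rankOneTaming_self]
    refine hcoco.trans (mul_le_mul_of_nonneg_right ?_ hinner)
    linarith
  · have heq := rankOneTamingSymm_add_skew (Q := Q) (m := m) (R := R) (n := n) (g := g)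
    rw [rankOneTamingSkew_eq_zero hQ hn (hM.trans_lt hlt), add_zero, rankOneTamingSymm] at heq
    rw [← heq] at hM ⊢
    exact .of_isPositive_add_smul hpos hm.le hM

end LinearAlgebra

/-! ### The tamed field and its Lipschitz constant -/

theorem lipschitzWith_lipConst {E F : Type*} [PseudoMetricSpace E] [PseudoMetricSpace F]
    {f : E → F} {K : ℝ≥0} (hf : LipschitzWith K f) : LipschitzWith (lipConst f) f := by
  have hclosed : IsClosed {K : ℝ≥0 | LipschitzWith K f} := by
    simp only [lipschitzWith_iff_dist_le_mul, Set.ofPred_forall]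
    exact isClosed_iInter fun x => isClosed_iInter fun y =>
      isClosed_le continuous_const (by fun_prop)
  exact hclosed.csInf_mem ⟨K, hf⟩ (OrderBot.bddBelow _)

theorem tamingRadius_pos {m L l lam : ℝ} (hLm : 0 < L + m) (hlam : 0 < lam) :
    0 < tamingRadius m L l lam := by
  unfold tamingRadius
  positivity

theorem cutT_eq_clamp (ρ s : ℝ) : cutT ρ s = max 0 (min 1 (ρ - s)) := by
  unfold cutT
  split_ifs with hs₁ hs₂
  · rw [min_eq_left (by linarith), max_eq_right zero_le_one]
  · rw [min_eq_right (by linarith), max_eq_right (by linarith)]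
  · rw [min_eq_right (by linarith), max_eq_left (by linarith)]

theorem cutS_eq_clamp_mul {ρ : ℝ} (hρ : 0 < ρ) (s : ℝ) :
    cutS ρ s = max 0 (min 1 (s - (ρ - 2))) * (ρ / max ρ s) := by
  unfold cutS
  split_ifs with hs₁ hs₂ hs₃
  · rw [min_eq_right (by linarith), max_eq_left (by linarith), zero_mul]
  · rw [min_eq_right (by linarith), max_eq_right (by linarith), max_eq_left (by linarith),
      div_self hρ.ne', mul_one]
    ring
  · rw [min_eq_left (by linarith), max_eq_right zero_le_one, max_eq_left hs₃, div_self hρ.ne',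
      mul_one]
  · rw [min_eq_left (by linarith), max_eq_right zero_le_one, max_eq_right (by linarith), one_mul]

theorem abs_clamp_le_one (s : ℝ) : |max 0 (min 1 s)| ≤ 1 := by
  rw [abs_of_nonneg (le_max_left _ _)]
  exact max_le zero_le_one (min_le_left _ _)

section Lipschitz

variable {V : Type*} [NormedAddCommGroup V]

theorem lipschitzWith_clamp_norm_sub (s : ℝ) :
    LipschitzWith 1 fun x : V => max 0 (min 1 (‖x‖ - s)) := by
  simpa using ((lipschitzWith_one_norm.sub (LipschitzWith.const s)).const_min 1).const_max 0

theorem lipschitzWith_cutT_norm (ρ : ℝ) : LipschitzWith 1 fun x : V => cutT ρ ‖x‖ := by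
  simp only [cutT_eq_clamp]
  simpa using (((LipschitzWith.const ρ).sub lipschitzWith_one_norm).const_min 1).const_max 0

variable [NormedSpace ℝ V]

theorem norm_smul_sub_smul_le (a b : ℝ) (x y : V) :
    ‖a • x - b • y‖ ≤ |a| * ‖x - y‖ + |a - b| * ‖y‖ := by
  have hsplit : a • x - b • y = a • (x - y) + (a - b) • y := by module
  rw [hsplit, ← Real.norm_eq_abs, ← Real.norm_eq_abs, ← norm_smul, ← norm_smul]
  exact norm_add_le _ _

theorem lipschitzWith_cutoff_smul {c : V → ℝ} {G : V → V} {B : Set V} {K R : ℝ≥0}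
    (hc : LipschitzWith 1 c) (hc₁ : ∀ x, |c x| ≤ 1) (hc₀ : ∀ x ∉ B, c x = 0)
    (hG : LipschitzOnWith K G B) (hR : ∀ x ∈ B, ‖G x‖ ≤ R) :
    LipschitzWith (K + R) fun x => c x • G x := by
  refine LipschitzWith.of_dist_le_mul fun x y => ?_
  simp only [dist_eq_norm, NNReal.coe_add]
  wlog hy : y ∈ B generalizing x y
  · by_cases hx : x ∈ B
    · rw [norm_sub_rev, norm_sub_rev x]
      exact this y x hx
    · rw [hc₀ x hx, hc₀ y hy, zero_smul, zero_smul, sub_zero, norm_zero]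
      positivity
  have hcG : |c x| * ‖G x - G y‖ ≤ K * ‖x - y‖ := by
    by_cases hx : x ∈ B
    · simpa only [one_mul] using mul_le_mul (hc₁ x) (hG.norm_sub_le hx hy) (norm_nonneg _)
        zero_le_one
    · rw [hc₀ x hx, abs_zero, zero_mul]
      positivity
  have hcR : |c x - c y| * ‖G y‖ ≤ ‖x - y‖ * R := by
    gcongr
    · simpa only [NNReal.coe_one, one_mul, Real.norm_eq_abs] using hc.norm_sub_le x y
    · exact hR y hy
  linarith [norm_smul_sub_smul_le (c x) (c y) (G x) (G y)]

theorem norm_radial_retraction_le {ρ : ℝ} (hρ : 0 < ρ) (x : V) : ‖(ρ / max ρ ‖x‖) • x‖ ≤ ρ := by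
  have hmax : 0 < max ρ ‖x‖ := lt_max_of_lt_left hρ
  rw [norm_smul, Real.norm_of_nonneg (by positivity), div_mul_eq_mul_div, div_le_iff₀ hmax]
  gcongr
  exact le_max_right _ _

theorem lipschitzWith_radial_retraction {ρ : ℝ} (hρ : 0 < ρ) :
    LipschitzWith 2 fun x : V => (ρ / max ρ ‖x‖) • x := by
  have hmax (x : V) : 0 < max ρ ‖x‖ := lt_max_of_lt_left hρ
  have hfactor (x : V) : |ρ / max ρ ‖x‖| ≤ 1 := by
    have := hmax x
    rw [abs_of_pos (by positivity), div_le_one this]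
    exact le_max_left _ _
  refine LipschitzWith.of_dist_le_mul fun x y => ?_
  simp only [dist_eq_norm]
  have hdiff : ρ / max ρ ‖x‖ - ρ / max ρ ‖y‖
      = ρ / max ρ ‖x‖ * ((max ρ ‖y‖ - max ρ ‖x‖) / max ρ ‖y‖) := by
    have := hmax x
    have := hmax y
    field_simp
  have hlip : |max ρ ‖y‖ - max ρ ‖x‖| ≤ ‖x - y‖ := by
    rw [norm_sub_rev]
    simpa using (lipschitzWith_one_norm.const_max ρ).norm_sub_le y x
  have hscale : |ρ / max ρ ‖x‖ - ρ / max ρ ‖y‖| * ‖y‖ ≤ ‖x - y‖ := by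
    have := hmax y
    rw [hdiff, abs_mul, abs_div (max ρ ‖y‖ - max ρ ‖x‖), abs_of_pos this]
    calc |ρ / max ρ ‖x‖| * (|max ρ ‖y‖ - max ρ ‖x‖| / max ρ ‖y‖) * ‖y‖
        ≤ 1 * (‖x - y‖ / max ρ ‖y‖) * max ρ ‖y‖ := by
          gcongr
          · exact hfactor x
          · exact le_max_right _ _
      _ = ‖x - y‖ := by field_simp
  have hmain := mul_le_mul_of_nonneg_right (hfactor x) (norm_nonneg (x - y))
  rw [NNReal.coe_ofNat]
  linarith [norm_smul_sub_smul_le (ρ / max ρ ‖x‖) (ρ / max ρ ‖y‖) x y]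

theorem lipschitzWith_cutT_norm_smul {ρ : ℝ} {g : V → V} {K R : ℝ≥0}
    (hg : LipschitzOnWith K g (Metric.ball 0 ρ)) (hR : ∀ x ∈ Metric.ball 0 ρ, ‖g x‖ ≤ R) :
    LipschitzWith (K + R) fun x => cutT ρ ‖x‖ • g x := by
  refine lipschitzWith_cutoff_smul (lipschitzWith_cutT_norm ρ) (fun x => ?_) (fun x hx => ?_) hg hR
  · rw [cutT_eq_clamp]
    exact abs_clamp_le_one _
  · rw [mem_ball_zero_iff, not_lt] at hx
    rw [cutT_eq_clamp, min_eq_right (by linarith), max_eq_left (by linarith)]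

theorem lipschitzWith_cutS_norm_smul {ρ : ℝ} (hρ : 0 < ρ) :
    LipschitzWith (2 + ρ.toNNReal) fun x : V => cutS ρ ‖x‖ • x := by
  simp only [cutS_eq_clamp_mul hρ, mul_smul]
  refine lipschitzWith_cutoff_smul (B := Set.univ) (lipschitzWith_clamp_norm_sub (ρ - 2))
    (fun x => abs_clamp_le_one _) (fun x hx => (hx trivial).elim)
    (lipschitzWith_radial_retraction hρ).lipschitzOnWith fun x _ => ?_
  rw [Real.coe_toNNReal _ hρ.le]
  exact norm_radial_retraction_le hρ x

/-- The drift `t(x) g(x) + R s(x) x + m x` obtained by taming a general vector field `g` with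
radius `ρ` and amplitude `R`; the tamed drift is the case `g = h - m x`, `R = R_λ`, `ρ = r_λ`. -/
noncomputable def tamedField (g : V → V) (R ρ m : ℝ) (x : V) : V :=
  cutT ρ ‖x‖ • g x + (R * cutS ρ ‖x‖) • x + m • x

theorem tamedField_of_le_sub_two {g : V → V} {R ρ m : ℝ} {x : V} (hx : ‖x‖ ≤ ρ - 2) :
    tamedField g R ρ m x = g x + m • x := by
  rw [tamedField, cutT, cutS, if_pos (by linarith), if_pos hx]
  module

theorem tamedField_of_le_sub_one {g : V → V} {R ρ m : ℝ} {x : V} (hx₂ : ρ - 2 < ‖x‖)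
    (hx₁ : ‖x‖ < ρ - 1) :
    tamedField g R ρ m x = g x + (R * (‖x‖ - (ρ - 2))) • x + m • x := by
  rw [tamedField, cutT, cutS, if_pos hx₁.le, if_neg hx₂.not_ge, if_pos hx₁]
  module

theorem tamedField_of_lt {g : V → V} {R ρ m : ℝ} {x : V} (hx₁ : ρ - 1 < ‖x‖) (hx : ‖x‖ < ρ) :
    tamedField g R ρ m x = (ρ - ‖x‖) • g x + R • x + m • x := by
  rw [tamedField, cutT, cutS, if_neg hx₁.not_ge, if_pos hx, if_neg (by linarith),
    if_neg hx₁.not_gt, if_pos hx.le, mul_one]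

theorem tamedField_of_gt {g : V → V} {R ρ m : ℝ} {x : V} (hx : ρ < ‖x‖) :
    tamedField g R ρ m x = (R * ρ * ‖x‖⁻¹) • x + m • x := by
  rw [tamedField, cutT, cutS, if_neg (by linarith), if_neg hx.not_gt, if_neg (by linarith),
    if_neg (by linarith), if_neg hx.not_ge]
  module

theorem exists_lipschitzWith_tamedField {g : V → V} {R ρ : ℝ} {K : ℝ≥0} (m : ℝ) (hρ : 0 < ρ)
    (hg : LipschitzOnWith K g (Metric.ball 0 ρ)) (hR : ∀ x ∈ Metric.ball 0 ρ, ‖g x‖ ≤ R) :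
    ∃ K', LipschitzWith K' (tamedField g R ρ m) := by
  lift R to ℝ≥0 using (norm_nonneg _).trans (hR 0 (Metric.mem_ball_self hρ))
  have houter := (lipschitzWith_smul (R : ℝ)).comp (lipschitzWith_cutS_norm_smul (V := V) hρ)
  have hsum := ((lipschitzWith_cutT_norm_smul hg hR).add houter).add (lipschitzWith_smul m)
  simp only [Function.comp_apply, ← mul_smul] at hsum
  exact ⟨_, hsum⟩

end Lipschitz

section Derivative

variable {V : Type*} [NormedAddCommGroup V] [InnerProductSpace ℝ V] {H Q : V →L[ℝ] V}
  {g G T : V → V} {x : V} {m M R ρ τ' : ℝ} {τ : ℝ → ℝ}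

theorem hasFDerivAt_norm_of_ne_zero (hx : x ≠ 0) :
    HasFDerivAt (fun y : V => ‖y‖) (innerSL ℝ (‖x‖⁻¹ • x)) x := by
  have hsqrt := (hasStrictFDerivAt_norm_sq x).hasFDerivAt.sqrt (by simpa using hx)
  simp only [Real.sqrt_sq (norm_nonneg _)] at hsqrt
  refine hsqrt.congr_fderiv ?_
  ext y
  simp only [smul_apply, innerSL_apply_apply, real_inner_smul_left, nsmul_eq_mul, smul_eq_mul]
  field_simp
  norm_num

open InnerProductSpace in
theorem hasFDerivAt_norm_smul (hx : x ≠ 0) (hτ : HasDerivAt τ τ' ‖x‖) (hG : HasFDerivAt G H x) :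
    HasFDerivAt (fun y => τ ‖y‖ • G y) (τ ‖x‖ • H + τ' • rankOne ℝ (G x) (‖x‖⁻¹ • x)) x := by
  refine ((hτ.comp_hasFDerivAt x (hasFDerivAt_norm_of_ne_zero hx)).smul hG).congr_fderiv ?_
  ext y
  simp [mul_smul]

open InnerProductSpace in
theorem isPositive_smul_id_add_smul_rankOne [CompleteSpace V] {c c' : ℝ} (hx : x ≠ 0) (hc : 0 ≤ c)
    (hc' : 0 ≤ c + c' * ‖x‖) :
    (c • ContinuousLinearMap.id ℝ V + c' • rankOne ℝ x (‖x‖⁻¹ • x)).IsPositive := by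
  set n := ‖x‖⁻¹ • x with hn
  have hn₁ : ‖n‖ = 1 := norm_smul_inv_norm hx
  have hproj := isStarProjection_rankOne_self (𝕜 := ℝ) hn₁
  have hsplit : c • ContinuousLinearMap.id ℝ V + c' • rankOne ℝ x n
      = c • (1 - rankOne ℝ n n) + (c + c' * ‖x‖) • rankOne ℝ n n := by
    have hrank : rankOne ℝ x n = ‖x‖ • rankOne ℝ n n := by
      ext y
      rw [smul_apply, rankOne_apply, rankOne_apply, hn, smul_comm,
        smul_inv_smul₀ (norm_ne_zero_iff.2 hx)]
    rw [hrank, ContinuousLinearMap.one_def]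
    module
  rw [hsplit]
  exact ((ContinuousLinearMap.IsPositive.of_isStarProjection hproj.one_sub).smul_of_nonneg hc).add
    ((isPositive_rankOne_self n).smul_of_nonneg hc')

theorem stronglyMonotoneCocoercive_fderiv_of_radial [CompleteSpace V] (hx : x ≠ 0) (hm : 0 ≤ m)
    (hQ : Q.IsPositive) (hG : HasFDerivAt G Q x) (hτ : HasDerivAt τ τ' ‖x‖) (hτ₀ : 0 ≤ τ ‖x‖)
    (hτ' : 0 ≤ τ ‖x‖ + τ' * ‖x‖) (hT : T =ᶠ[𝓝 x] fun y => G y + τ ‖y‖ • y + m • y)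
    (hM : ‖fderiv ℝ T x‖ ≤ M) : StronglyMonotoneCocoercive m (2 * M - m) (fderiv ℝ T x) := by
  have hderiv := ((hG.add (hasFDerivAt_norm_smul hx hτ (hasFDerivAt_id x))).add
    ((hasFDerivAt_id x).const_smul m)).congr_of_eventuallyEq hT
  rw [hderiv.fderiv] at hM ⊢
  exact .of_isPositive_add_smul (hQ.add (isPositive_smul_id_add_smul_rankOne hx hτ₀ hτ')) hm hM

theorem stronglyMonotoneCocoercive_fderiv_of_shell [CompleteSpace V] (hx : x ≠ 0) (hm : 0 < m)
    (hH : H.IsPositive) (hg : HasFDerivAt g H x) (hgR : ‖g x‖ ≤ R) (hxρ : ‖x‖ ≤ ρ)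
    (hT : T =ᶠ[𝓝 x] fun y => (ρ - ‖y‖) • g y + R • y + m • y) (hM : ‖fderiv ℝ T x‖ ≤ M) :
    StronglyMonotoneCocoercive m (2 * M - m) (fderiv ℝ T x) := by
  have hcut := hasFDerivAt_norm_smul hx ((hasDerivAt_id ‖x‖).const_sub ρ) hg
  have hderiv := ((hcut.add ((hasFDerivAt_id x).const_smul R)).add
    ((hasFDerivAt_id x).const_smul m)).congr_of_eventuallyEq hT
  have hfderiv : fderiv ℝ T x = rankOneTaming ((ρ - ‖x‖) • H) m R (‖x‖⁻¹ • x) (g x) := by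
    rw [hderiv.fderiv, rankOneTaming, id]
    module
  rw [hfderiv] at hM ⊢
  exact stronglyMonotoneCocoercive_rankOneTaming (hH.smul_of_nonneg (sub_nonneg.2 hxρ)) hm
    (norm_smul_inv_norm hx) hgR hM

theorem stronglyMonotoneCocoercive_fderiv_tamedField [CompleteSpace V] (hx : x ≠ 0) (hm : 0 < m)
    (hρ : 0 < ρ) (hR : 0 ≤ R) (hx₀ : ‖x‖ ≠ ρ) (hx₁ : ‖x‖ ≠ ρ - 1) (hx₂ : ‖x‖ ≠ ρ - 2)
    (hg : ‖x‖ < ρ → ∃ H : V →L[ℝ] V, H.IsPositive ∧ HasFDerivAt g H x)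
    (hgR : ‖x‖ < ρ → ‖g x‖ ≤ R) (hM : ‖fderiv ℝ (tamedField g R ρ m) x‖ ≤ M) :
    StronglyMonotoneCocoercive m (2 * M - m) (fderiv ℝ (tamedField g R ρ m) x) := by
  have hlt {a : ℝ} (ha : ‖x‖ < a) : ∀ᶠ y : V in 𝓝 x, ‖y‖ < a :=
    continuous_norm.continuousAt.eventually_lt_const ha
  have hgt {a : ℝ} (ha : a < ‖x‖) : ∀ᶠ y : V in 𝓝 x, a < ‖y‖ :=
    continuous_norm.continuousAt.eventually_const_lt ha
  have hxpos := norm_pos_iff.2 hx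
  rcases hx₀.lt_or_gt with hlt₀ | hgt₀
  · obtain ⟨H, hH, hgH⟩ := hg hlt₀
    rcases hx₁.lt_or_gt with hlt₁ | hgt₁
    · rcases hx₂.lt_or_gt with hlt₂ | hgt₂
      · refine stronglyMonotoneCocoercive_fderiv_of_radial hx hm.le hH hgH
          (hasDerivAt_const ‖x‖ (0 : ℝ)) le_rfl (by simp) ?_ hM
        filter_upwards [hlt hlt₂] with y hy
        rw [tamedField_of_le_sub_two hy.le, zero_smul, add_zero]
      · have hτ₀ : 0 ≤ R * (‖x‖ - (ρ - 2)) := mul_nonneg hR (by linarith)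
        refine stronglyMonotoneCocoercive_fderiv_of_radial hx hm.le hH hgH
          (((hasDerivAt_id ‖x‖).sub_const (ρ - 2)).const_mul R) hτ₀ (by positivity) ?_ hM
        filter_upwards [hgt hgt₂, hlt hlt₁] with y hy₂ hy₁
        exact tamedField_of_le_sub_one hy₂ hy₁
    · refine stronglyMonotoneCocoercive_fderiv_of_shell hx hm hH hgH (hgR hlt₀) hlt₀.le ?_ hM
      filter_upwards [hgt hgt₁, hlt hlt₀] with y hy₁ hy₀
      exact tamedField_of_lt hy₁ hy₀
  · refine stronglyMonotoneCocoercive_fderiv_of_radial hx hm.le ContinuousLinearMap.isPositive_zero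
      (hasFDerivAt_const 0 x) ((hasDerivAt_inv hxpos.ne').const_mul (R * ρ)) (by positivity)
      (le_of_eq (by field_simp; ring)) ?_ hM
    filter_upwards [hgt hgt₀] with y hy
    rw [tamedField_of_gt hy, zero_add]

end Derivative

section Gradient

variable {V : Type*} [NormedAddCommGroup V] [InnerProductSpace ℝ V] {x : V} {H : V →L[ℝ] V}

theorem inner_gradient_fderiv_symm [CompleteSpace V] {u : V → ℝ} (hu : Differentiable ℝ u)
    (hH : HasFDerivAt (gradient u) H x) (v w : V) : inner ℝ (H v) w = inner ℝ v (H w) := by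
  have hgrad (y : V) : HasFDerivAt u (InnerProductSpace.toDual ℝ V (gradient u y)) y :=
    (hu y).hasGradientAt.hasFDerivAt
  have hsecond : HasFDerivAt (fun y => InnerProductSpace.toDual ℝ V (gradient u y))
      ((innerSL ℝ).comp H) x :=
    ((innerSL ℝ : V →L[ℝ] V →L[ℝ] ℝ).hasFDerivAt).comp x hH
  rw [real_inner_comm (H w) v]
  simpa using second_derivative_symmetric hgrad hsecond v w

theorem inner_fderiv_nonneg_of_monotone {f : V → V} (hf : HasFDerivAt f H x)
    (hmono : ∀ y, 0 ≤ inner ℝ (f y - f x) (y - x)) (v : V) : 0 ≤ inner ℝ (H v) v := by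
  have hline : HasDerivAt (fun t : ℝ => f (x + t • v)) (H v) 0 := hf.hasLineDerivAt v
  have hslope := hline.tendsto_slope_zero_right.inner (𝕜 := ℝ) (tendsto_const_nhds (x := v))
  refine ge_of_tendsto hslope ?_
  filter_upwards [self_mem_nhdsWithin] with t ht
  have hty := hmono (x + t • v)
  rw [add_sub_cancel_left, real_inner_smul_right] at hty
  have hinner := nonneg_of_mul_nonneg_right hty ht
  rw [zero_add, zero_smul, add_zero, real_inner_smul_left]
  exact mul_nonneg (inv_nonneg.2 (le_of_lt ht)) hinner

theorem isPositive_of_hasFDerivAt_gradient_sub_smul [CompleteSpace V] {u : V → ℝ} {m : ℝ}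
    (hu : Differentiable ℝ u)
    (hconv : ∀ x y, m * ‖x - y‖ ^ 2 ≤ inner ℝ (gradient u x - gradient u y) (x - y))
    (hH : HasFDerivAt (fun y => gradient u y - m • y) H x) : H.IsPositive := by
  refine (ContinuousLinearMap.isPositive_iff _).2 ⟨fun v w => ?_,
    inner_fderiv_nonneg_of_monotone hH fun y => ?_⟩
  · have hgrad : HasFDerivAt (gradient u) (H + m • ContinuousLinearMap.id ℝ V) x := by
      have hsum := hH.add ((hasFDerivAt_id x).const_smul m)
      exact hsum.congr_of_eventuallyEq (.of_forall fun y => (sub_add_cancel _ (m • y)).symm)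
    have hsymm := inner_gradient_fderiv_symm hu hgrad v w
    simp only [add_apply, smul_apply, ContinuousLinearMap.id_apply, inner_add_left, inner_add_right,
      real_inner_smul_left, real_inner_smul_right] at hsymm
    exact add_right_cancel hsymm
  · have hsplit : gradient u y - m • y - (gradient u x - m • x)
        = (gradient u y - gradient u x) - m • (y - x) := by module
    rw [hsplit, inner_sub_left, real_inner_smul_left, real_inner_self_eq_norm_sq]
    exact sub_nonneg.2 (hconv y x)

end Gradient

section Rademacher

variable {V : Type*} [NormedAddCommGroup V] [InnerProductSpace ℝ V] [FiniteDimensional ℝ V]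
  [MeasurableSpace V] [BorelSpace V] {μ : Measure V} [μ.IsAddHaarMeasure]

theorem ae_norm_ne [Nontrivial V] (r : ℝ) : ∀ᵐ x ∂μ, ‖x‖ ≠ r := by
  refine measure_mono_null (fun x hx => ?_) (Measure.addHaar_sphere μ (0 : V) r)
  simpa using hx

theorem ae_stronglyMonotoneCocoercive_fderiv_tamedField [Nontrivial V] {u : V → ℝ}
    {m R ρ : ℝ} {K K' : ℝ≥0} (hu : Differentiable ℝ u) (hm : 0 < m) (hρ : 0 < ρ)
    (hconv : ∀ x y, m * ‖x - y‖ ^ 2 ≤ inner ℝ (gradient u x - gradient u y) (x - y))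
    (hg : LipschitzOnWith K (fun y => gradient u y - m • y) (Metric.ball 0 ρ))
    (hR : ∀ x ∈ Metric.ball 0 ρ, ‖gradient u x - m • x‖ ≤ R)
    (hT : LipschitzWith K' (tamedField (fun y => gradient u y - m • y) R ρ m)) :
    ∀ᵐ x ∂μ, StronglyMonotoneCocoercive m (2 * K' - m)
      (fderiv ℝ (tamedField (fun y => gradient u y - m • y) R ρ m) x) := by
  filter_upwards [hg.ae_differentiableWithinAt_of_mem, ae_norm_ne 0, ae_norm_ne ρ,
    ae_norm_ne (ρ - 1), ae_norm_ne (ρ - 2)] with x hdiff hx hx₀ hx₁ hx₂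
  refine stronglyMonotoneCocoercive_fderiv_tamedField (norm_ne_zero_iff.1 hx) hm hρ
    ((norm_nonneg _).trans (hR 0 (Metric.mem_ball_self hρ))) hx₀ hx₁ hx₂ (fun hlt => ?_)
    (fun hlt => hR x (mem_ball_zero_iff.2 hlt)) (norm_fderiv_le_of_lipschitz ℝ hT)
  have hball := mem_ball_zero_iff.2 hlt
  have hderiv := ((hdiff hball).differentiableAt (Metric.isOpen_ball.mem_nhds hball)).hasFDerivAt
  exact ⟨_, isPositive_of_hasFDerivAt_gradient_sub_smul hu hconv hderiv, hderiv⟩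

end Rademacher

section TamedDrift

variable {d : ℕ} {h : Vec d → Vec d} {m L l lam : ℝ}

theorem norm_shifted_le_tamingSup (hh : Continuous h) {x : Vec d}
    (hx : x ∈ Metric.ball 0 (tamingRadius m L l lam)) :
    ‖shifted h m x‖ ≤ tamingSup h m L l lam := by
  have hcont : Continuous fun y => ‖shifted h m y‖ := by unfold shifted; fun_prop
  refine le_csSup ?_ ⟨x, hx, rfl⟩
  exact ((isCompact_closedBall _ _).image hcont).bddAbove.mono
    (Set.image_mono Metric.ball_subset_closedBall)

theorem exists_lipschitzOnWith_shifted (hh : LocallyLipschitz h) (m r : ℝ) :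
    ∃ K, LipschitzOnWith K (shifted h m) (Metric.ball 0 r) := by
  have hshift : LocallyLipschitz (shifted h m) :=
    hh.sub (lipschitzWith_smul m).locallyLipschitz
  obtain ⟨K, hK⟩ := LocallyLipschitzOn.exists_lipschitzOnWith_of_compact
    (isCompact_closedBall (0 : Vec d) r) hshift.locallyLipschitzOn
  exact ⟨K, hK.mono Metric.ball_subset_closedBall⟩

theorem lipschitzWith_lipConst_tamedDrift (hh : LocallyLipschitz h)
    (hρ : 0 < tamingRadius m L l lam) :
    LipschitzWith (lipConst (tamedDrift h m L l lam)) (tamedDrift h m L l lam) := by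
  obtain ⟨K, hK⟩ := exists_lipschitzOnWith_shifted hh m (tamingRadius m L l lam)
  obtain ⟨K', hK'⟩ := exists_lipschitzWith_tamedField m hρ hK fun x hx =>
    norm_shifted_le_tamingSup hh.continuous hx
  exact lipschitzWith_lipConst hK'

theorem ae_stronglyMonotoneCocoercive_fderiv_tamedDrift [NeZero d] {u : Vec d → ℝ} {K : ℝ≥0}
    (hu : Differentiable ℝ u) (hlip : LocallyLipschitz (gradient u)) (hm : 0 < m)
    (hρ : 0 < tamingRadius m L l lam)
    (hconv : ∀ x y, m * ‖x - y‖ ^ 2 ≤ inner ℝ (gradient u x - gradient u y) (x - y))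
    (hK : LipschitzWith K (tamedDrift (gradient u) m L l lam)) :
    ∀ᵐ x, StronglyMonotoneCocoercive m (2 * K - m)
      (fderiv ℝ (tamedDrift (gradient u) m L l lam) x) := by
  obtain ⟨K₀, hK₀⟩ := exists_lipschitzOnWith_shifted hlip m (tamingRadius m L l lam)
  exact ae_stronglyMonotoneCocoercive_fderiv_tamedField hu hm hρ hconv hK₀
    (fun x hx => norm_shifted_le_tamingSup hlip.continuous hx) hK

end TamedDrift

/-! ### Mollification -/

section Mollification

variable {V : Type*} [NormedAddCommGroup V] [InnerProductSpace ℝ V] {m c : ℝ} {T : V → V} {K : ℝ≥0}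

theorem norm_sq_le_mul_inner_iff (hc : 0 ≤ c) (x y : V) :
    ‖x‖ ^ 2 ≤ c * inner ℝ x y ↔ ‖x - (c / 2) • y‖ ≤ c / 2 * ‖y‖ := by
  have hexpand : ‖x - (c / 2) • y‖ ^ 2 = ‖x‖ ^ 2 - c * inner ℝ x y + (c / 2 * ‖y‖) ^ 2 := by
    rw [norm_sub_sq_real, norm_smul, Real.norm_of_nonneg (by positivity), real_inner_smul_right]
    ring
  rw [← sq_le_sq₀ (norm_nonneg _) (by positivity), hexpand]
  constructor <;> intro h <;> linarith

/- For fixed `x` and `y`, both conditions on `k x - k y` describe closed convex sets: a half-space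
and, by `norm_sq_le_mul_inner_iff`, a ball. -/
theorem StronglyMonotoneCocoercive.integral [CompleteSpace V] {α : Type*} [MeasurableSpace α]
    {ν : Measure α} [IsProbabilityMeasure ν] {k : α → V → V} (hc : 0 ≤ c)
    (hint : ∀ x, Integrable (fun t => k t x) ν)
    (hk : ∀ᵐ t ∂ν, StronglyMonotoneCocoercive m c (k t)) :
    StronglyMonotoneCocoercive m c fun x => ∫ t, k t x ∂ν where
  mul_norm_sq_le x y := by
    rw [← integral_sub (hint x) (hint y), real_inner_comm]
    have hhalf : IsClosed {z | m * ‖x - y‖ ^ 2 ≤ inner ℝ (x - y) z} :=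
      isClosed_le continuous_const (by fun_prop)
    refine (convex_halfSpace_ge (innerₗ V (x - y)).isLinear _).integral_mem hhalf ?_
      ((hint x).sub (hint y))
    filter_upwards [hk] with t ht
    exact (ht.mul_norm_sq_le x y).trans_eq (real_inner_comm _ _)
  norm_sq_le x y := by
    rw [← integral_sub (hint x) (hint y), norm_sq_le_mul_inner_iff hc, ← dist_eq_norm]
    refine (convex_closedBall ((c / 2) • (x - y)) _).integral_mem Metric.isClosed_closedBall ?_
      ((hint x).sub (hint y))
    filter_upwards [hk] with t ht
    rw [mem_closedBall_iff_norm]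
    exact (norm_sq_le_mul_inner_iff hc _ _).1 (ht.norm_sq_le x y)

theorem mul_norm_sq_le_inner_sub_of_fderiv {f : V → V} (hf : Differentiable ℝ f)
    (hmono : ∀ x ξ, m * ‖ξ‖ ^ 2 ≤ inner ℝ (fderiv ℝ f x ξ) ξ) (x y : V) :
    m * ‖x - y‖ ^ 2 ≤ inner ℝ (f x - f y) (x - y) := by
  set ξ := x - y with hξ
  have hderiv (t : ℝ) :
      HasDerivAt (fun t : ℝ => inner ℝ (f (y + t • ξ)) ξ - t * (m * ‖ξ‖ ^ 2))
        (inner ℝ (fderiv ℝ f (y + t • ξ) ξ) ξ - m * ‖ξ‖ ^ 2) t := by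
    have hline : HasDerivAt (fun t : ℝ => y + t • ξ) ξ t := by
      simpa using ((hasDerivAt_id t).smul_const ξ).const_add y
    have hinner := ((hf (y + t • ξ)).hasFDerivAt.comp_hasDerivAt t hline).inner ℝ
      (hasDerivAt_const t ξ)
    exact (hinner.sub ((hasDerivAt_id t).mul_const (m * ‖ξ‖ ^ 2))).congr_deriv (by simp)
  have hle := monotone_of_deriv_nonneg (fun t => (hderiv t).differentiableAt)
    (fun t => (hderiv t).deriv ▸ sub_nonneg.2 (hmono _ ξ)) (zero_le_one' ℝ)
  have hx : y + ξ = x := by rw [hξ]; abel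
  simp only [zero_smul, add_zero, zero_mul, sub_zero, one_smul, one_mul, hx] at hle
  rw [inner_sub_left]
  linarith

theorem StronglyMonotoneCocoercive.of_fderiv {f : V → V} (hf : Differentiable ℝ f) (hc : 0 ≤ c)
    (h : ∀ x, StronglyMonotoneCocoercive m c (fderiv ℝ f x)) :
    StronglyMonotoneCocoercive m c f where
  mul_norm_sq_le := mul_norm_sq_le_inner_sub_of_fderiv hf fun x ξ => by
    simpa using (h x).mul_norm_sq_le ξ 0
  norm_sq_le x y := by
    rw [norm_sq_le_mul_inner_iff hc]
    have hderiv (z : V) : HasFDerivAt (fun z => f z - (c / 2) • z)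
        (fderiv ℝ f z - (c / 2) • ContinuousLinearMap.id ℝ V) z :=
      (hf z).hasFDerivAt.sub ((hasFDerivAt_id z).const_smul (c / 2))
    have hbound (z : V) : ‖fderiv ℝ (fun z => f z - (c / 2) • z) z‖ ≤ c / 2 := by
      rw [(hderiv z).fderiv]
      refine ContinuousLinearMap.opNorm_le_bound _ (by positivity) fun ξ => ?_
      have hξ := (norm_sq_le_mul_inner_iff hc _ _).1 ((h z).norm_sq_le ξ 0)
      simpa using hξ
    have hle := convex_univ.norm_image_sub_le_of_norm_fderiv_le (𝕜 := ℝ)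
      (fun z _ => (hderiv z).differentiableAt) (fun z _ => hbound z) (Set.mem_univ y)
      (Set.mem_univ x)
    rwa [sub_sub_sub_comm, ← smul_sub] at hle

variable [FiniteDimensional ℝ V] [MeasurableSpace V] [BorelSpace V]

theorem integrable_fderiv_sub {ν : Measure V} [IsFiniteMeasure ν] (hT : LipschitzWith K T) (x : V) :
    Integrable (fun t => fderiv ℝ T (x - t)) ν :=
  .of_bound ((measurable_fderiv ℝ T).comp (by fun_prop)).aestronglyMeasurable K
    (.of_forall fun _ => norm_fderiv_le_of_lipschitz ℝ hT)

theorem ae_sub_left_of_ae {ν : Measure V} (hν : ν ≪ volume) {p : V → Prop}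
    (hp : ∀ᵐ x : V, p x) (x : V) : ∀ᵐ t ∂ν, p (x - t) :=
  hν ((Measure.measurePreserving_sub_left volume x).quasiMeasurePreserving.ae hp)

theorem hasFDerivAt_integral_sub {ν : Measure V} [IsFiniteMeasure ν] (hν : ν ≪ volume)
    (hT : LipschitzWith K T) (hint : ∀ x, Integrable (fun t => T (x - t)) ν) (x : V) :
    HasFDerivAt (fun x => ∫ t, T (x - t) ∂ν) (∫ t, fderiv ℝ T (x - t) ∂ν) x := by
  refine (hasFDerivAt_integral_of_dominated_loc_of_lip' (F := fun y t => T (y - t))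
    (bound := fun _ => K) univ_mem (fun y _ => (hint y).aestronglyMeasurable) (hint x)
    (integrable_fderiv_sub hT x).aestronglyMeasurable (.of_forall fun t y _ => ?_)
    (integrable_const _) ?_).2
  · simpa only [sub_sub_sub_cancel_right] using hT.norm_sub_le (y - t) (x - t)
  · filter_upwards [ae_sub_left_of_ae hν hT.ae_differentiableAt x] with t ht
    exact (ht.hasFDerivAt.comp x ((hasFDerivAt_id x).sub_const t)).congr_fderiv
      (ContinuousLinearMap.comp_id _)

theorem StronglyMonotoneCocoercive.integral_sub_of_ae_fderiv {ν : Measure V}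
    [IsProbabilityMeasure ν] (hν : ν ≪ volume) (hT : LipschitzWith K T)
    (hint : ∀ x, Integrable (fun t => T (x - t)) ν) (hc : 0 ≤ c)
    (hae : ∀ᵐ x : V, StronglyMonotoneCocoercive m c (fderiv ℝ T x)) :
    StronglyMonotoneCocoercive m c fun x => ∫ t, T (x - t) ∂ν := by
  have hderiv := hasFDerivAt_integral_sub hν hT hint
  refine .of_fderiv (fun x => (hderiv x).differentiableAt) hc fun x => ?_
  have hfint := integrable_fderiv_sub (ν := ν) hT x
  have hmean := StronglyMonotoneCocoercive.integral hc
    (fun ξ => hfint.apply_continuousLinearMap ξ) (ae_sub_left_of_ae hν hae x)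
  rw [(hderiv x).fderiv]
  convert hmean using 2 with ξ
  exact ContinuousLinearMap.integral_apply hfint ξ

/-- The probability measure whose density with respect to Lebesgue measure is the normalization of
the bump function `φ`; convolution with it is mollification. -/
noncomputable def bumpMeasure (φ : ContDiffBump (0 : V)) : Measure V :=
  volume.withDensity fun t => (φ.normed volume t).toNNReal

variable (φ : ContDiffBump (0 : V))

theorem measurable_toNNReal_normed : Measurable fun t => (φ.normed volume t).toNNReal :=
  φ.continuous_normed.measurable.real_toNNReal

theorem bumpMeasure_absolutelyContinuous : bumpMeasure φ ≪ volume :=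
  withDensity_absolutelyContinuous _ _

instance isProbabilityMeasure_bumpMeasure : IsProbabilityMeasure (bumpMeasure φ) := by
  refine ⟨?_⟩
  rw [bumpMeasure, withDensity_apply _ .univ, Measure.restrict_univ]
  exact (ofReal_integral_eq_lintegral_ofReal φ.integrable_normed
    (.of_forall φ.nonneg_normed)).symm.trans (by rw [φ.integral_normed, ENNReal.ofReal_one])

theorem integral_bumpMeasure_eq_convolution (f : V → V) (x : V) :
    ∫ t, f (x - t) ∂bumpMeasure φ
      = convolution (φ.normed volume) f (ContinuousLinearMap.lsmul ℝ ℝ) volume x := by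
  rw [bumpMeasure, integral_withDensity_eq_integral_smul (measurable_toNNReal_normed φ)]
  refine integral_congr_ae (.of_forall fun t => ?_)
  simp [NNReal.smul_def, φ.nonneg_normed t]

theorem integrable_bumpMeasure {f : V → V} (hf : Continuous f) : Integrable f (bumpMeasure φ) := by
  rw [bumpMeasure, integrable_withDensity_iff_integrable_smul (measurable_toNNReal_normed φ)]
  have hsupp : HasCompactSupport (φ.normed volume) := φ.hasCompactSupport_normed
  refine ((φ.continuous_normed.smul hf).integrable_of_hasCompactSupport hsupp.smul_right).congr
    (.of_forall fun t => ?_)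
  simp [NNReal.smul_def, φ.nonneg_normed t]

theorem exists_contDiff_norm_sub_le (hT : LipschitzWith K T) (hc : 0 ≤ c)
    (hae : ∀ᵐ x : V, StronglyMonotoneCocoercive m c (fderiv ℝ T x)) {ε : ℝ} (hε : 0 < ε) :
    ∃ k : V → V, ContDiff ℝ 1 k ∧ StronglyMonotoneCocoercive m c k ∧
      ∀ x, dist (k x) (T x) ≤ K * ε := by
  let φ : ContDiffBump (0 : V) := ⟨ε / 2, ε, by positivity, by linarith⟩
  refine ⟨fun x => ∫ t, T (x - t) ∂bumpMeasure φ, ?_, ?_, fun x => ?_⟩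
  · simp only [integral_bumpMeasure_eq_convolution]
    exact φ.hasCompactSupport_normed.contDiff_convolution_left _ φ.contDiff_normed
      hT.continuous.locallyIntegrable
  · exact .integral_sub_of_ae_fderiv (bumpMeasure_absolutelyContinuous φ) hT
      (fun x => integrable_bumpMeasure φ (hT.continuous.comp (by fun_prop))) hc hae
  · simp only [integral_bumpMeasure_eq_convolution]
    refine φ.dist_normed_convolution_le hT.continuous.aestronglyMeasurable fun y hy => ?_
    exact (hT.dist_le_mul y x).trans (by gcongr; exact (Metric.mem_ball.1 hy).le)

theorem exists_seq_contDiff_tendstoUniformly (hT : LipschitzWith K T) (hc : 0 ≤ c)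
    (hae : ∀ᵐ x : V, StronglyMonotoneCocoercive m c (fderiv ℝ T x)) :
    ∃ k : ℕ → V → V, (∀ j, ContDiff ℝ 1 (k j)) ∧ (∀ j, StronglyMonotoneCocoercive m c (k j)) ∧
      TendstoUniformly k T atTop := by
  choose k hk hmono hdist using fun j : ℕ =>
    exists_contDiff_norm_sub_le hT hc hae (Nat.one_div_pos_of_nat (α := ℝ) (n := j))
  refine ⟨k, hk, hmono, Metric.tendstoUniformly_iff.2 fun ε hε => ?_⟩
  have hlim : Tendsto (fun j : ℕ => K * (1 / ((j : ℝ) + 1))) atTop (𝓝 0) := by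
    simpa using tendsto_one_div_add_atTop_nhds_zero_nat.const_mul (K : ℝ)
  filter_upwards [hlim.eventually_lt_const hε] with j hj x
  exact (dist_comm (T x) _ ▸ hdist j x).trans_lt hj

end Mollification

/-! ### Contraction of the OBABO step -/

theorem exp_le_one_add_three_halves_mul {x : ℝ} (h0 : 0 ≤ x) (h1 : x ≤ 1 / 2) :
    Real.exp x ≤ 1 + 3 / 2 * x := by
  have h := (abs_le.1 (Real.abs_exp_sub_one_sub_id_le (x := x)
    (by rw [abs_of_nonneg h0]; linarith))).2
  nlinarith

theorem exp_sq_le {x : ℝ} (h0 : 0 ≤ x) (h1 : x ≤ 1 / 4) : Real.exp x ^ 2 ≤ 1 + 3 * x := by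
  rw [sq, ← Real.exp_add, ← two_mul]
  linarith [exp_le_one_add_three_halves_mul (x := 2 * x) (by linarith) (by linarith)]

theorem sinh_le_add_half_cube {x : ℝ} (h0 : 0 ≤ x) (h1 : x ≤ 1) :
    Real.sinh x ≤ x + x ^ 3 / 2 := by
  have hpos := Real.exp_bound (x := x) (abs_le.2 ⟨by linarith, h1⟩) (n := 4) (by norm_num)
  have hneg := Real.exp_bound (x := -x) (abs_le.2 ⟨by linarith, by linarith⟩) (n := 4)
    (by norm_num)
  norm_num [Finset.sum_range_succ, Nat.factorial, abs_of_nonneg h0] at hpos hneg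
  have hfour : x ^ 4 ≤ x ^ 3 := pow_le_pow_of_le_one h0 h1 (by norm_num)
  have hcube : 0 ≤ x ^ 3 := by positivity
  rw [Real.sinh_eq]
  linarith [(abs_le.1 hpos).2, (abs_le.1 hneg).1]

theorem mul_mul_le_of_sq_le {P Q R : ℝ} (hP : 0 < P) (hR : R ^ 2 ≤ 4 * (P * Q)) (y w : ℝ) :
    R * y * w ≤ P * y ^ 2 + Q * w ^ 2 := by
  have h : 0 ≤ 4 * P * (P * y ^ 2 + Q * w ^ 2 - R * y * w) :=
    calc 0 ≤ (2 * P * y - R * w) ^ 2 + (4 * (P * Q) - R ^ 2) * w ^ 2 := by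
          have := mul_nonneg (sub_nonneg.2 hR) (sq_nonneg w)
          positivity
      _ = 4 * P * (P * y ^ 2 + Q * w ^ 2 - R * y * w) := by ring
  linarith [nonneg_of_mul_nonneg_right h (by positivity)]

theorem mul_le_mul_of_abs_le {u U k K : ℝ} (hu : 0 ≤ u) (huU : u ≤ U) (hk : |k| ≤ K) :
    u * k ≤ U * K :=
  calc u * k ≤ u * |k| := by gcongr; exact le_abs_self k
    _ ≤ U * K := by gcongr; exact hu.trans huU

/-- The parameter regime of the contraction estimate, with `a = 1 / M` and `b = 1 / γ` encoded by
the equations `a * M = 1` and `b * γ = 1`. The condition `4 * b ≤ a * γ` says `4 * M ≤ γ ^ 2`. -/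
structure ObaboParams (a b γ m M lam : ℝ) : Prop where
  m_pos : 0 < m
  m_le : m ≤ M
  two_le : 2 ≤ M
  a_mul : a * M = 1
  b_mul : b * γ = 1
  γ_pos : 0 < γ
  four_b_le : 4 * b ≤ a * γ
  lam_pos : 0 < lam
  step_le : 33 * (lam * γ) ≤ m * b ^ 2

/-- The quadratic form `|x|² + 2b⟨x, v⟩ + a|v|²`, which is `|S(x, v)|²` for the shear `S`. -/
def twistedSq {E : Type*} [NormedAddCommGroup E] [InnerProductSpace ℝ E] (a b : ℝ) (x v : E) : ℝ :=
  ‖x‖ ^ 2 + 2 * b * inner ℝ x v + a * ‖v‖ ^ 2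

theorem twistedSq_smul_add_smul {E : Type*} [NormedAddCommGroup E] [InnerProductSpace ℝ E]
    (a b c r : ℝ) (x w y : E) :
    twistedSq a b x (c • (w + r • y))
      = ‖x‖ ^ 2 + 2 * b * c * (inner ℝ x w + r * inner ℝ y x)
        + a * c ^ 2 * (‖w‖ ^ 2 + 2 * r * inner ℝ y w + r ^ 2 * ‖y‖ ^ 2) := by
  rw [twistedSq, inner_smul_right, inner_add_right, norm_smul, mul_pow, norm_add_sq_real]
  simp only [inner_smul_right, norm_smul, mul_pow, Real.norm_eq_abs, sq_abs]
  rw [real_inner_comm y w, real_inner_comm y x]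
  ring

namespace ObaboParams

variable {a b γ m M lam δ : ℝ}

theorem M_pos (h : ObaboParams a b γ m M lam) : 0 < M := by
  linarith [h.two_le]

theorem a_pos (h : ObaboParams a b γ m M lam) : 0 < a :=
  pos_of_mul_pos_left (h.a_mul ▸ one_pos) h.M_pos.le

theorem a_le_half (h : ObaboParams a b γ m M lam) : a ≤ 1 / 2 := by
  nlinarith [h.a_mul, h.a_pos, h.two_le]

theorem b_pos (h : ObaboParams a b γ m M lam) : 0 < b :=
  pos_of_mul_pos_left (h.b_mul ▸ one_pos) h.γ_pos.le

theorem four_b_sq_le (h : ObaboParams a b γ m M lam) : 4 * b ^ 2 ≤ a :=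
  calc 4 * b ^ 2 = 4 * b * b := by ring
    _ ≤ a * γ * b := mul_le_mul_of_nonneg_right h.four_b_le h.b_pos.le
    _ = a := by linear_combination a * h.b_mul

theorem b_sq_lt (h : ObaboParams a b γ m M lam) : b ^ 2 < a := by
  nlinarith [h.four_b_sq_le, h.a_pos]

theorem M_mul_b_sq_le (h : ObaboParams a b γ m M lam) : M * b ^ 2 ≤ 1 / 4 := by
  nlinarith [mul_le_mul_of_nonneg_left h.four_b_sq_le h.M_pos.le, h.a_mul]

theorem m_mul_b_sq_le (h : ObaboParams a b γ m M lam) : m * b ^ 2 ≤ 1 / 4 :=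
  (mul_le_mul_of_nonneg_right h.m_le (sq_nonneg b)).trans h.M_mul_b_sq_le

theorem m_mul_b_sq_pos (h : ObaboParams a b γ m M lam) : 0 < m * b ^ 2 :=
  mul_pos h.m_pos (pow_pos h.b_pos 2)

theorem lam_mul_γ_pos (h : ObaboParams a b γ m M lam) : 0 < lam * γ :=
  mul_pos h.lam_pos h.γ_pos

theorem lam_mul_γ_le (h : ObaboParams a b γ m M lam) : lam * γ ≤ 1 / 132 := by
  linarith [h.step_le, h.m_mul_b_sq_le]

theorem lam_eq (h : ObaboParams a b γ m M lam) : lam = lam * γ * b := by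
  linear_combination -lam * h.b_mul

theorem lam_sq_mul_le (h : ObaboParams a b γ m M lam) : lam ^ 2 * M ≤ 1 / 100 :=
  calc lam ^ 2 * M = (lam * γ) ^ 2 * (M * b ^ 2) := by
        nth_rewrite 1 [h.lam_eq]
        ring
    _ ≤ (1 / 132) ^ 2 * (1 / 4) :=
        mul_le_mul (pow_le_pow_left₀ h.lam_mul_γ_pos.le h.lam_mul_γ_le 2) h.M_mul_b_sq_le
          (mul_nonneg h.M_pos.le (sq_nonneg b)) (by positivity)
    _ ≤ 1 / 100 := by norm_num

theorem a_mul_sq_le (h : ObaboParams a b γ m M lam) {Y q : ℝ} (hY : Y ^ 2 ≤ (2 * M - m) * q) :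
    a * Y ^ 2 ≤ 2 * q := by
  have hc : 0 < 2 * M - m := by linarith [h.m_le, h.M_pos]
  have hq : 0 ≤ q := nonneg_of_mul_nonneg_right ((sq_nonneg Y).trans hY) hc
  calc a * Y ^ 2 ≤ a * ((2 * M - m) * q) := mul_le_mul_of_nonneg_left hY h.a_pos.le
    _ = 2 * q - a * m * q := by linear_combination 2 * q * h.a_mul
    _ ≤ 2 * q := sub_le_self _ (mul_nonneg (mul_nonneg h.a_pos.le h.m_pos.le) hq)

theorem rate_mul_lam_le (h : ObaboParams a b γ m M lam) (hδ : δ = lam * γ / 2) :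
    m * b / 3 * lam * (1 + 3 * δ) ≤ δ / 5 := by
  have hδ0 : 0 < δ := by linarith [h.lam_mul_γ_pos]
  have hδ1 : δ ≤ 1 / 264 := by linarith [h.lam_mul_γ_le]
  calc m * b / 3 * lam * (1 + 3 * δ) = 2 / 3 * δ * (m * b ^ 2) * (1 + 3 * δ) := by
        linear_combination m * b / 3 * (1 + 3 * δ) * (h.lam_eq - 2 * b * hδ)
    _ ≤ 2 / 3 * δ * (1 / 4) * (1 + 3 * (1 / 264)) := by
        have := h.m_mul_b_sq_le
        gcongr
    _ ≤ δ / 5 := by linarith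

theorem force_mul_le (h : ObaboParams a b γ m M lam) {s t Y q : ℝ} (hs : 0 < s)
    (hst : 1 ≤ 4 * (s * t)) (hY : Y ^ 2 ≤ (2 * M - m) * q) (W : ℝ) :
    a * (Y * W) ≤ s * (b * q) + t * (2 - a * m) * (a * γ) * W ^ 2 := by
  have hc : 0 < 2 * M - m := by linarith [h.m_le, h.M_pos]
  have hac : a * (2 * M - m) = 2 - a * m := by linear_combination 2 * h.a_mul
  have hPQ : s * b / (2 * M - m) * (t * (2 - a * m) * (a * γ)) = s * t * a ^ 2 := by
    rw [← hac]
    field_simp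
    linear_combination t * a ^ 2 * h.b_mul
  have hyoung := mul_mul_le_of_sq_le (P := s * b / (2 * M - m)) (R := a)
    (Q := t * (2 - a * m) * (a * γ)) (div_pos (mul_pos hs h.b_pos) hc)
    (by rw [hPQ]; nlinarith [sq_nonneg a]) Y W
  have hforce : s * b / (2 * M - m) * Y ^ 2 ≤ s * (b * q) :=
    calc s * b / (2 * M - m) * Y ^ 2 ≤ s * b / (2 * M - m) * ((2 * M - m) * q) :=
          mul_le_mul_of_nonneg_left hY (div_pos (mul_pos hs h.b_pos) hc).le
      _ = s * (b * q) := by field_simp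
  linarith

theorem position_mul_le (h : ObaboParams a b γ m M lam) {s t X q : ℝ} (hs : 0 < s) (ht : 0 ≤ t)
    (hst : 1 ≤ 16 * (s * t)) (hX : m * X ^ 2 ≤ q) (W : ℝ) :
    m * b ^ 2 * (X * W) ≤ s * (b * q) + t * (m * b ^ 2) * (a * γ) * W ^ 2 := by
  have hyoung := mul_mul_le_of_sq_le (P := s * b * m) (R := m * b ^ 2)
    (Q := t * (m * b ^ 2) * (4 * b)) (mul_pos (mul_pos hs h.b_pos) h.m_pos)
    (by nlinarith [sq_nonneg (m * b ^ 2)]) X W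
  have hposition := mul_le_mul_of_nonneg_left hX (mul_pos hs h.b_pos).le
  have hkin := mul_le_mul_of_nonneg_right (mul_le_mul_of_nonneg_left h.four_b_le
    (mul_nonneg ht h.m_mul_b_sq_pos.le)) (sq_nonneg W)
  linarith

theorem position_coeff_le (h : ObaboParams a b γ m M lam) (hδ : δ = lam * γ / 2) :
    δ ^ 2 + 2 / 3 * (m * b ^ 2) * (1 + 2 * δ) ≤ 0.68 * (m * b ^ 2) := by
  have hδ0 : 0 < δ := by linarith [h.lam_mul_γ_pos]
  have hδ1 : δ ≤ 1 / 264 := by linarith [h.lam_mul_γ_le]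
  have hδ2 : δ * δ ≤ δ * (1 / 264) := mul_le_mul_of_nonneg_left hδ1 hδ0.le
  have hμδ : m * b ^ 2 * δ ≤ m * b ^ 2 * (1 / 264) :=
    mul_le_mul_of_nonneg_left hδ1 h.m_mul_b_sq_pos.le
  linarith [h.step_le]

theorem kinetic_coeff_le (h : ObaboParams a b γ m M lam) (hδ : δ = lam * γ / 2) :
    0.68 * (2 - a * m) + 0.58 * (m * b ^ 2) ≤ 3 / 2 - δ / 2 - m * b ^ 2 / 3 * (1 + 3 * δ) := by
  have hδ1 : δ ≤ 1 / 264 := by linarith [h.lam_mul_γ_le]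
  have hμδ : m * b ^ 2 * δ ≤ m * b ^ 2 * (1 / 264) :=
    mul_le_mul_of_nonneg_left hδ1 h.m_mul_b_sq_pos.le
  have hμ : m * (4 * b ^ 2) ≤ m * a := mul_le_mul_of_nonneg_left h.four_b_sq_le h.m_pos.le
  linarith [h.m_mul_b_sq_pos]

-- The splitting constants are tuned so that the terms in `q₀`, `q₁` and `W ^ 2` all just fit.
theorem cross_terms_le (h : ObaboParams a b γ m M lam) (hδ : δ = lam * γ / 2)
    {X W q₀ q₁ Y₀ Y₁ : ℝ} (hX : 0 ≤ X) (hW : 0 ≤ W) (hY₀ : 0 ≤ Y₀) (hq₀ : m * X ^ 2 ≤ q₀)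
    (hc₀ : Y₀ ^ 2 ≤ (2 * M - m) * q₀) (hc₁ : Y₁ ^ 2 ≤ (2 * M - m) * q₁) :
    (δ ^ 2 + 2 / 3 * (m * b ^ 2) * (1 + 2 * δ)) * (X * W) + a * (1 + 3.2 * δ) * (Y₀ * W)
        + a * (Y₁ * W)
      ≤ b * (2 / 3 - δ / 5 - δ ^ 2) * q₀ + b * (1 - 2 * δ) * q₁
        + a * γ * (3 / 2 - δ / 2 - m * b ^ 2 / 3 * (1 + 3 * δ)) * W ^ 2 := by
  have hδ0 : 0 < δ := by linarith [h.lam_mul_γ_pos]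
  have hδ1 : δ ≤ 1 / 264 := by linarith [h.lam_mul_γ_le]
  have hbq₀ : 0 ≤ b * q₀ :=
    mul_nonneg h.b_pos.le ((mul_nonneg h.m_pos.le (sq_nonneg X)).trans hq₀)
  have hbq₁ : 0 ≤ b * q₁ := mul_nonneg h.b_pos.le
    (nonneg_of_mul_nonneg_right ((sq_nonneg Y₁).trans hc₁) (by linarith [h.m_le, h.M_pos]))
  have haW : 0 ≤ a * γ * W ^ 2 := mul_nonneg (mul_nonneg h.a_pos.le h.γ_pos.le) (sq_nonneg W)
  have haWm : 0 ≤ a * γ * W ^ 2 * (2 - a * m) := mul_nonneg haW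
    (by linarith [h.a_mul ▸ mul_le_mul_of_nonneg_left h.m_le h.a_pos.le])
  have haWμ : 0 ≤ a * γ * W ^ 2 * (m * b ^ 2) := mul_nonneg haW h.m_mul_b_sq_pos.le
  have hyoung₁ := h.force_mul_le (s := 0.99) (t := 0.26) (by norm_num) (by norm_num) hc₁ W
  have hyoung₀ := h.force_mul_le (s := 0.607) (t := 0.4149) (by norm_num) (by norm_num) hc₀ W
  have hyoungX := h.position_mul_le (s := 0.0735) (t := 0.8529) (by norm_num) (by norm_num)
    (by norm_num) hq₀ W
  have hXW := mul_le_mul_of_nonneg_right (h.position_coeff_le hδ) (mul_nonneg hX hW)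
  have hYW := mul_le_mul_of_nonneg_left (by linarith : 1 + 3.2 * δ ≤ 1.0122)
    (mul_nonneg h.a_pos.le (mul_nonneg hY₀ hW))
  have hq₁ := mul_le_mul_of_nonneg_left (by linarith : 0.99 ≤ 1 - 2 * δ) hbq₁
  have hq₀ := mul_le_mul_of_nonneg_left (by nlinarith : 0.665 ≤ 2 / 3 - δ / 5 - δ ^ 2) hbq₀
  have hkin := mul_le_mul_of_nonneg_left (h.kinetic_coeff_le hδ) haW
  linarith

section Energy

variable {E : Type*} [NormedAddCommGroup E] [InnerProductSpace ℝ E]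

theorem twistedSq_kick_le (h : ObaboParams a b γ m M lam) (hδ : δ = lam * γ / 2) {x w y : E}
    (hcoc : ‖y‖ ^ 2 ≤ (2 * M - m) * inner ℝ y (x + lam • w)) :
    twistedSq a b (x + lam • w) (Real.exp (-δ) • (w - (lam / 2) • y))
      ≤ ‖x‖ ^ 2 + 2 * (lam + b * Real.exp (-δ)) * inner ℝ x w
        + (lam ^ 2 + 2 * b * lam * Real.exp (-δ) + a * Real.exp (-δ) ^ 2) * ‖w‖ ^ 2
        - lam * b * (1 - 2 * δ) * inner ℝ y (x + lam • w) + lam * a * (‖y‖ * ‖w‖) := by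
  have ha := h.a_pos
  have hb := h.b_pos
  have hlam := h.lam_pos
  have hδ0 : 0 < δ := by linarith [h.lam_mul_γ_pos]
  have he0 : 0 ≤ Real.exp (-δ) := (Real.exp_pos _).le
  have he1 : Real.exp (-δ) ≤ 1 := Real.exp_le_one_iff.2 (by linarith)
  have he : 1 - δ ≤ Real.exp (-δ) := Real.one_sub_le_exp_neg δ
  have hq : a * ‖y‖ ^ 2 ≤ 2 * inner ℝ y (x + lam • w) := h.a_mul_sq_le hcoc
  have hinner : inner ℝ (x + lam • w) (w - (lam / 2) • y)
      = inner ℝ x w + lam * ‖w‖ ^ 2 - lam / 2 * inner ℝ y (x + lam • w) := by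
    rw [inner_sub_right, inner_smul_right, real_inner_comm y, inner_add_left, real_inner_smul_left,
      real_inner_self_eq_norm_sq]
  rw [twistedSq, inner_smul_right, hinner, norm_smul, mul_pow, Real.norm_of_nonneg he0,
    norm_add_sq_real, norm_sub_sq_real]
  simp only [inner_smul_right, norm_smul, mul_pow, Real.norm_eq_abs, sq_abs]
  rw [real_inner_comm y w]
  set e := Real.exp (-δ)
  set q : ℝ := inner ℝ y (x + lam • w)
  have hq0 : 0 ≤ q := by nlinarith [sq_nonneg ‖y‖]
  have he2 : e ^ 2 ≤ 1 := pow_le_one₀ he0 he1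
  have hforce : b * lam * (1 - δ) * q ≤ b * lam * e * q := by gcongr
  have hcross : a * lam * (e ^ 2 * -inner ℝ y w) ≤ a * lam * (1 * (‖y‖ * ‖w‖)) := by
    have := mul_le_mul_of_abs_le (sq_nonneg e) he2
      (abs_neg (inner ℝ y w : ℝ) ▸ abs_real_inner_le_norm y w)
    gcongr
  have hsq : lam ^ 2 / 4 * (e ^ 2 * (a * ‖y‖ ^ 2)) ≤ lam ^ 2 / 4 * (1 * (2 * q)) := by gcongr
  have hlam2 : lam ^ 2 / 4 * (1 * (2 * q)) = lam * b * δ * q := by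
    rw [hδ]
    linear_combination lam / 2 * q * h.lam_eq
  linarith

theorem le_twistedSq_exp_smul (h : ObaboParams a b γ m M lam) (hδ : δ = lam * γ / 2) {x w y : E}
    (hmon : m * ‖x‖ ^ 2 ≤ inner ℝ y x) :
    ‖x‖ ^ 2 + 2 * b * Real.exp δ * inner ℝ x w + a * Real.exp δ ^ 2 * ‖w‖ ^ 2
        + lam * b * inner ℝ y x - lam * a * (1 + 3 * δ) * (‖y‖ * ‖w‖)
      ≤ twistedSq a b x (Real.exp δ • (w + (lam / 2) • y)) := by
  have ha := h.a_pos
  have hb := h.b_pos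
  have hlam := h.lam_pos
  have hδ0 : 0 < δ := by linarith [h.lam_mul_γ_pos]
  have hq : 0 ≤ inner ℝ y x := (mul_nonneg h.m_pos.le (sq_nonneg _)).trans hmon
  have hf1 : 1 ≤ Real.exp δ := Real.one_le_exp hδ0.le
  have hf2 : Real.exp δ ^ 2 ≤ 1 + 3 * δ := exp_sq_le hδ0.le (by linarith [h.lam_mul_γ_le])
  rw [twistedSq_smul_add_smul]
  have hforce : b * lam * 1 * inner ℝ y x ≤ b * lam * Real.exp δ * inner ℝ y x := by gcongr
  have hcross : a * lam * (Real.exp δ ^ 2 * -inner ℝ y w)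
      ≤ a * lam * ((1 + 3 * δ) * (‖y‖ * ‖w‖)) := by
    have := mul_le_mul_of_abs_le (sq_nonneg (Real.exp δ)) hf2
      (abs_neg (inner ℝ y w : ℝ) ▸ abs_real_inner_le_norm y w)
    gcongr
  have hsq : 0 ≤ a * (Real.exp δ ^ 2 * (lam ^ 2 / 4 * ‖y‖ ^ 2)) := by positivity
  linarith

theorem mul_free_energy_le (h : ObaboParams a b γ m M lam) (hδ : δ = lam * γ / 2) {x w y : E}
    (hmon : m * ‖x‖ ^ 2 ≤ inner ℝ y x) :
    m * b / 3 * (‖x‖ ^ 2 + 2 * b * Real.exp δ * inner ℝ x w + a * Real.exp δ ^ 2 * ‖w‖ ^ 2)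
      ≤ b / 3 * inner ℝ y x + 2 / 3 * (m * b ^ 2) * (1 + 2 * δ) * (‖x‖ * ‖w‖)
        + a * γ * (m * b ^ 2 / 3) * (1 + 3 * δ) * ‖w‖ ^ 2 := by
  have ha := h.a_pos
  have hb := h.b_pos
  have hm := h.m_pos
  have hδ0 : 0 < δ := by linarith [h.lam_mul_γ_pos]
  have hδ1 : δ ≤ 1 / 264 := by linarith [h.lam_mul_γ_le]
  have hf1 : Real.exp δ ≤ 1 + 2 * δ := by
    linarith [exp_le_one_add_three_halves_mul hδ0.le (by linarith)]
  have hf2 : Real.exp δ ^ 2 ≤ 1 + 3 * δ := exp_sq_le hδ0.le (by linarith)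
  have hposition : b / 3 * (m * ‖x‖ ^ 2) ≤ b / 3 * inner ℝ y x := by gcongr
  have hmixed : 2 / 3 * (m * b ^ 2) * (Real.exp δ * inner ℝ x w)
      ≤ 2 / 3 * (m * b ^ 2) * ((1 + 2 * δ) * (‖x‖ * ‖w‖)) := by
    have := mul_le_mul_of_abs_le (Real.exp_pos δ).le hf1 (abs_real_inner_le_norm x w)
    gcongr
  have hkin : m * b / 3 * (a * (Real.exp δ ^ 2 * ‖w‖ ^ 2))
      ≤ a * γ * (m * b ^ 2 / 3) * (1 + 3 * δ) * ‖w‖ ^ 2 :=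
    calc m * b / 3 * (a * (Real.exp δ ^ 2 * ‖w‖ ^ 2))
        ≤ m * b / 3 * (a * ((1 + 3 * δ) * ‖w‖ ^ 2)) := by gcongr
      _ = a * γ * (m * b ^ 2 / 3) * (1 + 3 * δ) * ‖w‖ ^ 2 := by
        linear_combination -(m * b * a * (1 + 3 * δ) * ‖w‖ ^ 2) / 3 * h.b_mul
  linarith

theorem mul_force_energy_le (h : ObaboParams a b γ m M lam) (hδ : δ = lam * γ / 2) {x w y : E}
    (hq : 0 ≤ inner ℝ y x) (hcoc : ‖y‖ ^ 2 ≤ (2 * M - m) * inner ℝ y x) :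
    m * b / 3 * (lam * b * Real.exp δ * inner ℝ y x
        + a * Real.exp δ ^ 2 * (lam * inner ℝ y w + lam ^ 2 / 4 * ‖y‖ ^ 2))
      ≤ b * (δ / 5 + δ ^ 2) * inner ℝ y x + a * (δ / 5) * (‖y‖ * ‖w‖) := by
  have ha := h.a_pos
  have hb := h.b_pos
  have hlam := h.lam_pos
  have hκ : 0 < m * b / 3 * lam := mul_pos (div_pos (mul_pos h.m_pos hb) (by norm_num)) hlam
  have hδ0 : 0 < δ := by linarith [h.lam_mul_γ_pos]
  have hf2 : Real.exp δ ^ 2 ≤ 1 + 3 * δ := exp_sq_le hδ0.le (by linarith [h.lam_mul_γ_le])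
  have hf1 : Real.exp δ ≤ Real.exp δ ^ 2 := by nlinarith [Real.one_le_exp hδ0.le]
  have hrate2 : m * b / 3 * lam * Real.exp δ ^ 2 ≤ δ / 5 :=
    (mul_le_mul_of_nonneg_left hf2 hκ.le).trans (h.rate_mul_lam_le hδ)
  have hrate1 : m * b / 3 * lam * Real.exp δ ≤ δ / 5 :=
    (mul_le_mul_of_nonneg_left hf1 hκ.le).trans hrate2
  have hforce : b * inner ℝ y x * (m * b / 3 * lam * Real.exp δ) ≤ b * inner ℝ y x * (δ / 5) := by
    gcongr
  have hcross : a * (m * b / 3 * lam * Real.exp δ ^ 2 * inner ℝ y w)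
      ≤ a * (δ / 5 * (‖y‖ * ‖w‖)) := by
    have := mul_le_mul_of_abs_le (by positivity) hrate2 (abs_real_inner_le_norm y w)
    gcongr
  have hsq : lam / 4 * (m * b / 3 * lam * Real.exp δ ^ 2) * (a * ‖y‖ ^ 2)
      ≤ b * δ ^ 2 * inner ℝ y x :=
    calc lam / 4 * (m * b / 3 * lam * Real.exp δ ^ 2) * (a * ‖y‖ ^ 2)
        ≤ lam / 4 * (δ / 5) * (2 * inner ℝ y x) := by
          have := h.a_mul_sq_le hcoc
          gcongr
      _ = b * δ ^ 2 * inner ℝ y x / 5 := by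
          linear_combination δ * inner ℝ y x / 10 * h.lam_eq - b * δ / 5 * inner ℝ y x * hδ
      _ ≤ b * δ ^ 2 * inner ℝ y x := by
          linarith [mul_nonneg (mul_nonneg hb.le (sq_nonneg δ)) hq]
  linarith

theorem transport_le (h : ObaboParams a b γ m M lam) (hδ : δ = lam * γ / 2) (x w : E) :
    2 * (lam + b * Real.exp (-δ) - b * Real.exp δ) * inner ℝ x w
        + (lam ^ 2 + 2 * b * lam * Real.exp (-δ)
          + a * (Real.exp (-δ) ^ 2 - Real.exp δ ^ 2)) * ‖w‖ ^ 2
      ≤ lam * (δ ^ 2 * (‖x‖ * ‖w‖)) - lam * (a * γ * (3 / 2 - δ / 2) * ‖w‖ ^ 2) := by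
  have ha := h.a_pos
  have hb := h.b_pos
  have hlam := h.lam_pos
  have hδ0 : 0 < δ := by linarith [h.lam_mul_γ_pos]
  have hδ1 : δ ≤ 1 / 264 := by linarith [h.lam_mul_γ_le]
  have hlamδ : lam = 2 * δ * b := by linear_combination h.lam_eq - 2 * b * hδ
  have he1 : Real.exp (-δ) ≤ 1 := Real.exp_le_one_iff.2 (by linarith)
  have hsinh_eq : Real.exp δ - Real.exp (-δ) = 2 * Real.sinh δ := by rw [Real.sinh_eq]; ring
  have hsinh_ge : δ ≤ Real.sinh δ := Real.self_le_sinh_iff.2 hδ0.le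
  have hsinh_le : Real.sinh δ ≤ δ + δ ^ 3 / 2 := sinh_le_add_half_cube hδ0.le (by linarith)
  have hgap : 4 * δ ≤ Real.exp δ ^ 2 - Real.exp (-δ) ^ 2 := by
    have := Real.self_le_sinh_iff.2 (by linarith : 0 ≤ 2 * δ)
    rw [Real.sinh_eq] at this
    rw [sq, sq, ← Real.exp_add, ← Real.exp_add, ← two_mul, ← two_mul, mul_neg]
    linarith
  have hinner : 2 * (lam + b * Real.exp (-δ) - b * Real.exp δ) * inner ℝ x w
      ≤ lam * (δ ^ 2 * (‖x‖ * ‖w‖)) :=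
    calc 2 * (lam + b * Real.exp (-δ) - b * Real.exp δ) * inner ℝ x w
        = 4 * b * ((Real.sinh δ - δ) * -inner ℝ x w) := by
          rw [hlamδ]
          linear_combination -2 * b * inner ℝ x w * hsinh_eq
      _ ≤ 4 * b * (δ ^ 3 / 2 * (‖x‖ * ‖w‖)) := by
          have := mul_le_mul_of_abs_le (sub_nonneg.2 hsinh_ge) (sub_le_iff_le_add'.2 hsinh_le)
            (abs_neg (inner ℝ x w : ℝ) ▸ abs_real_inner_le_norm x w)
          gcongr
      _ = lam * (δ ^ 2 * (‖x‖ * ‖w‖)) := by rw [hlamδ]; ring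
  have hkin : lam ^ 2 + 2 * b * lam * Real.exp (-δ) + a * (Real.exp (-δ) ^ 2 - Real.exp δ ^ 2)
      ≤ -(lam * (a * γ * (3 / 2 - δ / 2))) := by
    have hfour : (1 + δ) / 2 * lam * (4 * b) ≤ (1 + δ) / 2 * lam * (a * γ) :=
      mul_le_mul_of_nonneg_left h.four_b_le (by positivity)
    have hone : 2 * b * lam * Real.exp (-δ) ≤ 2 * b * lam * 1 := by gcongr
    have hdiff := mul_le_mul_of_nonneg_left hgap ha.le
    have hsq : lam ^ 2 = 2 * δ * b * lam := by rw [sq]; nth_rewrite 1 [hlamδ]; rfl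
    have hγ : a * (4 * δ) = 2 * lam * (a * γ) := by rw [hδ]; ring
    linarith
  linarith [mul_le_mul_of_nonneg_right hkin (sq_nonneg ‖w‖)]

theorem twistedSq_obabo_le (h : ObaboParams a b γ m M lam) (hδ : δ = lam * γ / 2)
    {x w y₀ y₁ : E} (hmon : m * ‖x‖ ^ 2 ≤ inner ℝ y₀ x)
    (hcoc₀ : ‖y₀‖ ^ 2 ≤ (2 * M - m) * inner ℝ y₀ x)
    (hcoc₁ : ‖y₁‖ ^ 2 ≤ (2 * M - m) * inner ℝ y₁ (x + lam • w)) :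
    twistedSq a b (x + lam • w) (Real.exp (-δ) • (w - (lam / 2) • y₁))
      ≤ (1 - lam * (m * b / 3)) * twistedSq a b x (Real.exp δ • (w + (lam / 2) • y₀)) := by
  have hq : 0 ≤ inner ℝ y₀ x := (mul_nonneg h.m_pos.le (sq_nonneg _)).trans hmon
  have hcross := mul_le_mul_of_nonneg_left (h.cross_terms_le hδ (norm_nonneg x) (norm_nonneg w)
    (norm_nonneg y₀) hmon hcoc₀ hcoc₁) h.lam_pos.le
  have hfree := mul_le_mul_of_nonneg_left (h.mul_free_energy_le hδ (w := w) hmon) h.lam_pos.le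
  have hforce := mul_le_mul_of_nonneg_left (h.mul_force_energy_le hδ (w := w) hq hcoc₀)
    h.lam_pos.le
  have hafter := h.twistedSq_kick_le hδ hcoc₁
  have hbefore := h.le_twistedSq_exp_smul hδ (w := w) hmon
  have htransport := h.transport_le hδ x w
  have hexpand := twistedSq_smul_add_smul a b (Real.exp δ) (lam / 2) x w y₀
  rw [sub_mul, one_mul, mul_assoc lam, hexpand]
  rw [hexpand] at hbefore
  linarith

end Energy

end ObaboParams

section Shear

variable {d : ℕ} {a b : ℝ}

theorem Phase.ext {z z' : Phase d} (hfst : z.fst = z'.fst) (hsnd : z.snd = z'.snd) : z = z' :=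
  WithLp.ofLp_injective 2 (Prod.ext hfst hsnd)

theorem Phase.contDiff_toLp :
    ContDiff ℝ 1 fun p : Vec d × Vec d => (WithLp.toLp 2 p : Phase d) :=
  (WithLp.prodContinuousLinearEquiv 2 ℝ (Vec d) (Vec d)).symm.contDiff

theorem Phase.contDiff_fst : ContDiff ℝ 1 fun z : Phase d => z.fst :=
  (WithLp.prodContinuousLinearEquiv 2 ℝ (Vec d) (Vec d)).contDiff.fst

theorem Phase.contDiff_snd : ContDiff ℝ 1 fun z : Phase d => z.snd :=
  (WithLp.prodContinuousLinearEquiv 2 ℝ (Vec d) (Vec d)).contDiff.snd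

theorem shear_add (a b : ℝ) (z z' : Phase d) :
    shear a b (z + z') = shear a b z + shear a b z' := by
  refine Phase.ext ?_ ?_
  · simp only [shear, WithLp.toLp_fst, WithLp.add_fst, WithLp.add_snd]
    module
  · simp only [shear, WithLp.toLp_snd, WithLp.add_snd, smul_add]

theorem shear_sub (a b : ℝ) (z z' : Phase d) :
    shear a b (z - z') = shear a b z - shear a b z' := by
  rw [eq_sub_iff_add_eq, ← shear_add, sub_add_cancel]

theorem contDiff_shear (a b : ℝ) : ContDiff ℝ 1 (shear (d := d) a b) :=
  Phase.contDiff_toLp.comp ((Phase.contDiff_fst.add (Phase.contDiff_snd.const_smul b)).prodMk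
    (Phase.contDiff_snd.const_smul _))

theorem measurable_shear (a b : ℝ) : Measurable (shear (d := d) a b) :=
  (contDiff_shear a b).continuous.measurable

/-- The inverse of `shear a b`, for `b ^ 2 < a`. -/
noncomputable def unshear (a b : ℝ) (w : Phase d) : Phase d :=
  WithLp.toLp 2 (w.fst - (b / √(a - b ^ 2)) • w.snd, (1 / √(a - b ^ 2)) • w.snd)

theorem contDiff_unshear (a b : ℝ) : ContDiff ℝ 1 (unshear (d := d) a b) :=
  Phase.contDiff_toLp.comp ((Phase.contDiff_fst.sub (Phase.contDiff_snd.const_smul _)).prodMk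
    (Phase.contDiff_snd.const_smul _))

theorem shear_unshear (hab : b ^ 2 < a) (w : Phase d) : shear a b (unshear a b w) = w := by
  have hc : √(a - b ^ 2) ≠ 0 := (Real.sqrt_pos.2 (sub_pos.2 hab)).ne'
  refine Phase.ext ?_ ?_
  · simp only [shear, WithLp.toLp_fst, WithLp.toLp_snd, unshear, smul_smul, mul_one_div,
      sub_add_cancel]
  · simp only [shear, WithLp.toLp_snd, unshear, smul_smul, mul_one_div, div_self hc, one_smul]

theorem unshear_shear (hab : b ^ 2 < a) (z : Phase d) : unshear a b (shear a b z) = z := by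
  have hc : √(a - b ^ 2) ≠ 0 := (Real.sqrt_pos.2 (sub_pos.2 hab)).ne'
  refine Phase.ext ?_ ?_
  · simp only [shear, WithLp.toLp_fst, WithLp.toLp_snd, unshear, smul_smul,
      div_mul_cancel₀ _ hc, add_sub_cancel_right]
  · simp only [shear, WithLp.toLp_snd, unshear, smul_smul, one_div_mul_cancel hc, one_smul]

theorem norm_sq_shear (hab : b ^ 2 ≤ a) (z : Phase d) :
    ‖shear a b z‖ ^ 2 = twistedSq a b z.fst z.snd := by
  have hfst : (shear a b z).fst = z.fst + b • z.snd := rfl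
  have hsnd : (shear a b z).snd = √(a - b ^ 2) • z.snd := rfl
  rw [WithLp.prod_norm_sq_eq_of_L2, hfst, hsnd, norm_add_sq_real, norm_smul, norm_smul,
    inner_smul_right, mul_pow, mul_pow, Real.norm_eq_abs, Real.norm_eq_abs, sq_abs, sq_abs,
    Real.sq_sqrt (sub_nonneg.2 hab), twistedSq]
  ring

theorem norm_sq_shear_sub_shear (hab : b ^ 2 ≤ a) (z z' : Phase d) :
    ‖shear a b z - shear a b z'‖ ^ 2 = twistedSq a b (z.fst - z'.fst) (z.snd - z'.snd) := by
  rw [← shear_sub, norm_sq_shear hab]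
  rfl

theorem norm_sq_shear_le (ha₀ : 0 < a) (ha : a ≤ 1 / 2) (hab : 4 * b ^ 2 ≤ a) (z : Phase d) :
    ‖shear a b z‖ ^ 2 ≤ √(1 + a) * ‖z‖ ^ 2 := by
  have hq_sq : √(1 + a) ^ 2 = 1 + a := Real.sq_sqrt (by linarith)
  have hq_nonneg := Real.sqrt_nonneg (1 + a)
  rw [norm_sq_shear (by nlinarith only [hab, sq_nonneg b]), WithLp.prod_norm_sq_eq_of_L2,
    twistedSq]
  set q := √(1 + a)
  have hq_one : 1 < q := by nlinarith only [hq_sq, hq_nonneg, ha₀]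
  have hdisc : b ^ 2 ≤ (q - 1) * (q - a) := by
    nlinarith only [hq_sq, hq_nonneg, hq_one, ha, ha₀, hab]
  have hinner : b * inner ℝ z.fst z.snd ≤ |b| * (‖z.fst‖ * ‖z.snd‖) :=
    (le_abs_self _).trans <| by
      rw [abs_mul]
      exact mul_le_mul_of_nonneg_left (abs_real_inner_le_norm _ _) (abs_nonneg b)
  have hcross := mul_mul_le_of_sq_le (P := q - 1) (Q := q - a) (R := 2 * |b|) (by linarith)
    (by rw [mul_pow, sq_abs]; linarith) ‖z.fst‖ ‖z.snd‖
  linarith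

theorem lipschitzWith_shear (ha₀ : 0 < a) (ha : a ≤ 1 / 2) (hab : 4 * b ^ 2 ≤ a) :
    LipschitzWith (NNReal.sqrt (Real.toNNReal √(1 + a))) (shear (d := d) a b) := by
  refine LipschitzWith.of_dist_le_mul fun z z' => ?_
  rw [dist_eq_norm, dist_eq_norm, ← shear_sub, Real.coe_sqrt,
    Real.coe_toNNReal _ (Real.sqrt_nonneg _)]
  refine (Real.le_sqrt_of_sq_le (norm_sq_shear_le ha₀ ha hab (z - z'))).trans_eq ?_
  rw [Real.sqrt_mul (Real.sqrt_nonneg _), Real.sqrt_sq (norm_nonneg _)]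

end Shear

section TwistedSq

variable {E : Type*} [NormedAddCommGroup E] [InnerProductSpace ℝ E] {a b γ m M lam : ℝ}

theorem twistedSq_le (hab : 4 * b ^ 2 ≤ a) (x v : E) :
    twistedSq a b x v ≤ 2 * ‖x‖ ^ 2 + 5 / 4 * a * ‖v‖ ^ 2 := by
  have hsq := norm_sub_sq_real x (b • v)
  rw [inner_smul_right, norm_smul, mul_pow, Real.norm_eq_abs, sq_abs] at hsq
  rw [twistedSq]
  nlinarith only [hsq, sq_nonneg ‖x - b • v‖, mul_le_mul_of_nonneg_right hab (sq_nonneg ‖v‖)]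

theorem ObaboParams.twistedSq_le_norm_sq (h : ObaboParams a b γ m M lam) {x v w : E}
    (hx : ‖x‖ ≤ lam * ‖w‖) (hv : ‖v‖ ≤ 101 / 100 * ‖w‖) : twistedSq a b x v ≤ ‖w‖ ^ 2 := by
  have hlam : lam ^ 2 ≤ 1 / 200 := by
    nlinarith only [h.lam_sq_mul_le, h.two_le, sq_nonneg lam]
  have hx_sq : ‖x‖ ^ 2 ≤ 1 / 200 * ‖w‖ ^ 2 :=
    (pow_le_pow_left₀ (norm_nonneg x) hx 2).trans <| by
      rw [mul_pow]
      exact mul_le_mul_of_nonneg_right hlam (sq_nonneg _)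
  have hv_sq := pow_le_pow_left₀ (norm_nonneg v) hv 2
  have hav := mul_le_mul h.a_le_half hv_sq (sq_nonneg _) (by norm_num)
  linarith only [twistedSq_le h.four_b_sq_le x v, hx_sq, hav, sq_nonneg ‖w‖]

end TwistedSq

section Step

variable {d : ℕ} {a b γ m M lam : ℝ} {k : Vec d → Vec d}

/-- The velocity of the OBABO scheme after the first `O` and `B` half-steps, which transports the
position from `x₀` to `x₁`. -/
noncomputable def halfVelocity (k : Vec d → Vec d) (lam γ : ℝ) (z : Phase d) (g : Vec d) : Vec d :=
  Real.exp (-(lam * γ / 2)) • z.snd + √(1 - Real.exp (-(lam * γ / 2)) ^ 2) • g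
    - (lam / 2) • k z.fst

theorem obaboStep_fst (z : Phase d) (g g' : Vec d) :
    (obaboStep k lam γ z g g').fst = z.fst + lam • halfVelocity k lam γ z g :=
  rfl

theorem obaboStep_snd (z : Phase d) (g g' : Vec d) :
    (obaboStep k lam γ z g g').snd =
      Real.exp (-(lam * γ / 2)) • (halfVelocity k lam γ z g
        - (lam / 2) • k (z.fst + lam • halfVelocity k lam γ z g))
      + √(1 - Real.exp (-(lam * γ / 2)) ^ 2) • g' :=
  rfl

theorem obaboStep_eq_add (z : Phase d) (g g' : Vec d) :
    obaboStep k lam γ z g g' = obaboStep k lam γ z g 0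
      + WithLp.toLp 2 (0, √(1 - Real.exp (-(lam * γ / 2)) ^ 2) • g') := by
  refine Phase.ext (add_zero _).symm ?_
  rw [WithLp.add_snd, obaboStep_snd, obaboStep_snd, smul_zero, add_zero, WithLp.toLp_snd]

theorem contDiff_obaboStep (hk : ContDiff ℝ 1 k) (g' : Vec d) :
    ContDiff ℝ 1 fun p : Phase d × Vec d => obaboStep k lam γ p.1 p.2 g' := by
  have hfst : ContDiff ℝ 1 fun p : Phase d × Vec d => p.1.fst :=
    Phase.contDiff_fst.comp contDiff_fst
  have hsnd : ContDiff ℝ 1 fun p : Phase d × Vec d => p.1.snd :=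
    Phase.contDiff_snd.comp contDiff_fst
  unfold obaboStep
  refine Phase.contDiff_toLp.comp ?_
  fun_prop

theorem norm_sq_shear_obaboStep_sub_le (hp : ObaboParams a b γ m M lam)
    (hk : StronglyMonotoneCocoercive m (2 * M - m) k) (z z' : Phase d) (g g' : Vec d) :
    ‖shear a b (obaboStep k lam γ z g g') - shear a b (obaboStep k lam γ z' g g')‖ ^ 2
      ≤ (1 - lam * (m * b / 3)) * ‖shear a b z - shear a b z'‖ ^ 2 := by
  rw [norm_sq_shear_sub_shear hp.b_sq_lt.le, norm_sq_shear_sub_shear hp.b_sq_lt.le,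
    obaboStep_fst, obaboStep_fst, obaboStep_snd, obaboStep_snd, add_sub_add_right_eq_sub]
  set w := halfVelocity k lam γ z g with hw
  set w' := halfVelocity k lam γ z' g with hw'
  have hx : z.fst + lam • w - (z'.fst + lam • w') = z.fst - z'.fst + lam • (w - w') := by module
  have hv : z.snd - z'.snd = Real.exp (lam * γ / 2) •
      (w - w' + (lam / 2) • (k z.fst - k z'.fst)) := by
    have hww : w - w' + (lam / 2) • (k z.fst - k z'.fst)
        = Real.exp (-(lam * γ / 2)) • (z.snd - z'.snd) := by
      rw [hw, hw', halfVelocity, halfVelocity]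
      module
    rw [hww, smul_smul, ← Real.exp_add, add_neg_cancel, Real.exp_zero, one_smul]
  have hcoc₁ := hk.norm_sq_le (z.fst + lam • w) (z'.fst + lam • w')
  rw [hx] at hcoc₁
  rw [hv]
  convert hp.twistedSq_obabo_le rfl (hk.mul_norm_sq_le _ _) (hk.norm_sq_le _ _) hcoc₁ using 2
  module

theorem norm_shear_obaboStep_sub_le (hp : ObaboParams a b γ m M lam)
    (hk : StronglyMonotoneCocoercive m (2 * M - m) k) (z : Phase d) (g₁ g₂ g' : Vec d) :
    ‖shear a b (obaboStep k lam γ z g₁ g') - shear a b (obaboStep k lam γ z g₂ g')‖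
      ≤ √(1 - Real.exp (-(lam * γ / 2)) ^ 2) * ‖g₁ - g₂‖ := by
  rw [← Real.norm_of_nonneg (Real.sqrt_nonneg (1 - _)), ← norm_smul]
  refine abs_le_of_sq_le_sq' ?_ (norm_nonneg _) |>.2
  rw [norm_sq_shear_sub_shear hp.b_sq_lt.le, obaboStep_fst, obaboStep_fst, obaboStep_snd,
    obaboStep_snd, add_sub_add_right_eq_sub, ← smul_sub]
  have hww : √(1 - Real.exp (-(lam * γ / 2)) ^ 2) • (g₁ - g₂)
      = halfVelocity k lam γ z g₁ - halfVelocity k lam γ z g₂ := by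
    rw [halfVelocity, halfVelocity]
    module
  rw [hww]
  set w₁ := halfVelocity k lam γ z g₁
  set w₂ := halfVelocity k lam γ z g₂
  have hx : z.fst + lam • w₁ - (z.fst + lam • w₂) = lam • (w₁ - w₂) := by module
  have hforce : ‖k (z.fst + lam • w₁) - k (z.fst + lam • w₂)‖ ≤ 2 * M * (lam * ‖w₁ - w₂‖) := by
    have hlip := hk.norm_sub_le (by linarith [hp.m_le, hp.M_pos])
      (z.fst + lam • w₁) (z.fst + lam • w₂)
    rw [hx, norm_smul, Real.norm_of_nonneg hp.lam_pos.le] at hlip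
    have := hp.lam_pos
    exact hlip.trans (mul_le_mul_of_nonneg_right (by linarith [hp.m_pos]) (by positivity))
  refine hp.twistedSq_le_norm_sq (by rw [hx, norm_smul, Real.norm_of_nonneg hp.lam_pos.le]) ?_
  rw [sub_sub_sub_comm, ← smul_sub, norm_smul, Real.norm_of_nonneg (Real.exp_pos _).le]
  have hη : Real.exp (-(lam * γ / 2)) ≤ 1 := Real.exp_le_one_iff.2 (by linarith [hp.lam_mul_γ_pos])
  refine (mul_le_of_le_one_left (norm_nonneg _) hη).trans ((norm_sub_le _ _).trans ?_)
  rw [norm_smul, Real.norm_of_nonneg (half_pos hp.lam_pos).le]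
  have := mul_le_mul_of_nonneg_left hforce (half_pos hp.lam_pos).le
  have := mul_le_mul_of_nonneg_right hp.lam_sq_mul_le (norm_nonneg (w₁ - w₂))
  linarith

theorem norm_shear_toLp_sub_le (hp : ObaboParams a b γ m M lam) {s : ℝ} (hs : 0 ≤ s)
    (g₁ g₂ : Vec d) :
    ‖shear a b (WithLp.toLp 2 (0, s • g₁)) - shear a b (WithLp.toLp 2 (0, s • g₂))‖
      ≤ s * ‖g₁ - g₂‖ := by
  rw [← Real.norm_of_nonneg hs, ← norm_smul, smul_sub]
  refine abs_le_of_sq_le_sq' ?_ (norm_nonneg _) |>.2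
  rw [norm_sq_shear_sub_shear hp.b_sq_lt.le, Real.norm_of_nonneg hs]
  refine hp.twistedSq_le_norm_sq ?_ ?_
  · simp only [WithLp.toLp_fst, sub_self, norm_zero]
    exact mul_nonneg hp.lam_pos.le (norm_nonneg _)
  · exact le_mul_of_one_le_left (norm_nonneg _) (by norm_num)

end Step

theorem indepFun_prodMk_left {Ω α β γ : Type*} [MeasurableSpace Ω] [MeasurableSpace α]
    [MeasurableSpace β] [MeasurableSpace γ] {P : Measure Ω} [IsProbabilityMeasure P] {X : Ω → α}
    {Y : Ω → β} {Z : Ω → γ} (hX : Measurable X) (hY : Measurable Y) (hZ : Measurable Z)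
    (hXYZ : IndepFun X (fun ω => (Y ω, Z ω)) P) (hYZ : IndepFun Y Z P) :
    IndepFun (fun ω => (X ω, Y ω)) Z P := by
  have hXY : IndepFun X Y P := hXYZ.comp measurable_id measurable_fst
  have := Measure.isProbabilityMeasure_map (μ := P) hX.aemeasurable
  have := Measure.isProbabilityMeasure_map (μ := P) hY.aemeasurable
  have := Measure.isProbabilityMeasure_map (μ := P) hZ.aemeasurable
  rw [indepFun_iff_map_prod_eq_prod_map_map (by fun_prop) (by fun_prop)] at hXYZ hYZ hXY ⊢
  have hassoc : (fun ω => ((X ω, Y ω), Z ω))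
      = MeasurableEquiv.prodAssoc.symm ∘ fun ω => (X ω, (Y ω, Z ω)) := rfl
  rw [hassoc, ← Measure.map_map (MeasurableEquiv.measurable _) (by fun_prop), hXYZ, hYZ, hXY,
    ← Measure.prodAssoc_prod]
  exact MeasurableEquiv.map_symm_map _

theorem indepFun_prodMk_finset {Ω ι α β : Type*} [MeasurableSpace Ω] [MeasurableSpace α]
    [MeasurableSpace β] {P : Measure Ω} [IsProbabilityMeasure P] {Z : Ω → α} {X : ι → Ω → β}
    (hZ : Measurable Z) (hX : ∀ i, Measurable (X i)) (hindep : iIndepFun X P)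
    (hindepZ : IndepFun Z (fun ω i => X i ω) P) {S T : Finset ι} (hST : Disjoint S T) :
    IndepFun (fun ω => (Z ω, fun i : S => X i ω)) (fun ω (i : T) => X i ω) P := by
  have hrestrict : Measurable fun x : ι → β => (fun i : S => x i, fun i : T => x i) := by fun_prop
  exact indepFun_prodMk_left hZ (by fun_prop) (by fun_prop) (hindepZ.comp measurable_id hrestrict)
    (hindep.indepFun_finset S T hST hX)

section Chain

variable {d : ℕ} {b : Vec d → Vec d}

theorem measurable_obaboStep (hb : Measurable b) (lam gam : ℝ) :
    Measurable fun p : Phase d × (Vec d × Vec d) => obaboStep b lam gam p.1 p.2.1 p.2.2 := by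
  have hfst : Measurable fun p : Phase d × (Vec d × Vec d) => p.1.fst :=
    Phase.contDiff_fst.continuous.measurable.comp measurable_fst
  have hsnd : Measurable fun p : Phase d × (Vec d × Vec d) => p.1.snd :=
    Phase.contDiff_snd.continuous.measurable.comp measurable_fst
  unfold obaboStep
  refine Phase.contDiff_toLp.continuous.measurable.comp ?_
  fun_prop

/-- The indices of the Gaussian inputs used in the first `n` steps of the chain: `Sum.inl` labels
the `G`s and `Sum.inr` the `G'`s. -/
def pastIndices (n : ℕ) : Finset (ℕ ⊕ ℕ) := (Finset.range n).disjSum (Finset.range n)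

theorem pastIndices_mono : Monotone pastIndices := fun _ _ hmn =>
  Finset.disjSum_mono (Finset.range_mono hmn) (Finset.range_mono hmn)

theorem inl_mem_pastIndices {i n : ℕ} : Sum.inl i ∈ pastIndices n ↔ i < n := by
  rw [pastIndices, Finset.inl_mem_disjSum, Finset.mem_range]

theorem inr_mem_pastIndices {i n : ℕ} : Sum.inr i ∈ pastIndices n ↔ i < n := by
  rw [pastIndices, Finset.inr_mem_disjSum, Finset.mem_range]

theorem exists_measurable_obaboChain_eq {Ω : Type*} (hb : Measurable b) (lam gam : ℝ)
    (z₀ : Ω → Phase d) (G G' : ℕ → Ω → Vec d) (n : ℕ) :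
    ∃ Φ : Phase d × (pastIndices n → Vec d) → Phase d, Measurable Φ ∧
      ∀ ω, obaboChain b lam gam z₀ G G' n ω = Φ (z₀ ω, fun i => Sum.elim G G' (i : ℕ ⊕ ℕ) ω) := by
  induction n with
  | zero => exact ⟨Prod.fst, measurable_fst, fun ω => rfl⟩
  | succ n ih =>
    obtain ⟨Φ, hΦ, hchain⟩ := ih
    refine ⟨fun p => obaboStep b lam gam (Φ (p.1, fun i => p.2 ⟨i, pastIndices_mono n.le_succ i.2⟩))
      (p.2 ⟨Sum.inl n, inl_mem_pastIndices.2 n.lt_succ_self⟩)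
      (p.2 ⟨Sum.inr n, inr_mem_pastIndices.2 n.lt_succ_self⟩), ?_, fun ω => ?_⟩
    · exact (measurable_obaboStep hb lam gam).comp
        ((hΦ.comp (by fun_prop)).prodMk (Measurable.prodMk (by fun_prop) (by fun_prop)))
    · simp only [obaboChain, hchain, Sum.elim_inl, Sum.elim_inr]

variable {Ω : Type*} [MeasurableSpace Ω] {P : Measure Ω} {z₀ : Ω → Phase d} {G G' : ℕ → Ω → Vec d}

theorem measurable_obaboChain (hb : Measurable b) (lam gam : ℝ) (hz₀ : Measurable z₀)
    (hG : ∀ i, Measurable (G i)) (hG' : ∀ i, Measurable (G' i)) (n : ℕ) :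
    Measurable (obaboChain b lam gam z₀ G G' n) := by
  induction n with
  | zero => exact hz₀
  | succ n ih => exact (measurable_obaboStep hb lam gam).comp (ih.prodMk ((hG n).prodMk (hG' n)))

theorem indepFun_obaboChain [IsProbabilityMeasure P] (hb : Measurable b) (lam gam : ℝ)
    (hz₀ : Measurable z₀) (hG : ∀ i, Measurable (G i)) (hG' : ∀ i, Measurable (G' i))
    (hindep : iIndepFun (fun i : ℕ ⊕ ℕ => Sum.elim G G' i) P)
    (hindep₀ : IndepFun z₀ (fun ω (i : ℕ ⊕ ℕ) => Sum.elim G G' i ω) P) (n : ℕ) :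
    IndepFun (obaboChain b lam gam z₀ G G' n) (fun ω => (G n ω, G' n ω)) P := by
  obtain ⟨Φ, hΦ, hchain⟩ := exists_measurable_obaboChain_eq hb lam gam z₀ G G' n
  have hdisj : Disjoint (pastIndices n) {Sum.inl n, Sum.inr n} := by
    simp only [Finset.disjoint_right, Finset.mem_insert, Finset.mem_singleton, forall_eq_or_imp,
      forall_eq, inl_mem_pastIndices, inr_mem_pastIndices, lt_irrefl, not_false_eq_true, and_self]
  have hpair : Measurable fun x : ({Sum.inl n, Sum.inr n} : Finset (ℕ ⊕ ℕ)) → Vec d =>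
      (x ⟨Sum.inl n, by simp⟩, x ⟨Sum.inr n, by simp⟩) := by fun_prop
  rw [funext hchain]
  exact (indepFun_prodMk_finset hz₀ (Sum.rec hG hG') hindep hindep₀ hdisj).comp hΦ hpair

end Chain

/-! ### Propagation of the logarithmic Sobolev inequality -/

theorem SatisfiesLSI.map_of_indepFun {Ω E W E' : Type*} [MeasurableSpace Ω] {P : Measure Ω}
    [IsProbabilityMeasure P] [NormedAddCommGroup E] [NormedSpace ℝ E] [MeasurableSpace E]
    [BorelSpace E] [NormedAddCommGroup W] [NormedSpace ℝ W] [MeasurableSpace W] [BorelSpace W]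
    [SecondCountableTopologyEither E W] [NormedAddCommGroup E'] [NormedSpace ℝ E']
    [MeasurableSpace E'] [BorelSpace E'] {X : Ω → E} {Y : Ω → W} (hX : Measurable X)
    (hY : Measurable Y) (hXY : IndepFun X Y P) {C C' : ℝ} (hμ : SatisfiesLSI (P.map X) C)
    (hν : SatisfiesLSI (P.map Y) C') (hC : 0 ≤ C) (hC' : 0 ≤ C') {T : E × W → E'}
    (hT : ContDiff ℝ 1 T) {r s : ℝ≥0} (hr : ∀ y, LipschitzWith r fun x => T (x, y))
    (hs : ∀ x, LipschitzWith s fun y => T (x, y)) :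
    SatisfiesLSI (P.map fun ω => T (X ω, Y ω)) (r ^ 2 * C + s ^ 2 * C') := by
  have := Measure.isProbabilityMeasure_map (μ := P) hX.aemeasurable
  have := Measure.isProbabilityMeasure_map (μ := P) hY.aemeasurable
  have hlaw : P.map (fun ω => T (X ω, Y ω)) = ((P.map X).prod (P.map Y)).map T := by
    rw [← (indepFun_iff_map_prod_eq_prod_map_map hX.aemeasurable hY.aemeasurable).1 hXY,
      Measure.map_map hT.continuous.measurable (by fun_prop), Function.comp_def]
  exact hlaw ▸ hμ.map_prod hν hC hC' hT hr hs

theorem StronglyMonotoneCocoercive.le {V : Type*} [NormedAddCommGroup V] [InnerProductSpace ℝ V]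
    [Nontrivial V] {m c : ℝ} {k : V → V} (hk : StronglyMonotoneCocoercive m c k) (hm : 0 < m) :
    m ≤ c := by
  obtain ⟨x, hx⟩ := exists_ne (0 : V)
  have hmono := hk.mul_norm_sq_le x 0
  have hcoco := hk.norm_sq_le x 0
  rw [sub_zero] at hmono hcoco
  have hx_pos : 0 < ‖x‖ ^ 2 := pow_pos (norm_pos_iff.2 hx) 2
  have hinner : 0 < inner ℝ (k x - k 0) x := (mul_pos hm hx_pos).trans_le hmono
  have hcs : inner ℝ (k x - k 0) x ^ 2 ≤ ‖k x - k 0‖ ^ 2 * ‖x‖ ^ 2 := by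
    rw [← mul_pow]
    exact pow_le_pow_left₀ hinner.le (real_inner_le_norm _ _) 2
  have hle : inner ℝ (k x - k 0) x ≤ c * ‖x‖ ^ 2 := by
    refine le_of_mul_le_mul_left ?_ hinner
    calc inner ℝ (k x - k 0) x * inner ℝ (k x - k 0) x
        ≤ ‖k x - k 0‖ ^ 2 * ‖x‖ ^ 2 := by rwa [← sq]
      _ ≤ c * inner ℝ (k x - k 0) x * ‖x‖ ^ 2 := by gcongr
      _ = inner ℝ (k x - k 0) x * (c * ‖x‖ ^ 2) := by ring
  exact le_of_mul_le_mul_right (hmono.trans hle) hx_pos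

theorem locallyLipschitz_of_norm_sub_le_mul {E F : Type*} [SeminormedAddCommGroup E]
    [SeminormedAddCommGroup F] {f : E → F} {c : E × E → ℝ} (hc : Continuous c)
    (hf : ∀ x y, ‖f x - f y‖ ≤ c (x, y) * ‖x - y‖) : LocallyLipschitz f := by
  intro x
  obtain ⟨U, hU, V, hV, hUV⟩ := mem_nhds_prod_iff.1
    (hc.continuousAt.eventually_le_const (lt_add_one (c (x, x))))
  refine ⟨(c (x, x) + 1).toNNReal, U ∩ V, inter_mem hU hV,
    .of_dist_le_mul fun y hy z hz => ?_⟩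
  rw [dist_eq_norm, dist_eq_norm]
  exact (hf y z).trans (by gcongr; exact (hUV ⟨hy.1, hz.2⟩).trans (Real.le_coe_toNNReal _))

theorem locallyLipschitz_of_norm_sub_le_rpow {E F : Type*} [SeminormedAddCommGroup E]
    [SeminormedAddCommGroup F] {f : E → F} {L l : ℝ}
    (hf : ∀ x y, ‖f x - f y‖ ≤ L * (1 + ‖x‖ + ‖y‖) ^ l * ‖x - y‖) : LocallyLipschitz f :=
  locallyLipschitz_of_norm_sub_le_mul (c := fun p => L * (1 + ‖p.1‖ + ‖p.2‖) ^ l)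
    (continuous_const.mul (Continuous.rpow_const (by fun_prop) fun _ => .inl (by positivity))) hf

theorem sq_sqrt_one_sub_exp_neg_sq {x : ℝ} (hx : 0 ≤ x) :
    √(1 - Real.exp (-x) ^ 2) ^ 2 = 1 - Real.exp (-x) ^ 2 :=
  Real.sq_sqrt <| sub_nonneg.2 <|
    pow_le_one₀ (Real.exp_pos _).le (Real.exp_le_one_iff.2 (neg_nonpos.2 hx))

theorem four_mul_one_sub_exp_neg_sq_le {x : ℝ} (hx : 0 ≤ x) :
    4 * (1 - Real.exp (-(x / 2)) ^ 2) ≤ 8 * √(1 - Real.exp (-(2 * x))) := by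
  have hhalf : Real.exp (-(x / 2)) ^ 2 = Real.exp (-x) := by
    rw [← Real.exp_nat_mul]
    ring_nf
  have hmono : Real.exp (-(2 * x)) ≤ Real.exp (-x) := Real.exp_le_exp.2 (by linarith)
  have hle_sqrt : 1 - Real.exp (-(2 * x)) ≤ √(1 - Real.exp (-(2 * x))) :=
    Real.le_sqrt_of_sq_le (pow_le_of_le_one
      (sub_nonneg.2 (Real.exp_le_one_iff.2 (by linarith)))
      (sub_le_self _ (Real.exp_pos _).le) two_ne_zero)
  rw [hhalf]
  linarith [Real.sqrt_nonneg (1 - Real.exp (-(2 * x)))]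

namespace ObaboParams

variable {a b γ m M lam : ℝ}

theorem of_step_le (hm : 0 < m) (hmM : m ≤ M) (hM : 2 ≤ M) (hγ : 2 * √M ≤ γ) (hlam : 0 < lam)
    (hstep : lam ≤ m / (33 * γ ^ 3)) : ObaboParams (1 / M) (1 / γ) γ m M lam := by
  have hM_pos : 0 < M := by linarith
  have hγ_pos : 0 < γ := by linarith [Real.sqrt_pos.2 hM_pos]
  have hγ_sq : 4 * M ≤ γ ^ 2 := by nlinarith [Real.sq_sqrt hM_pos.le, Real.sqrt_nonneg M]
  refine ⟨hm, hmM, hM, one_div_mul_cancel hM_pos.ne', one_div_mul_cancel hγ_pos.ne', hγ_pos, ?_,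
    hlam, ?_⟩
  · rw [mul_one_div, one_div_mul_eq_div, div_le_div_iff₀ hγ_pos hM_pos]
    linarith
  · rw [le_div_iff₀ (by positivity)] at hstep
    rw [one_div, inv_pow, ← div_eq_mul_inv, le_div_iff₀ (by positivity)]
    linarith

theorem rate_pos (hp : ObaboParams a b γ m M lam) : 0 < lam * (m * b / 3) :=
  mul_pos hp.lam_pos (div_pos (mul_pos hp.m_pos hp.b_pos) three_pos)

theorem rate_lt_one (hp : ObaboParams a b γ m M lam) : lam * (m * b / 3) < 1 := by
  have hMb : M * b ^ 2 < 1 := by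
    rw [← hp.a_mul, mul_comm a]
    exact mul_lt_mul_of_pos_left hp.b_sq_lt hp.M_pos
  have hmb : m * b ^ 2 ≤ 1 :=
    (mul_le_mul_of_nonneg_right hp.m_le (sq_nonneg b)).trans hMb.le
  calc lam * (m * b / 3) = lam * γ * (m * b ^ 2) / 3 := by
        linear_combination (-(lam * m * b / 3)) * hp.b_mul
    _ ≤ lam * γ * 1 / 3 := by
        have := hp.lam_mul_γ_pos
        gcongr
    _ < 1 := by linarith [hp.lam_mul_γ_le]

end ObaboParams

section ObaboStep

variable {d : ℕ} {a b γ m M lam : ℝ} {k : Vec d → Vec d}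

theorem lipschitzWith_shear_obaboStep_unshear (hp : ObaboParams a b γ m M lam)
    (hk : StronglyMonotoneCocoercive m (2 * M - m) k) {r : ℝ≥0}
    (hr : (r : ℝ) ^ 2 = 1 - lam * (m * b / 3)) (g g' : Vec d) :
    LipschitzWith r fun w => shear a b (obaboStep k lam γ (unshear a b w) g g') := by
  refine .of_dist_le_mul fun w w' => ?_
  rw [dist_eq_norm, dist_eq_norm]
  refine (abs_le_of_sq_le_sq' ?_ (by positivity)).2
  have h := norm_sq_shear_obaboStep_sub_le hp hk (unshear a b w) (unshear a b w') g g'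
  rwa [shear_unshear hp.b_sq_lt, shear_unshear hp.b_sq_lt, ← hr, ← mul_pow] at h

variable {Ω : Type*} [MeasurableSpace Ω] {P : Measure Ω} [IsProbabilityMeasure P] {C : ℝ}

theorem SatisfiesLSI.shear_obaboStep_zero (hp : ObaboParams a b γ m M lam) (hk : ContDiff ℝ 1 k)
    (hmc : StronglyMonotoneCocoercive m (2 * M - m) k) {Z : Ω → Phase d} {G : Ω → Vec d}
    (hZ : Measurable Z) (hG : Measurable G) (hGlaw : P.map G = stdGaussian (Vec d))
    (hZG : IndepFun Z G P) (hC : 0 ≤ C) (hLSI : SatisfiesLSI (P.map fun ω => shear a b (Z ω)) C) :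
    SatisfiesLSI (P.map fun ω => shear a b (obaboStep k lam γ (Z ω) (G ω) 0))
      ((1 - lam * (m * b / 3)) * C + 2 * (1 - Real.exp (-(lam * γ / 2)) ^ 2)) := by
  let r : ℝ≥0 := ⟨√(1 - lam * (m * b / 3)), Real.sqrt_nonneg _⟩
  have hr : (r : ℝ) ^ 2 = 1 - lam * (m * b / 3) := Real.sq_sqrt (sub_nonneg.2 hp.rate_lt_one.le)
  let s : ℝ≥0 := ⟨√(1 - Real.exp (-(lam * γ / 2)) ^ 2), Real.sqrt_nonneg _⟩
  have hs : (s : ℝ) ^ 2 = 1 - Real.exp (-(lam * γ / 2)) ^ 2 :=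
    sq_sqrt_one_sub_exp_neg_sq (half_pos hp.lam_mul_γ_pos).le
  have hT : ContDiff ℝ 1 fun p : Phase d × Vec d =>
      shear a b (obaboStep k lam γ (unshear a b p.1) p.2 0) :=
    (contDiff_shear a b).comp ((contDiff_obaboStep hk 0).comp
      (((contDiff_unshear a b).comp contDiff_fst).prodMk contDiff_snd))
  have hstep := hLSI.map_of_indepFun ((measurable_shear a b).comp hZ) hG
    (hZG.comp (measurable_shear a b) measurable_id) (hGlaw ▸ satisfiesLSI_stdGaussian) hC
    zero_le_two hT (fun g => lipschitzWith_shear_obaboStep_unshear hp hmc hr g 0) (s := s)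
    fun w => .of_dist_le_mul fun g₁ g₂ => by
      rw [dist_eq_norm, dist_eq_norm]
      exact norm_shear_obaboStep_sub_le hp hmc _ g₁ g₂ 0
  rw [hr, hs, mul_comm _ (2 : ℝ)] at hstep
  simpa only [Function.comp_apply, unshear_shear hp.b_sq_lt] using hstep

theorem SatisfiesLSI.add_shear_noise (hp : ObaboParams a b γ m M lam) {X : Ω → Phase d}
    {G : Ω → Vec d} (hX : Measurable X) (hG : Measurable G)
    (hGlaw : P.map G = stdGaussian (Vec d)) (hXG : IndepFun X G P) (hC : 0 ≤ C)
    (hLSI : SatisfiesLSI (P.map X) C) (s : ℝ≥0) :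
    SatisfiesLSI (P.map fun ω => X ω + shear a b (WithLp.toLp 2 (0, (s : ℝ) • G ω)))
      (C + s ^ 2 * 2) := by
  have hT : ContDiff ℝ 1 fun p : Phase d × Vec d =>
      p.1 + shear a b (WithLp.toLp 2 (0, (s : ℝ) • p.2)) :=
    contDiff_fst.add ((contDiff_shear a b).comp (Phase.contDiff_toLp.comp
      (contDiff_const.prodMk (contDiff_snd.const_smul (s : ℝ)))))
  have h := hLSI.map_of_indepFun hX hG hXG (hGlaw ▸ satisfiesLSI_stdGaussian) hC zero_le_two hT
    (r := 1) (s := s) (fun g => .of_dist_le_mul fun w w' => by simp)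
    fun w => .of_dist_le_mul fun g₁ g₂ => by
      rw [dist_add_left, dist_eq_norm, dist_eq_norm]
      exact norm_shear_toLp_sub_le hp s.coe_nonneg g₁ g₂
  rwa [NNReal.coe_one, one_pow, one_mul] at h

theorem SatisfiesLSI.shear_obaboStep (hp : ObaboParams a b γ m M lam) (hk : ContDiff ℝ 1 k)
    (hmc : StronglyMonotoneCocoercive m (2 * M - m) k) {Z : Ω → Phase d} {G G' : Ω → Vec d}
    (hZ : Measurable Z) (hG : Measurable G) (hG' : Measurable G')
    (hGlaw : P.map G = stdGaussian (Vec d)) (hGlaw' : P.map G' = stdGaussian (Vec d))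
    (hGG' : IndepFun G G' P) (hZGG' : IndepFun Z (fun ω => (G ω, G' ω)) P) (hC : 0 ≤ C)
    (hLSI : SatisfiesLSI (P.map fun ω => shear a b (Z ω)) C) :
    SatisfiesLSI (P.map fun ω => shear a b (obaboStep k lam γ (Z ω) (G ω) (G' ω)))
      ((1 - lam * (m * b / 3)) * C + 4 * (1 - Real.exp (-(lam * γ / 2)) ^ 2)) := by
  have hstep : Measurable fun p : Phase d × Vec d => shear a b (obaboStep k lam γ p.1 p.2 0) :=
    ((contDiff_shear a b).comp (contDiff_obaboStep hk 0)).continuous.measurable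
  have hindep : IndepFun (fun ω => shear a b (obaboStep k lam γ (Z ω) (G ω) 0)) G' P :=
    (indepFun_prodMk_left hZ hG hG' hZGG' hGG').comp hstep measurable_id
  let s : ℝ≥0 := ⟨√(1 - Real.exp (-(lam * γ / 2)) ^ 2), Real.sqrt_nonneg _⟩
  have hs : (s : ℝ) ^ 2 = 1 - Real.exp (-(lam * γ / 2)) ^ 2 :=
    sq_sqrt_one_sub_exp_neg_sq (half_pos hp.lam_mul_γ_pos).le
  have hC_half : 0 ≤ (1 - lam * (m * b / 3)) * C + 2 * (1 - Real.exp (-(lam * γ / 2)) ^ 2) := by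
    have := mul_nonneg (sub_nonneg.2 hp.rate_lt_one.le) hC
    rw [← hs]
    positivity
  have h := (hLSI.shear_obaboStep_zero hp hk hmc hZ hG hGlaw
    (hZGG'.comp measurable_id measurable_fst) hC).add_shear_noise hp
      (hstep.comp (hZ.prodMk hG)) hG' hGlaw' hindep hC_half s
  simp only [obaboStep_eq_add _ _ (G' _), shear_add]
  exact h.mono (by linarith)

end ObaboStep

theorem tendsto_obaboChain {d : ℕ} {Ω : Type*} {T : Vec d → Vec d} (hT : Continuous T)
    {k : ℕ → Vec d → Vec d} (hk : TendstoUniformly k T atTop) (lam γ : ℝ) (z₀ : Ω → Phase d)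
    (G G' : ℕ → Ω → Vec d) (n : ℕ) (ω : Ω) :
    Tendsto (fun j => obaboChain (k j) lam γ z₀ G G' n ω) atTop
      (𝓝 (obaboChain T lam γ z₀ G G' n ω)) := by
  have hdrift {x : ℕ → Vec d} {y : Vec d} (hx : Tendsto x atTop (𝓝 y)) :
      Tendsto (fun j => k j (x j)) atTop (𝓝 (T y)) := hk.tendsto_comp hT.continuousAt hx
  induction n with
  | zero => exact tendsto_const_nhds
  | succ n ih =>
    have hfst := (Phase.contDiff_fst.continuous.tendsto _).comp ih
    have hsnd := (Phase.contDiff_snd.continuous.tendsto _).comp ih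
    have hhalf := ((hsnd.const_smul (Real.exp (-(lam * γ / 2)))).add_const
      (√(1 - Real.exp (-(lam * γ / 2)) ^ 2) • G n ω)).sub ((hdrift hfst).const_smul (lam / 2))
    have hpos := hfst.add (hhalf.const_smul lam)
    have hvel := ((hhalf.sub ((hdrift hpos).const_smul (lam / 2))).const_smul
      (Real.exp (-(lam * γ / 2)))).add_const (√(1 - Real.exp (-(lam * γ / 2)) ^ 2) • G' n ω)
    exact (Phase.contDiff_toLp.continuous.tendsto _).comp (hpos.prodMk_nhds hvel)

section ObaboChain

variable {d : ℕ} {a b γ m M lam C₀ C₁ : ℝ} {k T : Vec d → Vec d} {K : ℝ≥0} {Ω : Type*}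
  [MeasurableSpace Ω] {P : Measure Ω} [IsProbabilityMeasure P] {z₀ : Ω → Phase d}
  {G G' : ℕ → Ω → Vec d}

theorem measurable_shear_obaboChain (a b lam γ : ℝ) (hT : Continuous T) (hz₀ : Measurable z₀)
    (hG : ∀ i, Measurable (G i)) (hG' : ∀ i, Measurable (G' i)) (n : ℕ) :
    Measurable fun ω => shear a b (obaboChain T lam γ z₀ G G' n ω) :=
  (measurable_shear a b).comp (measurable_obaboChain hT.measurable lam γ hz₀ hG hG' n)

theorem satisfiesLSI_obaboChain (hp : ObaboParams a b γ m M lam) (hk : ContDiff ℝ 1 k)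
    (hmc : StronglyMonotoneCocoercive m (2 * M - m) k) (hz₀ : Measurable z₀)
    (hG : ∀ i, Measurable (G i)) (hG' : ∀ i, Measurable (G' i))
    (hGlaw : ∀ i, P.map (G i) = stdGaussian (Vec d))
    (hGlaw' : ∀ i, P.map (G' i) = stdGaussian (Vec d))
    (hindep : iIndepFun (fun i : ℕ ⊕ ℕ => Sum.elim G G' i) P)
    (hindep₀ : IndepFun z₀ (fun ω (i : ℕ ⊕ ℕ) => Sum.elim G G' i ω) P)
    (hC₀ : 0 ≤ C₀) (hLSI : SatisfiesLSI (P.map z₀) C₀)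
    (hC₁ : 4 * (1 - Real.exp (-(lam * γ / 2)) ^ 2) ≤ C₁) (n : ℕ) :
    SatisfiesLSI (P.map fun ω => shear a b (obaboChain k lam γ z₀ G G' n ω))
      ((1 - lam * (m * b / 3)) ^ n * √(1 + a) * C₀
        + (∑ i ∈ Finset.range n, (1 - lam * (m * b / 3)) ^ i) * C₁) := by
  set q := 1 - lam * (m * b / 3) with hq
  have hq₀ : 0 ≤ q := sub_nonneg.2 hp.rate_lt_one.le
  have hC₁₀ : 0 ≤ C₁ := by
    refine le_trans ?_ hC₁
    rw [← sq_sqrt_one_sub_exp_neg_sq (half_pos hp.lam_mul_γ_pos).le]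
    positivity
  induction n with
  | zero =>
    have := Measure.isProbabilityMeasure_map (μ := P) hz₀.aemeasurable
    have h := hLSI.map_lipschitz hC₀ (contDiff_shear a b)
      (lipschitzWith_shear hp.a_pos hp.a_le_half hp.four_b_sq_le)
    rw [Measure.map_map (measurable_shear a b) hz₀, ← NNReal.coe_pow, NNReal.sq_sqrt,
      Real.coe_toNNReal _ (Real.sqrt_nonneg _)] at h
    rwa [pow_zero, one_mul, Finset.range_zero, Finset.sum_empty, zero_mul, add_zero]
  | succ n ih =>
    have hkm := hk.continuous.measurable
    have hGG' : IndepFun (G n) (G' n) P :=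
      hindep.indepFun (i := Sum.inl n) (j := Sum.inr n) Sum.inl_ne_inr
    refine (ih.shear_obaboStep hp hk hmc (measurable_obaboChain hkm lam γ hz₀ hG hG' n)
      (hG n) (hG' n) (hGlaw n) (hGlaw' n) hGG'
      (indepFun_obaboChain hkm lam γ hz₀ hG hG' hindep hindep₀ n) (by positivity)).mono ?_
    rw [geom_sum_succ, pow_succ' q, ← hq]
    linarith

theorem satisfiesLSI_obaboChain_of_lipschitzWith [NeZero d] (hp : ObaboParams a b γ m M lam)
    (hT : LipschitzWith K T)
    (hae : ∀ᵐ x, StronglyMonotoneCocoercive m (2 * M - m) (fderiv ℝ T x)) (hz₀ : Measurable z₀)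
    (hG : ∀ i, Measurable (G i)) (hG' : ∀ i, Measurable (G' i))
    (hGlaw : ∀ i, P.map (G i) = stdGaussian (Vec d))
    (hGlaw' : ∀ i, P.map (G' i) = stdGaussian (Vec d))
    (hindep : iIndepFun (fun i : ℕ ⊕ ℕ => Sum.elim G G' i) P)
    (hindep₀ : IndepFun z₀ (fun ω (i : ℕ ⊕ ℕ) => Sum.elim G G' i ω) P)
    (hLSI : SatisfiesLSI (P.map z₀) C₀)
    (hC₁ : 4 * (1 - Real.exp (-(lam * γ / 2)) ^ 2) ≤ C₁) (n : ℕ) :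
    SatisfiesLSI (P.map fun ω => shear a b (obaboChain T lam γ z₀ G G' n ω))
      ((1 - lam * (m * b / 3)) ^ n * √(1 + a) * C₀
        + (∑ i ∈ Finset.range n, (1 - lam * (m * b / 3)) ^ i) * C₁) := by
  have := Measure.isProbabilityMeasure_map (μ := P) hz₀.aemeasurable
  have : Nontrivial (Phase d) := (WithLp.toLp_injective 2).nontrivial
  obtain ⟨k, hk, hmc, hlim⟩ :=
    exists_seq_contDiff_tendstoUniformly hT (by linarith [hp.m_le, hp.M_pos]) hae
  exact satisfiesLSI_of_tendsto
    (fun j => measurable_shear_obaboChain a b lam γ (hk j).continuous hz₀ hG hG' n)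
    (measurable_shear_obaboChain a b lam γ hT.continuous hz₀ hG hG' n)
    (fun ω => ((contDiff_shear a b).continuous.tendsto _).comp
      (tendsto_obaboChain hT.continuous hlim lam γ z₀ G G' n ω))
    fun j => satisfiesLSI_obaboChain hp (hk j) (hmc j) hz₀ hG hG' hGlaw hGlaw' hindep hindep₀
      hLSI.nonneg hLSI hC₁ n

end ObaboChain

theorem mainTheorem5_general {d : ℕ} {u : Vec d → ℝ} {m L l : ℝ} (hu : Differentiable ℝ u)
    (hm : 0 < m)
    (hconv : ∀ x y : Vec d, m * ‖x - y‖ ^ 2 ≤ inner ℝ (gradient u x - gradient u y) (x - y))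
    (hlip : LocallyLipschitz (gradient u))
    {lam gam M : ℝ} (hρ : 0 < tamingRadius m L l lam) (hlam : 0 < lam)
    (hM : (lipConst (tamedDrift (gradient u) m L l lam) : ℝ) ≤ M) (hM2 : 2 ≤ M)
    (hgam : 2 * √M ≤ gam) (hstep : lam ≤ m / (33 * gam ^ 3))
    {a b κ r C₁ : ℝ} (ha : a = 1 / M) (hb : b = 1 / gam) (hκ : κ = m / (3 * gam))
    (hr : r = √(1 - lam * κ)) (hC₁ : C₁ = 8 * √(1 - Real.exp (-(2 * lam * gam))))
    {Ω : Type*} [MeasurableSpace Ω] {P : Measure Ω} [IsProbabilityMeasure P]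
    {z₀ : Ω → Phase d} {G G' : ℕ → Ω → Vec d} (hz₀ : Measurable z₀)
    (hGm : ∀ k, Measurable (G k)) (hGm' : ∀ k, Measurable (G' k))
    (hG : ∀ k, P.map (G k) = stdGaussian (Vec d))
    (hG' : ∀ k, P.map (G' k) = stdGaussian (Vec d))
    (hindep : iIndepFun (fun i : ℕ ⊕ ℕ => Sum.elim G G' i) P)
    (hindep₀ : IndepFun z₀ (fun ω (i : ℕ ⊕ ℕ) => Sum.elim G G' i ω) P)
    {C₀ : ℝ} (hLSI : SatisfiesLSI (P.map z₀) C₀) (n : ℕ) :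
    SatisfiesLSI
      (P.map fun ω =>
        shear a b (obaboChain (tamedDrift (gradient u) m L l lam) lam gam z₀ G G' n ω))
      ((1 - lam * κ) ^ n * √(1 + a) * C₀ + (1 - r ^ (2 * n)) / (1 - r ^ 2) * C₁) := by
  have hT : LipschitzWith M.toNNReal (tamedDrift (gradient u) m L l lam) :=
    (lipschitzWith_lipConst_tamedDrift hlip hρ).weaken (NNReal.le_toNNReal_of_coe_le hM)
  rcases eq_zero_or_neZero d with rfl | _
  · have : Subsingleton (Phase 0) := (WithLp.ofLp_injective 2).subsingleton
    have := Measure.isProbabilityMeasure_map (μ := P)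
      (measurable_shear_obaboChain a b lam gam hT.continuous hz₀ hGm hGm' n).aemeasurable
    exact satisfiesLSI_of_subsingleton
  have hae := ae_stronglyMonotoneCocoercive_fderiv_tamedDrift hu hlip hm hρ hconv hT
  rw [Real.coe_toNNReal M (by linarith)] at hae
  obtain ⟨x, hx⟩ := hae.exists
  have hp := ObaboParams.of_step_le hm (by linarith [hx.le hm]) hM2 hgam hlam hstep
  rw [← ha, ← hb] at hp
  obtain rfl : κ = m * b / 3 := by rw [hκ, hb]; ring
  have hr_sq : r ^ 2 = 1 - lam * (m * b / 3) :=
    hr ▸ Real.sq_sqrt (sub_nonneg.2 hp.rate_lt_one.le)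
  rw [pow_mul, hr_sq, ← mul_neg_geom_sum, mul_div_cancel_left₀ _ (by linarith [hp.rate_pos])]
  refine satisfiesLSI_obaboChain_of_lipschitzWith hp hT hae hz₀ hGm hGm' hG hG' hindep hindep₀ hLSI
    ?_ n
  rw [hC₁, mul_assoc]
  exact four_mul_one_sub_exp_neg_sq_le hp.lam_mul_γ_pos.le

theorem mainTheorem5 {d : ℕ} (u : Vec d → ℝ) (m L l : ℝ)
    -- standing assumptions on the potential, `h = ∇u`
    (hu : Differentiable ℝ u) (hm : 0 < m) (hL : 0 < L) (hl : 0 < l)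
    (hconv : ∀ x y : Vec d, 2 * m * ‖x - y‖ ^ 2 ≤ inner ℝ (gradient u x - gradient u y) (x - y))
    (hlip : ∀ x y : Vec d,
      ‖gradient u x - gradient u y‖ ≤ L * (1 + ‖x‖ + ‖y‖) ^ l * ‖x - y‖)
    -- step size, friction, Lipschitz constant of the tamed drift
    (lam gam M : ℝ) (hlam : 0 < lam)
    (hM : (lipConst (tamedDrift (gradient u) m L l lam) : ℝ) ≤ M) (hM2 : 2 ≤ M)
    (hgam : 2 * √M ≤ gam) (hstep : lam ≤ m / (33 * gam ^ 3))
    (a b κ r C₁ : ℝ) (ha : a = 1 / M) (hb : b = 1 / gam) (hκ : κ = m / (3 * gam))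
    (hr : r = √(1 - lam * κ)) (hC₁ : C₁ = 8 * √(1 - Real.exp (-(2 * lam * gam))))
    -- initial condition and independent standard Gaussian inputs
    {Ω : Type*} [MeasurableSpace Ω] (P : Measure Ω) [IsProbabilityMeasure P]
    (z₀ : Ω → Phase d) (G G' : ℕ → Ω → Vec d) (hz₀ : Measurable z₀)
    (hGm : ∀ k, Measurable (G k)) (hGm' : ∀ k, Measurable (G' k))
    (hG : ∀ k, P.map (G k) = stdGaussian (Vec d))
    (hG' : ∀ k, P.map (G' k) = stdGaussian (Vec d))
    (hindep : iIndepFun (fun i : ℕ ⊕ ℕ => Sum.elim G G' i) P)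
    (hindep₀ : IndepFun z₀ (fun ω (i : ℕ ⊕ ℕ) => Sum.elim G G' i ω) P)
    (C₀ : ℝ) (hLSI : SatisfiesLSI (P.map z₀) C₀) (n : ℕ) :
    SatisfiesLSI
      (P.map fun ω =>
        shear a b (obaboChain (tamedDrift (gradient u) m L l lam) lam gam z₀ G G' n ω))
      ((1 - lam * κ) ^ n * √(1 + a) * C₀ + (1 - r ^ (2 * n)) / (1 - r ^ 2) * C₁) :=
  mainTheorem5_general hu hm (fun x y => le_trans (by gcongr; linarith) (hconv x y))
    (locallyLipschitz_of_norm_sub_le_rpow hlip) (tamingRadius_pos (by positivity) hlam) hlam hM hM2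
    hgam hstep ha hb hκ hr hC₁ hz₀ hGm hGm' hG hG' hindep hindep₀ hLSI n
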